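/- Let $\sigma>0$ and define weights $\beta_n>0$ by $\beta_0=1$, $\beta_{m+1}^2=\beta_m^2\,\frac{m+1}{m+\sigma}$ for $m\ge 0$. Let $\mathcal H_\beta$ be the weighted Hardy space of power series $f=\sum_{n\ge 0}a_nz^n$ with $\sum_n|a_n|^2\beta_n^2<\infty$. Let $N\ge 2$ and let $L=\sum_{k=0}^N p_k(z)D^k$, $D=d/dz$, be $\mathbb D$-regular, i.e. the coefficients $p_k$ are analytic on the closed unit disk and $p_N(z)\neq 0$ for $|z|=1$. Suppose that $p_N$ is an $R$-symmetric polynomial: it has degree at most $2N$, and for some $0\le M\le N$ its roots, listed with multiplicity, are nonzero numbers $z_1,\dots,z_M$ in the open unit disk, the point $0$ with multiplicity $N-M$, and $1/\overline{z_1},\dots,1/\overline{z_M}$. Let $\mathcal L$ be the maximal operator of $L$ in $\mathcal H_\beta$, that is $\mathcal Lf=Lf$ on the domain $\{f\in\mathcal H_\beta : Lf\in\mathcal H_\beta\}$. Then there are constants $C_1\in\mathbb C\setminus\{0\}$, $\tau>0$ and $C_2\in\mathbb C$ such that for every $\epsilon$ with $0<\epsilon<1$ there is a sequence $\{\mu_n\}_{n\in\mathbb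 Z}$ of complex numbers with $$\mu_n/C_1=(n/\tau+C_2)^N+O(|n|^{N-2+\epsilon})\qquad (|n|\to\infty)$$ such that each eigenvalue of $\mathcal L$ is an element of $\{\mu_n\}$. Moreover, there is an $R$ such that every eigenvalue $\lambda$ of $\mathcal L$ with $|\lambda|>R$ has algebraic multiplicity at most $2$, where the algebraic multiplicity of $\lambda$ is the dimension of $\bigcup_{j\ge 1}\ker(\mathcal L-\lambda I)^j$. -/

import Mathlib

open Polynomial

/-- The squares `β_n ^ 2` of the weights with parameter `σ`:
`β_0 ^ 2 = 1` and `β_{m+1} ^ 2 = β_m ^ 2 (m + 1) / (m + σ)`; in particular `β_1 ^ 2 = 1 / σ`. -/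
noncomputable def betaSq (σ : ℝ) : ℕ → ℝ
  | 0 => 1
  | m + 1 => betaSq σ m * ((m + 1) / (m + σ))

/-- The weighted Hardy space `H_β`: the power series `∑ a_n z ^ n` with
`∑ |a_n| ^ 2 β_n ^ 2 < ∞`. (For `σ > 0` the numbers `β_n ^ 2` are positive and the absolute value
around them has no effect.) -/
noncomputable def weightedHardy (σ : ℝ) : Submodule ℂ (PowerSeries ℂ) where
  carrier := {f | Summable fun n => ‖PowerSeries.coeff n f‖ ^ 2 * |betaSq σ n|}
  zero_mem' := by simp [summable_zero]
  add_mem' := by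
    intro f g hf hg
    refine Summable.of_nonneg_of_le (fun n => by positivity) (fun n => ?_)
      ((hf.mul_left 2).add (hg.mul_left 2))
    have h := norm_add_le (PowerSeries.coeff n f) (PowerSeries.coeff n g)
    have h2 : ‖PowerSeries.coeff n (f + g)‖ ^ 2 ≤
        2 * ‖PowerSeries.coeff n f‖ ^ 2 + 2 * ‖PowerSeries.coeff n g‖ ^ 2 := by
      rw [map_add]
      have h3 := norm_nonneg (PowerSeries.coeff n f + PowerSeries.coeff n g)
      nlinarith [sq_nonneg (‖PowerSeries.coeff n f‖ - ‖PowerSeries.coeff n g‖)]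
    calc _ ≤ (2 * ‖PowerSeries.coeff n f‖ ^ 2 + 2 * ‖PowerSeries.coeff n g‖ ^ 2) *
          |betaSq σ n| := mul_le_mul_of_nonneg_right h2 (abs_nonneg _)
      _ = _ := by ring
  smul_mem' := by
    intro c f hf
    have h := Summable.mul_left (‖c‖ ^ 2) hf
    refine h.congr (fun n => ?_)
    simp only [map_smul, smul_eq_mul, norm_mul]
    ring

/-- The Taylor series at `0` of a function. -/
noncomputable def taylorSeries (f : ℂ → ℂ) : PowerSeries ℂ :=
  PowerSeries.mk fun n => iteratedDeriv n f 0 / (n.factorial : ℂ)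

/-- The differential expression `L = ∑_{k=0}^N p_k(z) D ^ k`, `D = d/dz`, acting on power series
(products are Cauchy products, differentiation is termwise). -/
noncomputable def diffExpr (N : ℕ) (p : ℕ → ℂ → ℂ) : PowerSeries ℂ →ₗ[ℂ] PowerSeries ℂ :=
  ∑ k ∈ Finset.range (N + 1),
    LinearMap.mulLeft ℂ (taylorSeries (p k)) ∘ₗ
      ((PowerSeries.derivative ℂ).toLinearMap ^ k : Module.End ℂ (PowerSeries ℂ))

/-- The maximal operator of `L` in `H_β`: it acts by `L` on `{f ∈ H_β | L f ∈ H_β}`. -/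
noncomputable def maximalOperator (σ : ℝ) (N : ℕ) (p : ℕ → ℂ → ℂ) :
    weightedHardy σ →ₗ.[ℂ] weightedHardy σ where
  domain := (weightedHardy σ).comap (diffExpr N p ∘ₗ (weightedHardy σ).subtype)
  toFun := LinearMap.codRestrict (weightedHardy σ)
    ((diffExpr N p ∘ₗ (weightedHardy σ).subtype) ∘ₗ Submodule.subtype _) (fun f => f.2)

/-- `λ` is an eigenvalue of the (unbounded) operator `T`. -/
def IsEigenvalue {E : Type*} [AddCommGroup E] [Module ℂ E] (T : E →ₗ.[ℂ] E) (lam : ℂ) : Prop :=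
  ∃ f : T.domain, (f : E) ≠ 0 ∧ T f = lam • (f : E)

/-- The null space of `(T - λ) ^ j` with its natural domain, for an unbounded operator `T`. -/
def nullPow {E : Type*} [AddCommGroup E] [Module ℂ E] (T : E →ₗ.[ℂ] E) (lam : ℂ) :
    ℕ → Submodule ℂ E
  | 0 => ⊥
  | j + 1 => ((nullPow T lam j).comap (T.toFun - lam • T.domain.subtype)).map T.domain.subtype

/-- The algebraic multiplicity of `λ`: the dimension of the union over `j` of the null spaces
of `(T - λ) ^ j`. -/
noncomputable def algMultiplicity {E : Type*} [AddCommGroup E] [Module ℂ E]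
    (T : E →ₗ.[ℂ] E) (lam : ℂ) : Cardinal :=
  Module.rank ℂ (⨆ j : ℕ, nullPow T lam j : Submodule ℂ E)

/-- `L = ∑_{k=0}^N p_k(z) D ^ k` is `𝔻`-regular: the coefficients are analytic on the closed unit
disk, and the leading one has no zeros on the unit circle. -/
def IsDRegular (N : ℕ) (p : ℕ → ℂ → ℂ) : Prop :=
  (∀ k ≤ N, AnalyticOnNhd ℂ (p k) (Metric.closedBall 0 1)) ∧ ∀ z : ℂ, ‖z‖ = 1 → p N z ≠ 0

/-- `P` is `R`-symmetric (with respect to `N`): it has degree at most `2N`, and its roots, with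
multiplicity, are nonzero `z_1, …, z_M` in the open unit disk (`M ≤ N`), the point `0` with
multiplicity `N - M`, and the reflected points `1 / conj z_1, …, 1 / conj z_M`. -/
def IsRSymmetric (N : ℕ) (P : ℂ[X]) : Prop :=
  P ≠ 0 ∧ P.natDegree ≤ 2 * N ∧
    ∃ s : Multiset ℂ, s.card ≤ N ∧ (∀ z ∈ s, z ≠ 0 ∧ ‖z‖ < 1) ∧
      P.roots = s + Multiset.replicate (N - s.card) 0 +
        s.map (fun z => 1 / (starRingEnd ℂ) z)

/-! Everything happens on the unit circle. A function in `H_β` has coefficients of at most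
polynomial growth. If it is a root vector of the maximal operator, it solves a linear differential
equation whose leading coefficient has no zeros in an annulus inside the circle. Gronwall's
inequality along radii bounds the solution and, after differentiating the equation, all its
derivatives (`mem_smoothSeries_of_ode`). Hence root vectors are smooth up to the circle, and by the
maximum principle they are determined by their boundary values.

On the circle an `R`-symmetric polynomial is `C z ^ N w` with `w > 0`. In the angular coordinate `x`
with density proportional to `w ^ (-1/N)`, the leading part of `L` becomes `C₁ δ ^ N` with `δ = -i
d/dx` (`exists_circleDensity`). Conjugation by a nowhere vanishing function turns the term of order
`N - 1` into a constant multiple, so that `L` becomes `C₁` times `(δ + α) ^ N` plus terms of order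
at most `N - 2` (`exists_normal_form`). In the Fourier coordinates of `x` this is the diagonal
operator with entries `(n + α) ^ N`, perturbed by something of size `|n| ^ (N - 2)`.

Large diagonal entries are separated by gaps of size `|n| ^ (N - 1)`, except that two of them may
coincide when `m + n + 2 α = 0` (`exists_separation`). The gaps beat the perturbation. Instead of
resolvents, a cone argument is used: a vector whose coordinates in `I` vanish, where `I` indexes the
entries near `l`, is expanded by powers of `A - l` faster than a vector annihilated by a polynomial
in `A` with roots near `l` can grow (`cone_step`, `exists_growth_bound`,
`eq_zero_of_aeval_eq_zero`). So the sum of root spaces near `l` embeds into the coordinates in `I`.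

With `I` a set of coinciding entries this bounds multiplicities by two
(`exists_multiplicity_bound`). Together with one large disc about `0`, it gives the counting
inequalities that allow Hall's marriage theorem to assign distinct integers to distinct eigenvalues
(`exists_enumeration`). Only upper bounds on the number of eigenvalues are needed, since integers
left over receive the unperturbed entry. -/

/-! ### Square summable two-sided sequences and their restrictions. -/

/-- Square summability of a two-sided sequence. -/
def SqSummable (v : ℤ → ℂ) : Prop := Summable fun n => ‖v n‖ ^ 2

/-- The `ℓ²` norm of a two-sided sequence. -/
noncomputable def l2 (v : ℤ → ℂ) : ℝ := Real.sqrt (∑' n, ‖v n‖ ^ 2)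

theorem l2_nonneg (v : ℤ → ℂ) : 0 ≤ l2 v := Real.sqrt_nonneg _

theorem SqSummable.mono {v w : ℤ → ℂ} {c : ℝ} (hw : SqSummable w)
    (h : ∀ n, ‖v n‖ ≤ c * ‖w n‖) : SqSummable v := by
  refine Summable.of_nonneg_of_le (fun n => by positivity) (fun n => ?_) (hw.mul_left (c ^ 2))
  rw [← mul_pow]
  exact pow_le_pow_left₀ (norm_nonneg _) (h n) 2

theorem l2_mono {v w : ℤ → ℂ} {c : ℝ} (hc : 0 ≤ c) (hw : SqSummable w)
    (h : ∀ n, ‖v n‖ ≤ c * ‖w n‖) : l2 v ≤ c * l2 w := by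
  unfold l2
  rw [← Real.sqrt_sq hc, ← Real.sqrt_mul (sq_nonneg c), ← tsum_mul_left]
  refine Real.sqrt_le_sqrt ((hw.mono h).tsum_le_tsum (fun n => ?_) (hw.mul_left (c ^ 2)))
  rw [← mul_pow]
  exact pow_le_pow_left₀ (norm_nonneg _) (h n) 2

theorem l2_mono' {v w : ℤ → ℂ} (hw : SqSummable w) (h : ∀ n, ‖v n‖ ≤ ‖w n‖) : l2 v ≤ l2 w := by
  simpa using l2_mono zero_le_one hw (fun n => by simpa using h n)

theorem SqSummable.add_and {v w : ℤ → ℂ} (hv : SqSummable v) (hw : SqSummable w) :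
    SqSummable (fun n => v n + w n) ∧ l2 (fun n => v n + w n) ≤ l2 v + l2 w := by
  have key := Real.Lp_add_le_tsum_of_nonneg (f := fun n => ‖v n‖) (g := fun n => ‖w n‖)
    (p := 2) (by norm_num) (fun _ => norm_nonneg _) (fun _ => norm_nonneg _)
    (by simpa [SqSummable] using hv) (by simpa [SqSummable] using hw)
  simp only [Real.rpow_two, ← Real.sqrt_eq_rpow] at key
  have hle : ∀ n, ‖v n + w n‖ ^ 2 ≤ (‖v n‖ + ‖w n‖) ^ 2 := fun n =>
    pow_le_pow_left₀ (norm_nonneg _) (norm_add_le _ _) 2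
  have hs : SqSummable (fun n => v n + w n) :=
    Summable.of_nonneg_of_le (fun n => by positivity) hle key.1
  exact ⟨hs, (Real.sqrt_le_sqrt (hs.tsum_le_tsum hle key.1)).trans key.2⟩

theorem SqSummable.add {v w : ℤ → ℂ} (hv : SqSummable v) (hw : SqSummable w) :
    SqSummable (fun n => v n + w n) := (hv.add_and hw).1

theorem l2_add_le {v w : ℤ → ℂ} (hv : SqSummable v) (hw : SqSummable w) :
    l2 (fun n => v n + w n) ≤ l2 v + l2 w := (hv.add_and hw).2

theorem SqSummable.const_mul {v : ℤ → ℂ} (hv : SqSummable v) (c : ℂ) :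
    SqSummable (fun n => c * v n) := hv.mono (c := ‖c‖) fun n => by rw [norm_mul]

theorem SqSummable.sub {v w : ℤ → ℂ} (hv : SqSummable v) (hw : SqSummable w) :
    SqSummable (fun n => v n - w n) := by
  simpa [sub_eq_add_neg] using hv.add (hw.const_mul (-1))

theorem norm_le_l2 {v : ℤ → ℂ} (hv : SqSummable v) (n : ℤ) : ‖v n‖ ≤ l2 v :=
  Real.le_sqrt_of_sq_le (hv.le_tsum n fun _ _ => by positivity)

open Classical in
/-- The restriction of a sequence to a set of indices. -/
noncomputable def cut (I : Set ℤ) (v : ℤ → ℂ) : ℤ → ℂ := fun n => if n ∈ I then v n else 0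

theorem norm_cut_le (I : Set ℤ) (v : ℤ → ℂ) (n : ℤ) : ‖cut I v n‖ ≤ ‖v n‖ := by
  unfold cut; split_ifs <;> simp

theorem SqSummable.cut {v : ℤ → ℂ} (hv : SqSummable v) (I : Set ℤ) : SqSummable (cut I v) :=
  hv.mono (c := 1) fun n => by simpa using norm_cut_le I v n

theorem l2_cut_le {v : ℤ → ℂ} (hv : SqSummable v) (I : Set ℤ) : l2 (cut I v) ≤ l2 v :=
  l2_mono' hv fun n => norm_cut_le I v n

theorem l2_le_cut_add_cut {v : ℤ → ℂ} (hv : SqSummable v) (I : Set ℤ) :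
    l2 v ≤ l2 (cut I v) + l2 (cut Iᶜ v) := by
  refine le_trans (le_of_eq ?_) (l2_add_le (hv.cut I) (hv.cut Iᶜ))
  congr 1
  funext n
  by_cases h : n ∈ I <;> simp [_root_.cut, h]

theorem l2_cut_mono {I : Set ℤ} {v w : ℤ → ℂ} {c : ℝ} (hc : 0 ≤ c) (hw : SqSummable w)
    (h : ∀ n ∈ I, ‖v n‖ ≤ c * ‖w n‖) : l2 (cut I v) ≤ c * l2 (cut I w) := by
  refine l2_mono hc (hw.cut I) fun n => ?_
  by_cases hn : n ∈ I
  · simpa [cut, hn] using h n hn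
  · simp [cut, hn]

theorem l2_cut_add_le {I : Set ℤ} {u v w : ℤ → ℂ} (hv : SqSummable v) (hw : SqSummable w)
    (h : ∀ n, u n = v n + w n) : l2 (cut I u) ≤ l2 (cut I v) + l2 (cut I w) := by
  refine le_trans (le_of_eq ?_) (l2_add_le (hv.cut I) (hw.cut I))
  congr 1
  funext n
  by_cases hn : n ∈ I <;> simp [cut, hn, h]

/-! ### The cone argument for perturbed diagonal operators. -/

section Cone

variable {V : Type*} [AddCommGroup V] [Module ℂ V]

/-- If `T` is, up to a perturbation dominated by the weights `q`, diagonal with entries `w` that are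
small on `I` and large off `I`, then it preserves the cone of vectors dominated by their
components off `I`, and expands these components. -/
theorem cone_step {T : Module.End ℂ V} {c : ℤ → V →ₗ[ℂ] ℂ} {w : ℤ → ℂ} {q : ℤ → ℝ} {I : Set ℤ}
    {r' s' η ε : ℝ} (hq0 : ∀ n, 0 ≤ q n)
    (hc : ∀ u, SqSummable fun n => c n u) (hw : ∀ u, SqSummable fun n => w n * c n u)
    (hq : ∀ u, SqSummable fun n => (q n : ℂ) * c n u)
    (hd : ∀ u, l2 (fun n => c n (T u) - w n * c n u) ≤ l2 (fun n => (q n : ℂ) * c n u))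
    (hr' : 0 ≤ r') (hs' : 0 < s') (hη : 0 ≤ η) (hε : 0 ≤ ε) (hε2 : ε ≤ 1 / 2)
    (hin : ∀ n ∈ I, ‖w n‖ ≤ r' ∧ q n ≤ η) (hout : ∀ n ∈ Iᶜ, s' ≤ ‖w n‖ ∧ q n ≤ ε * ‖w n‖)
    (hgap : r' ≤ (1 - 2 * ε) * s' - 2 * η) {u : V}
    (hu : l2 (cut I fun n => c n u) ≤ l2 (cut Iᶜ fun n => c n u)) :
    l2 (cut I fun n => c n (T u)) ≤ l2 (cut Iᶜ fun n => c n (T u)) ∧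
      ((1 - ε) * s' - η) * l2 (cut Iᶜ fun n => c n u) ≤ l2 (cut Iᶜ fun n => c n (T u)) := by
  set a := l2 (cut I fun n => c n u) with ha
  set b := l2 (cut Iᶜ fun n => c n u) with hb
  set g := l2 (cut Iᶜ fun n => w n * c n u) with hg
  set D := l2 (fun n => c n (T u) - w n * c n u) with hD
  have hdS : SqSummable (fun n => c n (T u) - w n * c n u) := (hc _).sub (hw u)
  have hgb : s' * b ≤ g := by
    have h : b ≤ s'⁻¹ * g := l2_cut_mono (inv_nonneg.2 hs'.le) (hw u) fun n hn => by
      rw [norm_mul, ← mul_assoc]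
      refine le_mul_of_one_le_left (norm_nonneg _) ?_
      rw [inv_mul_eq_div, one_le_div hs']
      exact (hout n hn).1
    rwa [inv_mul_eq_div, le_div_iff₀' hs'] at h
  -- The perturbation is measured against the vector itself on `I`, but against its image under the
  -- diagonal part off `I`; the latter allows unbounded weights.
  have hDle : D ≤ η * a + ε * g := by
    refine (hd u).trans ((l2_le_cut_add_cut (hq u) I).trans (add_le_add ?_ ?_))
    · refine l2_cut_mono hη (hc u) fun n hn => ?_
      rw [norm_mul, Complex.norm_real, Real.norm_of_nonneg (hq0 n)]
      exact mul_le_mul_of_nonneg_right (hin n hn).2 (norm_nonneg _)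
    · refine l2_cut_mono hε (hw u) fun n hn => ?_
      rw [norm_mul, norm_mul, Complex.norm_real, Real.norm_of_nonneg (hq0 n), ← mul_assoc]
      exact mul_le_mul_of_nonneg_right (hout n hn).2 (norm_nonneg _)
  have hin' : l2 (cut I fun n => c n (T u)) ≤ r' * a + D := by
    refine (l2_cut_add_le (hw u) hdS (fun n => by ring)).trans (add_le_add ?_ (l2_cut_le hdS I))
    refine l2_cut_mono hr' (hc u) fun n hn => ?_
    rw [norm_mul]
    exact mul_le_mul_of_nonneg_right (hin n hn).1 (norm_nonneg _)
  have hout' : g ≤ l2 (cut Iᶜ fun n => c n (T u)) + D := by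
    refine (l2_cut_add_le (hc (T u)) (hdS.const_mul (-1)) (fun n => by ring)).trans
      (add_le_add le_rfl ?_)
    refine (l2_cut_le (hdS.const_mul (-1)) _).trans (l2_mono' hdS fun n => ?_)
    rw [neg_one_mul, norm_neg]
  have hb0 : 0 ≤ b := l2_nonneg _
  have ha0 : 0 ≤ a := l2_nonneg _
  have h1 : r' * a ≤ r' * b := mul_le_mul_of_nonneg_left hu hr'
  have h2 : η * a ≤ η * b := mul_le_mul_of_nonneg_left hu hη
  have h3 : (1 - 2 * ε) * (s' * b) ≤ (1 - 2 * ε) * g :=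
    mul_le_mul_of_nonneg_left hgb (by linarith)
  have h4 : (1 - ε) * (s' * b) ≤ (1 - ε) * g :=
    mul_le_mul_of_nonneg_left hgb (by linarith)
  -- On the cone, the image has inner norm at most `(r' + η) b + ε g` and outer norm at least `(1 -
  -- ε) g - η b`. With `s' b ≤ g`, the gap hypothesis is exactly what orders these two.
  have h5 : r' * b ≤ ((1 - 2 * ε) * s' - 2 * η) * b := mul_le_mul_of_nonneg_right hgap hb0
  constructor <;> nlinarith

/-- Powers of an operator grow on the kernel of a polynomial at most like powers of any bound
exceeding the moduli of the roots. -/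
theorem exists_growth_bound {T : Module.End ℂ V} {f : V → ℝ}
    (hadd : ∀ u v, f (u + v) ≤ f u + f v) (hsmul : ∀ (z : ℂ) u, f (z • u) ≤ ‖z‖ * f u)
    (hf0 : ∀ u, 0 ≤ f u) {r s : ℝ} (hr : 0 ≤ r) (hrs : r < s) (S : Multiset ℂ) :
    (∀ z ∈ S, ‖z‖ ≤ r) → ∀ u, aeval T ((S.map fun z => X - C z).prod) u = 0 →
      ∃ B : ℝ, ∀ j : ℕ, f ((T ^ j) u) ≤ B * s ^ j := by
  have hs : 0 < s := hr.trans_lt hrs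
  induction S using Multiset.induction with
  | empty =>
    intro _ u hu
    have hu0 : u = 0 := by simpa using hu
    refine ⟨0, fun j => ?_⟩
    have := hsmul 0 ((T ^ j) u)
    simp only [zero_smul, norm_zero, zero_mul] at this
    simpa [hu0] using this
  | cons z S ih =>
    intro hS u hu
    rw [Multiset.map_cons, Multiset.prod_cons, mul_comm, map_mul, Module.End.mul_apply] at hu
    obtain ⟨B, hB⟩ := ih (fun y hy => hS y (Multiset.mem_cons_of_mem hy)) _ hu
    have hz := hS z (Multiset.mem_cons_self z S)
    -- The recursion is `x (j + 1) ≤ r x j + B s ^ j`. A constant `M` with `B ≤ (s - r) M`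
    -- propagates the bound `M s ^ j`, and `f u ≤ M` starts it.
    refine ⟨max (f u) (B / (s - r)), fun j => ?_⟩
    induction j with
    | zero => simp
    | succ j ihj =>
      have e : (T ^ (j + 1)) u = z • (T ^ j) u + (T ^ j) (aeval T (X - C z) u) := by
        simp [pow_succ, Module.End.mul_apply, Module.algebraMap_end_apply]
      have h1 : f ((T ^ (j + 1)) u) ≤ r * f ((T ^ j) u) + B * s ^ j := by
        rw [e]
        refine (hadd _ _).trans (add_le_add ((hsmul _ _).trans ?_) (hB j))
        exact mul_le_mul_of_nonneg_right hz (hf0 _)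
      have h2 : B ≤ (s - r) * max (f u) (B / (s - r)) := by
        rw [← div_le_iff₀' (by linarith)]
        exact le_max_right _ _
      have h3 := mul_le_mul_of_nonneg_left ihj hr
      have h4 := mul_le_mul_of_nonneg_right h2 (pow_pos hs j).le
      rw [pow_succ s]
      nlinarith

/-- In the situation of `cone_step`, a vector annihilated by a polynomial in `T` with roots of
modulus at most `r` is determined by its components in `I`. -/
theorem eq_zero_of_aeval_eq_zero {T : Module.End ℂ V} {c : ℤ → V →ₗ[ℂ] ℂ} {w : ℤ → ℂ} {q : ℤ → ℝ}
    {I : Set ℤ} {r r' s' η ε : ℝ} (hq0 : ∀ n, 0 ≤ q n)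
    (hc : ∀ u, SqSummable fun n => c n u) (hw : ∀ u, SqSummable fun n => w n * c n u)
    (hq : ∀ u, SqSummable fun n => (q n : ℂ) * c n u)
    (hd : ∀ u, l2 (fun n => c n (T u) - w n * c n u) ≤ l2 (fun n => (q n : ℂ) * c n u))
    (hinj : ∀ u, (∀ n, c n u = 0) → u = 0)
    (hr : 0 ≤ r) (hr' : 0 ≤ r') (hs' : 0 < s') (hη : 0 ≤ η) (hε : 0 ≤ ε) (hε2 : ε ≤ 1 / 2)
    (hin : ∀ n ∈ I, ‖w n‖ ≤ r' ∧ q n ≤ η) (hout : ∀ n ∈ Iᶜ, s' ≤ ‖w n‖ ∧ q n ≤ ε * ‖w n‖)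
    (hgap : r' ≤ (1 - 2 * ε) * s' - 2 * η) (hrs : r < (1 - ε) * s' - η)
    (S : Multiset ℂ) (hS : ∀ z ∈ S, ‖z‖ ≤ r) {u : V}
    (hu : aeval T ((S.map fun z => X - C z).prod) u = 0) (huI : ∀ n ∈ I, c n u = 0) : u = 0 := by
  set s := (1 - ε) * s' - η with hsdef
  -- The annihilating polynomial gives growth at most `B t ^ j`, the cone gives growth at least `s ^
  -- j`; with `t < s` both can hold only if the components off `I` vanish.
  obtain ⟨t, hrt, hts⟩ := exists_between hrs
  have hs0 : 0 < s := hr.trans_lt hrs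
  obtain ⟨B, hB⟩ := exists_growth_bound (T := T) (f := fun u => l2 (cut Iᶜ fun n => c n u))
    (fun u v => l2_cut_add_le (hc u) (hc v) fun n => by simp)
    (fun z u => l2_cut_mono (norm_nonneg z) (hc u) fun n _ => by simp)
    (fun u => l2_nonneg _) hr hrt S hS u hu
  have hin0 : l2 (cut I fun n => c n u) = 0 := by
    have : cut I (fun n => c n u) = fun _ => 0 := by
      funext n
      by_cases hn : n ∈ I <;> simp [cut, hn]
      exact huI n hn
    rw [this]; simp [l2]
  have grow : ∀ j : ℕ, l2 (cut I fun n => c n ((T ^ j) u)) ≤ l2 (cut Iᶜ fun n => c n ((T ^ j) u)) ∧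
      s ^ j * l2 (cut Iᶜ fun n => c n u) ≤ l2 (cut Iᶜ fun n => c n ((T ^ j) u)) := by
    intro j
    induction j with
    | zero => simpa [hin0] using l2_nonneg _
    | succ j ih =>
      have h := cone_step hq0 hc hw hq hd hr' hs' hη hε hε2 hin hout hgap ih.1
      rw [pow_succ' T, Module.End.mul_apply]
      refine ⟨h.1, le_trans ?_ h.2⟩
      rw [pow_succ', mul_assoc]
      exact mul_le_mul_of_nonneg_left ih.2 hs0.le
  have hz : l2 (cut Iᶜ fun n => c n u) = 0 := by
    by_contra hne
    have hpos : 0 < l2 (cut Iᶜ fun n => c n u) := lt_of_le_of_ne (l2_nonneg _) (Ne.symm hne)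
    have ht0 : 0 < t := hr.trans_lt hrt
    have hlim : Filter.Tendsto (fun j : ℕ => B * (t / s) ^ j) Filter.atTop (nhds (B * 0)) :=
      (tendsto_pow_atTop_nhds_zero_of_lt_one (by positivity) ((div_lt_one hs0).2 hts)).const_mul B
    rw [mul_zero] at hlim
    refine absurd (ge_of_tendsto' hlim fun j => ?_) (not_le.2 hpos)
    have h := (grow j).2.trans (hB j)
    rw [div_pow, mul_div_assoc', le_div_iff₀ (by positivity)]
    linarith
  refine hinj u fun n => ?_
  by_cases hn : n ∈ I
  · exact huI n hn
  · have h := norm_le_l2 ((hc u).cut Iᶜ) n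
    rw [hz] at h
    simpa [cut, hn] using h

end Cone

/-! ### Separation of powers of integer translates. -/

/-- Only the integer nearest to `-Re x` can make the sum smaller than `1/2`, so the nonzero values
have a positive minimum. Capping it at `1` lets the same constant bound differences of distinct
integers. -/
theorem exists_pos_le_norm_int_add (x : ℂ) :
    ∃ γ : ℝ, 0 < γ ∧ γ ≤ 1 ∧ ∀ k : ℤ, (k : ℂ) + x = 0 ∨ γ ≤ ‖(k : ℂ) + x‖ := by
  have far : ∀ k : ℤ, k ≠ round (-x.re) → 1 / 2 ≤ ‖(k : ℂ) + x‖ := by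
    intro k hk
    have h1 := abs_sub_round (-x.re)
    have h2 : (1 : ℝ) ≤ |(k : ℝ) - round (-x.re)| := by
      exact_mod_cast Int.one_le_abs (sub_ne_zero.2 hk)
    have h3 := Complex.abs_re_le_norm ((k : ℂ) + x)
    have h4 : (k : ℝ) - round (-x.re) = ((k : ℂ) + x).re + (-x.re - round (-x.re)) := by
      simp
      ring
    have h5 := abs_add_le (((k : ℂ) + x).re) (-x.re - round (-x.re))
    rw [← h4] at h5
    linarith
  by_cases h0 : ((round (-x.re) : ℤ) : ℂ) + x = 0
  · refine ⟨1 / 2, by norm_num, by norm_num, fun k => ?_⟩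
    by_cases hk : k = round (-x.re)
    · exact Or.inl (hk ▸ h0)
    · exact Or.inr (far k hk)
  · refine ⟨min (1 / 2) ‖((round (-x.re) : ℤ) : ℂ) + x‖, lt_min (by norm_num) (norm_pos_iff.2 h0),
      (min_le_left _ _).trans (by norm_num), fun k => Or.inr ?_⟩
    by_cases hk : k = round (-x.re)
    · exact hk ▸ min_le_right _ _
    · exact (min_le_left _ _).trans (far k hk)

theorem norm_pow_sub_norm_pow_le {z : ℂ} {η : ℝ} (hz : ‖z - (‖z‖ : ℂ)‖ ≤ η * ‖z‖) (i : ℕ) :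
    ‖z ^ i - (‖z‖ : ℂ) ^ i‖ ≤ i * η * ‖z‖ ^ i := by
  induction i with
  | zero => simp
  | succ i ih =>
    have e : z ^ (i + 1) - (‖z‖ : ℂ) ^ (i + 1) =
        (z ^ i - (‖z‖ : ℂ) ^ i) * z + (‖z‖ : ℂ) ^ i * (z - (‖z‖ : ℂ)) := by ring
    rw [e]
    refine (norm_add_le _ _).trans ?_
    rw [norm_mul, norm_mul, norm_pow, Complex.norm_real, norm_norm]
    have h1 := mul_le_mul_of_nonneg_right ih (norm_nonneg z)
    have h2 := mul_le_mul_of_nonneg_left hz (pow_nonneg (norm_nonneg z) i)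
    push_cast
    rw [pow_succ]
    nlinarith

theorem half_norm_le_re_pow_mul_pow {z w : ℂ} {η : ℝ} (hz : ‖z - (‖z‖ : ℂ)‖ ≤ η * ‖z‖)
    (hw : ‖w - (‖w‖ : ℂ)‖ ≤ η * ‖w‖) {i j : ℕ} (hη : ((i + j : ℕ) : ℝ) * η ≤ 1 / 2) :
    1 / 2 * (‖z‖ ^ i * ‖w‖ ^ j) ≤ (z ^ i * w ^ j).re := by
  have e : z ^ i * w ^ j - (‖z‖ : ℂ) ^ i * (‖w‖ : ℂ) ^ j =
      (z ^ i - (‖z‖ : ℂ) ^ i) * w ^ j + (‖z‖ : ℂ) ^ i * (w ^ j - (‖w‖ : ℂ) ^ j) := by ring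
  have h1 : ‖z ^ i * w ^ j - (‖z‖ : ℂ) ^ i * (‖w‖ : ℂ) ^ j‖ ≤ 1 / 2 * (‖z‖ ^ i * ‖w‖ ^ j) := by
    rw [e]
    refine (norm_add_le _ _).trans ?_
    rw [norm_mul, norm_mul, norm_pow, norm_pow, Complex.norm_real, norm_norm]
    have h2 := mul_le_mul_of_nonneg_right (norm_pow_sub_norm_pow_le hz i)
      (pow_nonneg (norm_nonneg w) j)
    have h3 := mul_le_mul_of_nonneg_left (norm_pow_sub_norm_pow_le hw j)
      (pow_nonneg (norm_nonneg z) i)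
    have h4 := mul_le_mul_of_nonneg_right hη
      (mul_nonneg (pow_nonneg (norm_nonneg z) i) (pow_nonneg (norm_nonneg w) j))
    push_cast at h4
    nlinarith
  have h2 := (abs_le.1 ((Complex.abs_re_le_norm _).trans h1)).1
  have h3 : ((‖z‖ : ℂ) ^ i * (‖w‖ : ℂ) ^ j).re = ‖z‖ ^ i * ‖w‖ ^ j := by
    rw [← Complex.ofReal_pow, ← Complex.ofReal_pow, ← Complex.ofReal_mul, Complex.ofReal_re]
  rw [Complex.sub_re, h3] at h2
  linarith

/-- In `z ^ N - w ^ N = (∑ z ^ i w ^ (N - 1 - i)) (z - w)` every summand is nearly positive real, so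
nothing cancels and the real part of the sum is at least that of the extreme term formed from the
larger number. -/
theorem half_max_pow_mul_norm_sub_le {N : ℕ} (hN : 1 ≤ N) {z w : ℂ} {η : ℝ} (hη0 : 0 ≤ η)
    (hη : (N : ℝ) * η ≤ 1 / 2) (hz : ‖z - (‖z‖ : ℂ)‖ ≤ η * ‖z‖)
    (hw : ‖w - (‖w‖ : ℂ)‖ ≤ η * ‖w‖) :
    1 / 2 * max ‖z‖ ‖w‖ ^ (N - 1) * ‖z - w‖ ≤ ‖z ^ N - w ^ N‖ := by
  rw [← geom_sum₂_mul, norm_mul]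
  refine mul_le_mul_of_nonneg_right ?_ (norm_nonneg _)
  refine le_trans ?_ (Complex.re_le_norm _)
  rw [Complex.re_sum]
  have hterm : ∀ i ∈ Finset.range N, 1 / 2 * (‖z‖ ^ i * ‖w‖ ^ (N - 1 - i)) ≤
      (z ^ i * w ^ (N - 1 - i)).re := by
    intro i hi
    refine half_norm_le_re_pow_mul_pow hz hw ((mul_le_mul_of_nonneg_right ?_ hη0).trans hη)
    have := Finset.mem_range.1 hi
    exact_mod_cast (by omega : i + (N - 1 - i) ≤ N)
  have hnn : ∀ i ∈ Finset.range N, 0 ≤ (z ^ i * w ^ (N - 1 - i)).re := fun i hi =>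
    le_trans (by positivity) (hterm i hi)
  rcases le_total ‖z‖ ‖w‖ with h | h
  · rw [max_eq_right h]
    have h0 : 0 ∈ Finset.range N := Finset.mem_range.2 (by omega)
    refine le_trans ?_ (Finset.single_le_sum hnn h0)
    simpa using hterm 0 h0
  · rw [max_eq_left h]
    have h0 : N - 1 ∈ Finset.range N := Finset.mem_range.2 (by omega)
    refine le_trans ?_ (Finset.single_le_sum hnn h0)
    simpa using hterm (N - 1) h0

theorem half_max_pow_le_norm_add {N : ℕ} {z w : ℂ} {η : ℝ}
    (hη : (N : ℝ) * η ≤ 1 / 2) (hz : ‖z - (‖z‖ : ℂ)‖ ≤ η * ‖z‖)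
    (hw : ‖w - (‖w‖ : ℂ)‖ ≤ η * ‖w‖) :
    1 / 2 * max ‖z‖ ‖w‖ ^ N ≤ ‖z ^ N + w ^ N‖ := by
  refine le_trans ?_ (Complex.re_le_norm _)
  have h1 := half_norm_le_re_pow_mul_pow hz hz (i := N) (j := 0) (by simpa using hη)
  have h2 := half_norm_le_re_pow_mul_pow hw hw (i := N) (j := 0) (by simpa using hη)
  have h3 := pow_nonneg (norm_nonneg z) N
  have h4 := pow_nonneg (norm_nonneg w) N
  simp only [pow_zero, mul_one] at h1 h2
  rw [Complex.add_re]
  rcases le_total ‖z‖ ‖w‖ with h | h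
  · rw [max_eq_right h]; linarith
  · rw [max_eq_left h]; linarith

/-- Integer translates of `α` of large modulus are, up to sign, nearly positive real. -/
theorem exists_sign_nearly_real (α : ℂ) {η : ℝ} {m : ℤ}
    (h : 2 * ‖α‖ ≤ η * ‖(m : ℂ) + α‖) :
    ∃ z : ℂ, ‖z‖ = ‖(m : ℂ) + α‖ ∧ ‖z - (‖z‖ : ℂ)‖ ≤ η * ‖z‖ ∧
      (z = (m : ℂ) + α ∨ z = -((m : ℂ) + α)) := by
  -- A number in the right half plane is within `2 |Im z|` of its modulus, and adding an integer to
  -- `α` does not change the imaginary part.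
  have key : ∀ z : ℂ, 0 ≤ z.re → |z.im| ≤ ‖α‖ → ‖z - (‖z‖ : ℂ)‖ ≤ 2 * ‖α‖ := by
    intro z hre him
    have h1 : ‖z - (z.re : ℂ)‖ = |z.im| := by
      have : z - (z.re : ℂ) = z.im * Complex.I := by
        apply Complex.ext <;> simp
      rw [this]; simp
    have h2 : ‖(z.re : ℂ) - (‖z‖ : ℂ)‖ ≤ |z.im| := by
      rw [← Complex.ofReal_sub, Complex.norm_real, Real.norm_eq_abs, abs_sub_comm,
        abs_of_nonneg (sub_nonneg.2 (Complex.re_le_norm z))]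
      have := Complex.norm_le_abs_re_add_abs_im z
      rw [abs_of_nonneg hre] at this
      linarith
    calc ‖z - (‖z‖ : ℂ)‖ = ‖(z - (z.re : ℂ)) + ((z.re : ℂ) - (‖z‖ : ℂ))‖ := by ring_nf
      _ ≤ ‖z - (z.re : ℂ)‖ + ‖(z.re : ℂ) - (‖z‖ : ℂ)‖ := norm_add_le _ _
      _ ≤ 2 * ‖α‖ := by rw [h1]; linarith
  have him : |((m : ℂ) + α).im| ≤ ‖α‖ := by simpa using Complex.abs_im_le_norm α
  rcases le_total 0 ((m : ℂ) + α).re with hre | hre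
  · exact ⟨(m : ℂ) + α, rfl, (key _ hre him).trans h, Or.inl rfl⟩
  · refine ⟨-((m : ℂ) + α), norm_neg _, ?_, Or.inr rfl⟩
    refine (key _ (by rw [Complex.neg_re]; linarith) (by rwa [Complex.neg_im, abs_neg])).trans ?_
    rwa [norm_neg]

/-- The numbers `(m + α) ^ N` of large modulus are well separated, apart from coincidences. -/
theorem exists_separation (α : ℂ) {N : ℕ} (hN : 1 ≤ N) :
    ∃ γ r : ℝ, 0 < γ ∧ 1 ≤ r ∧ ∀ m n : ℤ, r ≤ ‖(n : ℂ) + α‖ →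
      (((m : ℂ) + α) ^ N = ((n : ℂ) + α) ^ N ∧ (m = n ∨ (m : ℂ) + n + 2 * α = 0)) ∨
      γ * max ‖(m : ℂ) + α‖ ‖(n : ℂ) + α‖ ^ (N - 1) ≤ ‖((m : ℂ) + α) ^ N - ((n : ℂ) + α) ^ N‖ := by
  obtain ⟨γ₀, hγ₀, hγ₁, hγ⟩ := exists_pos_le_norm_int_add (2 * α)
  have hN' : (1 : ℝ) ≤ N := by exact_mod_cast hN
  -- If the second modulus exceeds `8 N ‖α‖` and the first is at least half of it, both exceed `4 N
  -- ‖α‖`, so both numbers are real up to relative error `1 / (2 N)`.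
  refine ⟨γ₀ / 2, 8 * N * ‖α‖ + 1, by positivity, by
    have : 0 ≤ 8 * (N : ℝ) * ‖α‖ := by positivity
    linarith, fun m n hn => ?_⟩
  set a : ℂ := (m : ℂ) + α with ha
  set b : ℂ := (n : ℂ) + α with hb
  have hαN : 0 ≤ (N : ℝ) * ‖α‖ := by positivity
  have hb1 : 1 ≤ ‖b‖ := by nlinarith
  have hmax : 1 ≤ max ‖a‖ ‖b‖ := hb1.trans (le_max_right _ _)
  have hpp : 0 ≤ max ‖a‖ ‖b‖ ^ (N - 1) := by positivity
  -- Very different moduli separate the powers without any regard to arguments.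
  by_cases hab : ‖a‖ < ‖b‖ / 2
  · right
    have h1 : ‖a‖ ^ N ≤ (‖b‖ / 2) ^ N := pow_le_pow_left₀ (norm_nonneg _) hab.le N
    have h2 : (‖b‖ / 2) ^ N ≤ 1 / 2 * ‖b‖ ^ N := by
      rw [div_pow, div_eq_mul_inv, mul_comm]
      refine mul_le_mul_of_nonneg_right ?_ (by positivity)
      rw [← inv_pow]
      exact (pow_le_of_le_one (by norm_num) (by norm_num) (by omega)).trans (by norm_num)
    have h3 : ‖b‖ ^ N - ‖a‖ ^ N ≤ ‖a ^ N - b ^ N‖ := by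
      rw [norm_sub_rev, ← norm_pow, ← norm_pow]
      exact norm_sub_norm_le _ _
    have h4 : ‖b‖ ^ (N - 1) ≤ ‖b‖ ^ N := pow_le_pow_right₀ hb1 (by omega)
    rw [max_eq_right (by linarith)]
    have : γ₀ / 2 * ‖b‖ ^ (N - 1) ≤ 1 / 2 * ‖b‖ ^ N := by gcongr
    linarith
  · push Not at hab
    have hη : (N : ℝ) * (1 / (2 * N)) ≤ 1 / 2 := by
      field_simp; norm_num
    have hη0 : (0 : ℝ) ≤ 1 / (2 * N) := by positivity
    have hbig : ∀ x : ℝ, 4 * N * ‖α‖ ≤ x → 2 * ‖α‖ ≤ 1 / (2 * N) * x := by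
      intro x hx
      rw [div_mul_eq_mul_div, le_div_iff₀ (by positivity)]
      linarith
    obtain ⟨z, hza, hz, hz'⟩ := exists_sign_nearly_real α (m := m) (hbig ‖a‖ (by linarith))
    obtain ⟨w, hwb, hw, hw'⟩ := exists_sign_nearly_real α (m := n) (hbig ‖b‖ (by linarith))
    rw [← ha] at hza hz'
    rw [← hb] at hwb hw'
    have hsub := half_max_pow_mul_norm_sub_le hN hη0 hη hz hw
    have hadd := half_max_pow_le_norm_add hη hz hw
    rw [hza, hwb] at hsub hadd
    have hadd' : γ₀ / 2 * max ‖a‖ ‖b‖ ^ (N - 1) ≤ ‖z ^ N + w ^ N‖ := by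
      refine le_trans ?_ hadd
      have : max ‖a‖ ‖b‖ ^ (N - 1) ≤ max ‖a‖ ‖b‖ ^ N := pow_le_pow_right₀ hmax (by omega)
      gcongr
    have hsub' : γ₀ ≤ ‖z - w‖ → γ₀ / 2 * max ‖a‖ ‖b‖ ^ (N - 1) ≤ ‖z ^ N - w ^ N‖ := by
      intro h
      refine le_trans ?_ hsub
      nlinarith [mul_le_mul_of_nonneg_left h hpp]
    have hsame : m = n ∨ γ₀ ≤ ‖a - b‖ := by
      by_cases hmn : m = n
      · exact Or.inl hmn
      · right
        have : a - b = ((m - n : ℤ) : ℂ) := by rw [ha, hb]; push_cast; ring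
        rw [this, Complex.norm_intCast]
        refine hγ₁.trans ?_
        exact_mod_cast Int.one_le_abs (sub_ne_zero.2 hmn)
    have hopp : (m : ℂ) + n + 2 * α = 0 ∨ γ₀ ≤ ‖a + b‖ := by
      have : a + b = ((m + n : ℤ) : ℂ) + 2 * α := by rw [ha, hb]; push_cast; ring
      rw [this]
      simpa using hγ (m + n)
    have hopp' : (m : ℂ) + n + 2 * α = 0 → a = -b := fun h => by
      rw [ha, hb]; linear_combination h
    -- For even `N` signs are invisible, and `a = -b` is a genuine coincidence. For odd `N` opposite
    -- signs turn the difference into a sum of nearly positive numbers, so only `m = n` coincides.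
    rcases Nat.even_or_odd N with he | ho
    · have ez : z ^ N = a ^ N := by rcases hz' with h | h <;> simp [h, he.neg_pow]
      have ew : w ^ N = b ^ N := by rcases hw' with h | h <;> simp [h, he.neg_pow]
      rw [ez, ew] at hsub'
      have hcase : (a = b → m = n) ∧ (‖z - w‖ = ‖a - b‖ ∨ ‖z - w‖ = ‖a + b‖) := by
        refine ⟨fun h => ?_, ?_⟩
        · have : (m : ℂ) = n := by rw [ha, hb] at h; simpa using h
          exact_mod_cast this
        · rcases hz' with h | h <;> rcases hw' with h' | h' <;> rw [h, h']
          · exact Or.inl rfl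
          · right; congr 1; ring
          · right; rw [← norm_neg]; congr 1; ring
          · left; rw [← norm_neg]; congr 1; ring
      rcases hcase.2 with h | h
      · rcases hsame with h1 | h1
        · left; subst h1; exact ⟨rfl, Or.inl rfl⟩
        · right; exact hsub' (h ▸ h1)
      · rcases hopp with h1 | h1
        · left; exact ⟨by rw [hopp' h1, he.neg_pow], Or.inr h1⟩
        · right; exact hsub' (h ▸ h1)
    · rcases hsame with h1 | h1
      · left; subst h1; exact ⟨rfl, Or.inl rfl⟩
      · right
        rcases hz' with h | h <;> rcases hw' with h' | h' <;> rw [h, h'] at hsub' hadd' <;>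
          try simp only [ho.neg_pow] at hsub' hadd'
        · exact hsub' h1
        · simpa [sub_eq_add_neg] using hadd'
        · rw [norm_sub_rev]
          have e : -a ^ N + b ^ N = b ^ N - a ^ N := by ring
          rwa [e] at hadd'
        · have e : -a ^ N - -b ^ N = b ^ N - a ^ N := by ring
          have e' : -a - -b = -(a - b) := by ring
          rw [e, e', norm_neg] at hsub'
          rw [norm_sub_rev]
          exact hsub' h1

theorem finite_norm_int_add_lt (α : ℂ) (t : ℝ) : {m : ℤ | ‖(m : ℂ) + α‖ ≤ t}.Finite := by
  refine (Set.finite_Icc (⌊-(t + ‖α‖)⌋) (⌈t + ‖α‖⌉)).subset fun m hm => ?_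
  have h1 : |(m : ℝ)| ≤ t + ‖α‖ := by
    have : ‖(m : ℂ)‖ ≤ ‖(m : ℂ) + α‖ + ‖α‖ := by simpa using norm_sub_le ((m : ℂ) + α) α
    rw [Complex.norm_intCast] at this
    have hm' : ‖(m : ℂ) + α‖ ≤ t := hm
    linarith
  rw [abs_le] at h1
  constructor
  · exact_mod_cast (Int.floor_le _).trans h1.1
  · exact_mod_cast h1.2.trans (Int.le_ceil _)

/-- Pigeonhole on the shifts `0`, `1/3`, `2/3`: each of the two classes `a` and `-a` modulo `1`
comes within `1/6` of at most one of them, so one of the three is free. -/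
theorem exists_shift_far (a : ℝ) : ∃ s : ℝ, 0 ≤ s ∧ ∀ k : ℤ,
    1 / 6 ≤ |k + a - s| ∧ 1 / 6 ≤ |k - a - s| := by
  have no : ∀ a s s' : ℝ, 1 / 3 ≤ s' - s → s' - s ≤ 2 / 3 →
      (∃ k : ℤ, |k + a - s| < 1 / 6) → (∃ k : ℤ, |k + a - s'| < 1 / 6) → False := by
    rintro a s s' h1 h2 ⟨k, hk⟩ ⟨l, hl⟩
    rw [abs_lt] at hk hl
    have h3 : ((0 : ℤ) : ℝ) < ((l - k : ℤ) : ℝ) := by push_cast; linarith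
    have h4 : ((l - k : ℤ) : ℝ) < ((1 : ℤ) : ℝ) := by push_cast; linarith
    rw [Int.cast_lt] at h3 h4
    omega
  by_contra hcon
  push Not at hcon
  have h : ∀ s : ℝ, 0 ≤ s → (∃ k : ℤ, |k + a - s| < 1 / 6) ∨ ∃ k : ℤ, |k + -a - s| < 1 / 6 := by
    intro s hs
    obtain ⟨k, hk⟩ := hcon s hs
    by_cases h1 : 1 / 6 ≤ |k + a - s|
    · exact Or.inr ⟨k, by simpa [sub_eq_add_neg] using hk h1⟩
    · exact Or.inl ⟨k, not_le.1 h1⟩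
  have h0 := h 0 le_rfl
  have h1 := h (1 / 3) (by norm_num)
  have h2 := h (2 / 3) (by norm_num)
  have n1 := no a 0 (1 / 3) (by norm_num) (by norm_num)
  have n2 := no a (1 / 3) (2 / 3) (by norm_num) (by norm_num)
  have n3 := no a 0 (2 / 3) (by norm_num) (by norm_num)
  have n1' := no (-a) 0 (1 / 3) (by norm_num) (by norm_num)
  have n2' := no (-a) (1 / 3) (2 / 3) (by norm_num) (by norm_num)
  have n3' := no (-a) 0 (2 / 3) (by norm_num) (by norm_num)
  rcases h0 with h0 | h0 <;> rcases h1 with h1 | h1 <;> rcases h2 with h2 | h2 <;>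
    first
    | exact n1 h0 h1
    | exact n2 h1 h2
    | exact n3 h0 h2
    | exact n1' h0 h1
    | exact n2' h1 h2
    | exact n3' h0 h2

/-- Arbitrarily large radii avoid the moduli of all `m + α` by a fixed amount. -/
theorem exists_radius_gap (α : ℂ) (t₀ : ℝ) :
    ∃ t : ℝ, t₀ ≤ t ∧ ∀ m : ℤ, 1 / 12 ≤ |‖(m : ℂ) + α‖ - t| := by
  obtain ⟨s, hs0, hs⟩ := exists_shift_far α.re
  -- At large modulus `‖z‖ - |Re z| = (Im z) ^ 2 / (‖z‖ + |Re z|)` is at most `1/12`, which costs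
  -- half of the margin `1/6` known for `|Re z|`.
  obtain ⟨n, hn⟩ := exists_nat_ge (max t₀ (24 * α.im ^ 2 + 1))
  have hn1 := (le_max_left _ _).trans hn
  have hn2 := (le_max_right _ _).trans hn
  refine ⟨s + n, by linarith, fun m => ?_⟩
  set z : ℂ := (m : ℂ) + α with hz
  have hre : z.re = m + α.re := by simp [hz]
  have him : z.im = α.im := by simp [hz]
  have hsq : ‖z‖ ^ 2 = z.re ^ 2 + z.im ^ 2 := by
    rw [Complex.sq_norm, Complex.normSq_apply]; ring
  have hx : 1 / 6 ≤ |(|z.re| - (s + n))| := by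
    rcases abs_cases z.re with ⟨h, _⟩ | ⟨h, _⟩
    · have := (hs (m - n)).1
      rw [h, hre]
      push_cast at this
      convert this using 2
      ring
    · have := (hs (-m - n)).2
      rw [h, hre]
      push_cast at this
      convert this using 2
      ring
  have hle : |z.re| ≤ ‖z‖ := Complex.abs_re_le_norm z
  have him2 : 0 ≤ α.im ^ 2 := sq_nonneg _
  by_cases hsmall : ‖z‖ ≤ (s + n) / 2
  · rw [abs_sub_comm]
    refine le_trans ?_ (le_abs_self _)
    linarith
  · push Not at hsmall
    have hprod : (‖z‖ - |z.re|) * (‖z‖ + |z.re|) = α.im ^ 2 := by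
      have : |z.re| ^ 2 = z.re ^ 2 := sq_abs _
      rw [← him]
      linear_combination hsq - this
    have hdiff : ‖z‖ - |z.re| ≤ 1 / 12 := by
      by_contra hc
      push Not at hc
      have h1 : 0 ≤ |z.re| := abs_nonneg _
      nlinarith
    have h3 := abs_sub_abs_le_abs_sub (|z.re| - (s + n)) (‖z‖ - (s + n))
    have h4 : |(|z.re| - (s + n) - (‖z‖ - (s + n)))| ≤ 1 / 12 := by
      rw [abs_le]; constructor <;> linarith
    linarith

/-! ### Localisation and counting of eigenvalues. -/

section Counting

variable {V : Type*} [AddCommGroup V] [Module ℂ V]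

/-- The operator `A` is, in the coordinates `c`, a perturbation of order `k` of the diagonal
operator with entries `(n + α) ^ (k + 2)`. -/
structure DiagonalPerturbation (A : Module.End ℂ V) (c : ℤ → V →ₗ[ℂ] ℂ) (α : ℂ) (k : ℕ) (K : ℝ) :
    Prop where
  pos : 0 < K
  inj : ∀ u, (∀ n, c n u = 0) → u = 0
  sq : ∀ u, SqSummable fun n => (((1 + ‖(n : ℂ) + α‖) ^ (k + 2) : ℝ) : ℂ) * c n u
  bound : ∀ u, l2 (fun n => c n (A u) - ((n : ℂ) + α) ^ (k + 2) * c n u) ≤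
    l2 (fun n => ((K * (1 + ‖(n : ℂ) + α‖) ^ k : ℝ) : ℂ) * c n u)

theorem aeval_sub_algebraMap_prod (A : Module.End ℂ V) (l : ℂ) (S : Multiset ℂ) :
    aeval (A - algebraMap ℂ (Module.End ℂ V) l)
      ((((S.map fun z => z - l)).map fun z => X - C z).prod) =
    aeval A ((S.map fun z => X - C z).prod) := by
  induction S using Multiset.induction with
  | empty => simp
  | cons z S ih =>
    simp only [Multiset.map_cons, Multiset.prod_cons, map_mul, ih]
    congr 1
    simp

theorem norm_eq_of_pow_eq {a b : ℂ} {n : ℕ} (hn : n ≠ 0) (h : a ^ n = b ^ n) : ‖a‖ = ‖b‖ := by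
  have := congrArg norm h
  rw [norm_pow, norm_pow] at this
  exact (pow_left_inj₀ (norm_nonneg _) (norm_nonneg _) hn).1 this

namespace DiagonalPerturbation

variable {A : Module.End ℂ V} {c : ℤ → V →ₗ[ℂ] ℂ} {α : ℂ} {k : ℕ} {K : ℝ}

/-- `l2` of a non-summable sequence is `0`, so estimates in `l2` carry no information without
summability. The strongest weight, in `DiagonalPerturbation.sq`, supplies it for all weights in use.
-/
theorem sq_of_le (h : DiagonalPerturbation A c α k K) {w : ℤ → ℂ} {B : ℝ}
    (hw : ∀ n : ℤ, ‖w n‖ ≤ B * (1 + ‖(n : ℂ) + α‖) ^ (k + 2)) (u : V) :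
    SqSummable fun n => w n * c n u := by
  refine (h.sq u).mono (c := B) fun n => ?_
  rw [norm_mul, norm_mul, Complex.norm_real, Real.norm_of_nonneg (by positivity), ← mul_assoc]
  exact mul_le_mul_of_nonneg_right (hw n) (norm_nonneg _)

theorem sq_coord (h : DiagonalPerturbation A c α k K) (u : V) : SqSummable fun n => c n u := by
  have := h.sq_of_le (w := fun _ => 1) (B := 1) (fun n => by
    rw [norm_one, one_mul]
    exact one_le_pow₀ (by linarith [norm_nonneg ((n : ℂ) + α)])) u
  simpa using this

/-- The basic uniqueness principle: a vector annihilated by a polynomial in `A` with roots close to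
`l` is determined by its coordinates in `I`, if the diagonal entries in `I` are closer to `l` than
those off `I`. -/
theorem eq_zero (h : DiagonalPerturbation A c α k K) (l : ℂ) {I : Set ℤ} {r r' s' η ε : ℝ}
    (hr : 0 ≤ r) (hr' : 0 ≤ r') (hs' : 0 < s') (hη : 0 ≤ η) (hε : 0 ≤ ε) (hε2 : ε ≤ 1 / 2)
    (hin : ∀ n ∈ I, ‖((n : ℂ) + α) ^ (k + 2) - l‖ ≤ r' ∧ K * (1 + ‖(n : ℂ) + α‖) ^ k ≤ η)
    (hout : ∀ n ∈ Iᶜ, s' ≤ ‖((n : ℂ) + α) ^ (k + 2) - l‖ ∧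
      K * (1 + ‖(n : ℂ) + α‖) ^ k ≤ ε * ‖((n : ℂ) + α) ^ (k + 2) - l‖)
    (hgap : r' ≤ (1 - 2 * ε) * s' - 2 * η) (hrs : r < (1 - ε) * s' - η)
    (S : Multiset ℂ) (hS : ∀ z ∈ S, ‖z - l‖ ≤ r) {u : V}
    (hu : aeval A ((S.map fun z => X - C z).prod) u = 0) (huI : ∀ n ∈ I, c n u = 0) : u = 0 := by
  have hK := h.pos
  have h1 : ∀ n : ℤ, 1 ≤ 1 + ‖(n : ℂ) + α‖ := fun n => by linarith [norm_nonneg ((n : ℂ) + α)]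
  refine eq_zero_of_aeval_eq_zero (T := A - algebraMap ℂ (Module.End ℂ V) l) (c := c)
    (w := fun n => ((n : ℂ) + α) ^ (k + 2) - l) (q := fun n => K * (1 + ‖(n : ℂ) + α‖) ^ k)
    (fun n => by positivity) h.sq_coord (fun u => h.sq_of_le (B := 1 + ‖l‖) (fun n => ?_) u)
    (fun u => h.sq_of_le (B := K) (fun n => ?_) u) (fun u => ?_) h.inj hr hr' hs' hη hε hε2
    hin hout hgap hrs (S.map fun z => z - l) (fun z hz => ?_) (u := u) ?_ huI
  · refine (norm_sub_le _ _).trans ?_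
    rw [norm_pow, add_mul, one_mul]
    refine add_le_add (pow_le_pow_left₀ (norm_nonneg _) (by linarith) _) ?_
    exact le_mul_of_one_le_right (norm_nonneg _) (one_le_pow₀ (h1 n))
  · rw [Complex.norm_real, Real.norm_of_nonneg (by positivity)]
    exact mul_le_mul_of_nonneg_left (pow_le_pow_right₀ (h1 n) (by omega)) hK.le
  · refine le_trans (le_of_eq ?_) (h.bound u)
    congr 1
    funext n
    simp [Module.algebraMap_end_apply]
    ring
  · obtain ⟨y, hy, rfl⟩ := Multiset.mem_map.1 hz
    exact hS y hy
  · rw [aeval_sub_algebraMap_prod, hu]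

/-- Every eigenvalue is close to a diagonal entry. -/
theorem exists_near (h : DiagonalPerturbation A c α k K) {l : ℂ} {u : V} (hu0 : u ≠ 0)
    (hu : A u = l • u) :
    ∃ m : ℤ, ‖l - ((m : ℂ) + α) ^ (k + 2)‖ ≤ 2 * (K * (1 + ‖(m : ℂ) + α‖) ^ k) := by
  by_contra! hcon
  have hK := h.pos
  -- With `I` empty the gap condition degenerates to `0 ≤ 0`. If `l` is further than twice the
  -- perturbation weight from every entry, then `ε = 1/2` is admissible.
  refine hu0 (h.eq_zero l (I := ∅) (r := 0) (r' := 0) (s' := 2 * K) (η := 0) (ε := 1 / 2) le_rfl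
    le_rfl (by linarith) le_rfl (by norm_num) le_rfl (by simp) (fun n _ => ?_) (by norm_num)
    (by linarith) {l} (by simp) ?_ (by simp))
  · have h1 := hcon n
    rw [norm_sub_rev] at h1
    have h2 : K * 1 ≤ K * (1 + ‖(n : ℂ) + α‖) ^ k :=
      mul_le_mul_of_nonneg_left
        (one_le_pow₀ (by linarith [norm_nonneg ((n : ℂ) + α)])) hK.le
    constructor <;> linarith
  · simp [hu, Module.algebraMap_end_apply]

/-- Near a diagonal entry of large modulus, the coordinates with that same entry determine the
vector. -/
theorem exists_local (h : DiagonalPerturbation A c α k K) :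
    ∃ R : ℝ, ∀ n : ℤ, R ≤ ‖(n : ℂ) + α‖ → ∃ I : Finset ℤ, I.card ≤ 2 ∧
      (∀ m, m ∈ I ↔ ((m : ℂ) + α) ^ (k + 2) = ((n : ℂ) + α) ^ (k + 2)) ∧
      ∀ S : Multiset ℂ, (∀ z ∈ S, ‖z - ((n : ℂ) + α) ^ (k + 2)‖ ≤
          2 * (K * (1 + ‖(n : ℂ) + α‖) ^ k)) →
        ∀ u, aeval A ((S.map fun z => X - C z).prod) u = 0 → (∀ n ∈ I, c n u = 0) → u = 0 := by
  obtain ⟨γ, r, hγ, hr1, hsep⟩ := exists_separation α (N := k + 2) (by omega)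
  have hK := h.pos
  set L := K * 2 ^ k with hL
  have hL0 : 0 < L := by positivity
  -- Beyond this modulus the separation `γ b ^ (k + 1)` exceeds four times the perturbation weight,
  -- itself at most `L b ^ k`.
  refine ⟨r + 4 * L / γ + 1, fun n hn => ?_⟩
  have hLγ : 0 < 4 * L / γ := by positivity
  set b := ‖(n : ℂ) + α‖ with hb
  have hb1 : 1 ≤ b := by linarith
  have hγb : 4 * L < γ * b := by
    have : 4 * L / γ < b := by linarith
    rwa [div_lt_iff₀' hγ] at this
  have hposs : ∀ m : ℤ, 0 < γ * max ‖(m : ℂ) + α‖ b ^ (k + 1) := fun m => by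
    have : 0 < max ‖(m : ℂ) + α‖ b := lt_of_lt_of_le (by linarith) (le_max_right _ _)
    positivity
  have hcase : ∀ m : ℤ, ((m : ℂ) + α) ^ (k + 2) = ((n : ℂ) + α) ^ (k + 2) →
      m = n ∨ (m : ℂ) + n + 2 * α = 0 := fun m hm => by
    rcases hsep m n (by linarith) with h1 | h1
    · exact h1.2
    · rw [hm, sub_self, norm_zero] at h1
      exact absurd h1 (not_le.2 (hposs m))
  have hfin : {m : ℤ | ((m : ℂ) + α) ^ (k + 2) = ((n : ℂ) + α) ^ (k + 2)}.Finite := by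
    refine (finite_norm_int_add_lt α b).subset fun m hm => ?_
    have hm' : ((m : ℂ) + α) ^ (k + 2) = ((n : ℂ) + α) ^ (k + 2) := hm
    exact (norm_eq_of_pow_eq (by omega) hm').le
  have hnormeq : ∀ m : ℤ, ((m : ℂ) + α) ^ (k + 2) = ((n : ℂ) + α) ^ (k + 2) →
      ‖(m : ℂ) + α‖ = b := fun m hm => norm_eq_of_pow_eq (by omega) hm
  refine ⟨hfin.toFinset, ?_, fun m => by simp, fun S hS u hu huI => ?_⟩
  · by_cases hex : ∃ m₀ : ℤ, (m₀ : ℂ) + n + 2 * α = 0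
    · obtain ⟨m₀, hm₀⟩ := hex
      refine (Finset.card_le_card (t := {n, m₀}) fun m hm => ?_).trans Finset.card_le_two
      rcases hcase m (by simpa using hm) with h1 | h1
      · simp [h1]
      · have : (m : ℂ) = m₀ := by linear_combination h1 - hm₀
        have : m = m₀ := by exact_mod_cast this
        simp [this]
    · refine (Finset.card_le_card (t := {n}) fun m hm => ?_).trans (by simp)
      rcases hcase m (by simpa using hm) with h1 | h1
      · simp [h1]
      · exact absurd ⟨m, h1⟩ hex
  · have hbk : (1 + b) ^ k ≤ 2 ^ k * b ^ k := by
      rw [← mul_pow]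
      exact pow_le_pow_left₀ (by linarith) (by linarith) k
    have hηL : K * (1 + b) ^ k ≤ L * b ^ k := by
      rw [hL, mul_assoc]
      exact mul_le_mul_of_nonneg_left hbk hK.le
    have hbp : 0 < b ^ k := by positivity
    have hs4 : 4 * (K * (1 + b) ^ k) < γ * b ^ (k + 1) := by
      have h3 := mul_lt_mul_of_pos_right hγb hbp
      have h4 : γ * b ^ (k + 1) = γ * b * b ^ k := by ring
      linarith
    have hη0 : 0 < K * (1 + b) ^ k := by positivity
    -- On `I` the entries equal the centre, hence `r' = 0`; the conditions reduce to `4 η < s'`. The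
    -- radius `2 η` is the distance at which `exists_near` places eigenvalues.
    refine h.eq_zero (((n : ℂ) + α) ^ (k + 2)) (I := (hfin.toFinset : Set ℤ))
      (r := 2 * (K * (1 + b) ^ k)) (r' := 0) (s' := γ * b ^ (k + 1)) (η := K * (1 + b) ^ k)
      (ε := 1 / 4) (by positivity) le_rfl (by positivity) hη0.le (by norm_num) (by norm_num)
      (fun m hm => ?_) (fun m hm => ?_) (by linarith) (by linarith) S hS hu huI
    · have hm' : ((m : ℂ) + α) ^ (k + 2) = ((n : ℂ) + α) ^ (k + 2) := by simpa using hm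
      rw [hm', sub_self, norm_zero, hnormeq m hm']
      exact ⟨le_rfl, le_rfl⟩
    · have hm' : ((m : ℂ) + α) ^ (k + 2) ≠ ((n : ℂ) + α) ^ (k + 2) := by simpa using hm
      rcases hsep m n (by linarith) with h1 | h1
      · exact absurd h1.1 hm'
      · set M := max ‖(m : ℂ) + α‖ b with hM
        have hMb : b ≤ M := le_max_right _ _
        have hMm : ‖(m : ℂ) + α‖ ≤ M := le_max_left _ _
        have h1' : γ * M ^ (k + 1) ≤ ‖((m : ℂ) + α) ^ (k + 2) - ((n : ℂ) + α) ^ (k + 2)‖ := h1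
        refine ⟨le_trans ?_ h1', ?_⟩
        · exact mul_le_mul_of_nonneg_left (pow_le_pow_left₀ (by linarith) hMb _) hγ.le
        · have h2 : (1 + ‖(m : ℂ) + α‖) ^ k ≤ 2 ^ k * M ^ k := by
            rw [← mul_pow]
            exact pow_le_pow_left₀ (by positivity) (by linarith) k
          have h3 : K * (1 + ‖(m : ℂ) + α‖) ^ k ≤ L * M ^ k := by
            rw [hL, mul_assoc]
            exact mul_le_mul_of_nonneg_left h2 hK.le
          have hMp : 0 ≤ M ^ k := by positivity
          have h4 : 4 * L ≤ γ * M := hγb.le.trans (mul_le_mul_of_nonneg_left hMb hγ.le)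
          have h5 := mul_le_mul_of_nonneg_right h4 hMp
          have h6 : γ * M ^ (k + 1) = γ * M * M ^ k := by ring
          linarith

/-- Arbitrarily large discs about `0` in which the low coordinates determine the vector. -/
theorem exists_global (h : DiagonalPerturbation A c α k K) (t₀ : ℝ) :
    ∃ t : ℝ, t₀ ≤ t ∧ 1 ≤ t ∧ (∀ m : ℤ, ‖(m : ℂ) + α‖ < t →
        ‖((m : ℂ) + α) ^ (k + 2)‖ + 2 * (K * (1 + ‖(m : ℂ) + α‖) ^ k) ≤ t ^ (k + 2)) ∧
      ∀ S : Multiset ℂ, (∀ z ∈ S, ‖z‖ ≤ t ^ (k + 2)) →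
        ∀ u, aeval A ((S.map fun z => X - C z).prod) u = 0 →
          (∀ n : ℤ, ‖(n : ℂ) + α‖ < t → c n u = 0) → u = 0 := by
  have hK := h.pos
  set L := K * 2 ^ k with hL
  have hL0 : 0 < L := by positivity
  -- The gap of `1/12` in the moduli keeps the entries `t ^ (k + 1) / 12` away from the circle of
  -- radius `t ^ (k + 2)`. The perturbation must stay below this with three copies of `L t ^ k`,
  -- whence `36`.
  obtain ⟨t, ht, hgap⟩ := exists_radius_gap α (max t₀ (36 * L + 1))
  have ht1 := (le_max_left _ _).trans ht
  have ht2 := (le_max_right _ _).trans ht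
  have h1t : 1 ≤ t := by linarith
  have htk : 0 < t ^ k := by positivity
  have hwt : ∀ b : ℝ, 0 ≤ b → b ≤ t → K * (1 + b) ^ k ≤ L * t ^ k := fun b hb0 hb => by
    rw [hL, mul_assoc, ← mul_pow]
    exact mul_le_mul_of_nonneg_left (pow_le_pow_left₀ (by positivity) (by linarith) k) hK.le
  have hsmall : ∀ m : ℤ, ‖(m : ℂ) + α‖ < t →
      ‖((m : ℂ) + α) ^ (k + 2)‖ ≤ t ^ (k + 2) - 1 / 12 * (t * t ^ k) := fun m hm => by
    have h1 := hgap m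
    rw [abs_of_neg (by linarith)] at h1
    have h3 : ‖(m : ℂ) + α‖ ^ (k + 1) ≤ t ^ (k + 1) := pow_le_pow_left₀ (norm_nonneg _) hm.le _
    rw [norm_pow, pow_succ']
    have h4 : ‖(m : ℂ) + α‖ * ‖(m : ℂ) + α‖ ^ (k + 1) ≤ (t - 1 / 12) * t ^ (k + 1) :=
      mul_le_mul (by linarith) h3 (by positivity) (by linarith)
    have h5 : (t - 1 / 12) * t ^ (k + 1) = t ^ (k + 2) - 1 / 12 * (t * t ^ k) := by ring
    linarith
  have hLt : 36 * L * t ^ k < t * t ^ k := mul_lt_mul_of_pos_right (by linarith) htk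
  refine ⟨t, ht1, h1t, fun m hm => ?_, fun S hS u hu huI => ?_⟩
  · have h1 := hsmall m hm
    have h2 := hwt _ (norm_nonneg _) hm.le
    have : 0 < L * t ^ k := by positivity
    linarith
  · have hε : L / t ^ 2 * t ^ (k + 2) = L * t ^ k := by
      field_simp
      ring
    have hε2 : L / t ^ 2 * (1 / 12 * (t * t ^ k)) ≤ L * t ^ k := by
      have : L / t ^ 2 * (1 / 12 * (t * t ^ k)) = L * t ^ k * (1 / (12 * t)) := by field_simp
      rw [this]
      refine mul_le_of_le_one_right (by positivity) ?_
      rw [div_le_one (by positivity)]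
      linarith
    have hε0 : 0 ≤ L / t ^ 2 := by positivity
    have hLt0 : 0 < L * t ^ k := by positivity
    refine h.eq_zero 0 (I := {m : ℤ | ‖(m : ℂ) + α‖ < t})
      (r := t ^ (k + 2)) (r' := t ^ (k + 2) - 1 / 12 * (t * t ^ k))
      (s' := t ^ (k + 2) + 1 / 12 * (t * t ^ k)) (η := L * t ^ k) (ε := L / t ^ 2)
      (by positivity) ?_ (by positivity) hLt0.le hε0 ?_
      (fun m hm => ?_) (fun m hm => ?_) ?_ ?_ S (by simpa using hS) hu huI
    · have : t ^ (k + 2) = t * (t * t ^ k) := by ring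
      nlinarith [mul_pos (lt_of_lt_of_le one_pos h1t) htk]
    · rw [div_le_iff₀ (by positivity)]
      nlinarith
    · rw [sub_zero]
      exact ⟨hsmall m hm, hwt _ (norm_nonneg _) (le_of_lt hm)⟩
    · rw [sub_zero, norm_pow]
      have hm' : t ≤ ‖(m : ℂ) + α‖ := not_lt.1 hm
      have h1 := hgap m
      set b := ‖(m : ℂ) + α‖
      rw [abs_of_nonneg (by linarith)] at h1
      have hb1 : 1 ≤ b := by linarith
      constructor
      · have h3 : t ^ (k + 1) ≤ b ^ (k + 1) := pow_le_pow_left₀ (by linarith) hm' _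
        have h4 : (t + 1 / 12) * t ^ (k + 1) ≤ b * b ^ (k + 1) :=
          mul_le_mul (by linarith) h3 (by positivity) (by linarith)
        have h5 : (t + 1 / 12) * t ^ (k + 1) = t ^ (k + 2) + 1 / 12 * (t * t ^ k) := by ring
        have h6 : b * b ^ (k + 1) = b ^ (k + 2) := by ring
        linarith
      · have h2 : K * (1 + b) ^ k ≤ L * b ^ k := by
          rw [hL, mul_assoc, ← mul_pow]
          exact mul_le_mul_of_nonneg_left (pow_le_pow_left₀ (by positivity) (by linarith) k) hK.le
        refine h2.trans ?_
        rw [div_mul_eq_mul_div, le_div_iff₀ (by positivity), mul_assoc]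
        refine mul_le_mul_of_nonneg_left ?_ hL0.le
        rw [pow_add]
        exact mul_le_mul_of_nonneg_left (pow_le_pow_left₀ (by linarith) hm' 2) (by positivity)
    · linarith
    · linarith

theorem aeval_prod_eq_zero_of_mem {u : V} {l : ℂ} (hu : A u = l • u) {s : Finset ℂ} (hl : l ∈ s) :
    aeval A ((s.val.map fun z => X - C z).prod) u = 0 := by
  have e : (s.val.map fun z => X - C z).prod = (∏ z ∈ s.erase l, (X - C z)) * (X - C l) := by
    rw [Finset.prod_erase_mul _ _ hl]; rfl
  rw [e, map_mul, Module.End.mul_apply]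
  have : aeval A (X - C l) u = 0 := by simp [hu, Module.algebraMap_end_apply]
  rw [this, map_zero]

/-- A finite set of eigenvalues is not larger than a set of coordinates determining the
eigenvectors. -/
theorem card_eigenvalues_le {s : Finset ℂ} {I : Finset ℤ} (hs : ∀ l ∈ s, ∃ u ≠ 0, A u = l • u)
    (hker : ∀ u, aeval A ((s.val.map fun z => X - C z).prod) u = 0 →
      (∀ n ∈ I, c n u = 0) → u = 0) : s.card ≤ I.card := by
  choose! v hv0 hv using hs
  have hli : LinearIndependent ℂ fun l : s => v l :=
    Module.End.eigenvectors_linearIndependent' A (fun l : s => (l : ℂ)) Subtype.val_injective _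
      fun l => ⟨Module.End.mem_eigenspace_iff.2 (hv l l.2), hv0 l l.2⟩
  -- The span of the chosen eigenvectors is annihilated by the product polynomial, so its elements
  -- are determined by their coordinates in `I`, and a dimension count finishes.
  let F : (s → ℂ) →ₗ[ℂ] (I → ℂ) :=
    (LinearMap.pi fun n : I => c n) ∘ₗ Fintype.linearCombination ℂ (fun l : s => v l)
  have hF : Function.Injective F := by
    rw [← LinearMap.ker_eq_bot, LinearMap.ker_eq_bot']
    intro a ha
    have h0 : Fintype.linearCombination ℂ (fun l : s => v l) a = 0 := by
      refine hker _ ?_ fun n hn => congrFun ha ⟨n, hn⟩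
      rw [Fintype.linearCombination_apply, map_sum]
      refine Finset.sum_eq_zero fun l _ => ?_
      rw [map_smul, aeval_prod_eq_zero_of_mem (hv l l.2) l.2, smul_zero]
    rw [Fintype.linearCombination_apply] at h0
    funext l
    exact Fintype.linearIndependent_iff.1 hli a h0 l
  simpa using LinearMap.finrank_le_finrank_of_injective hF

open Classical in
/-- The eigenvalues can be enumerated so that they follow the diagonal entries. -/
theorem exists_enumeration (h : DiagonalPerturbation A c α k K) :
    ∃ μ : ℤ → ℂ, (∀ (l : ℂ) (u : V), u ≠ 0 → A u = l • u → ∃ n, l = μ n) ∧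
      ∀ᶠ n in Filter.cofinite,
        ‖μ n - ((n : ℂ) + α) ^ (k + 2)‖ ≤ 2 * (K * (1 + ‖(n : ℂ) + α‖) ^ k) := by
  have hK := h.pos
  obtain ⟨R, hR⟩ := h.exists_local
  obtain ⟨t, htR, ht1, hlow, hglob⟩ := h.exists_global R
  let E : Set ℂ := {l | ∃ u ≠ 0, A u = l • u}
  have hnear : ∀ l : E, ∃ m : ℤ,
      ‖(l : ℂ) - ((m : ℂ) + α) ^ (k + 2)‖ ≤ 2 * (K * (1 + ‖(m : ℂ) + α‖) ^ k) := fun l => by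
    obtain ⟨u, hu0, hu⟩ := l.2
    exact h.exists_near hu0 hu
  choose m hm using hnear
  -- Eigenvalues and integers get labels: `none` for the low ones, otherwise the value of the nearby
  -- diagonal entry. Using the value rather than the index merges coinciding entries into one class.
  let κ : E → Option ℂ := fun l =>
    if ‖(l : ℂ)‖ ≤ t ^ (k + 2) then none else some (((m l : ℂ) + α) ^ (k + 2))
  let κ' : ℤ → Option ℂ := fun n =>
    if ‖(n : ℂ) + α‖ < t then none else some (((n : ℂ) + α) ^ (k + 2))
  have hfin : ∀ y, {n | κ' n = y}.Finite := by
    intro y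
    rcases y with _ | v
    · refine (finite_norm_int_add_lt α t).subset fun n hn => ?_
      by_contra hcon
      have : ¬ ‖(n : ℂ) + α‖ < t := fun h' => hcon h'.le
      simp [κ', this] at hn
    · refine (finite_norm_int_add_lt α (‖v‖ + 1)).subset fun n hn => ?_
      have hn1 : κ' n = some v := hn
      by_cases hn' : ‖(n : ℂ) + α‖ < t
      · simp only [κ', if_pos hn'] at hn1
        simp at hn1
      · have hv : ((n : ℂ) + α) ^ (k + 2) = v := by
            simpa only [κ', if_neg hn', Option.some.injEq] using hn1
        have h1 : 1 ≤ ‖(n : ℂ) + α‖ := ht1.trans (not_lt.1 hn')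
        have h2 : ‖(n : ℂ) + α‖ ^ 1 ≤ ‖(n : ℂ) + α‖ ^ (k + 2) :=
          pow_le_pow_right₀ h1 (by omega)
        rw [pow_one, ← norm_pow, hv] at h2
        show ‖(n : ℂ) + α‖ ≤ ‖v‖ + 1
        linarith
  let M : Option ℂ → Finset ℤ := fun y => (hfin y).toFinset
  have hM : ∀ y n, n ∈ M y ↔ κ' n = y := fun y n => by simp [M]
  have hbig : ∀ l : E, ¬ ‖(l : ℂ)‖ ≤ t ^ (k + 2) → t ≤ ‖(m l : ℂ) + α‖ := by
    intro l hl
    by_contra! hcon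
    have h1 := hlow _ hcon
    have h2 := hm l
    have h3 := norm_add_le ((l : ℂ) - ((m l : ℂ) + α) ^ (k + 2)) (((m l : ℂ) + α) ^ (k + 2))
    rw [sub_add_cancel] at h3
    exact hl (by linarith)
  have hfiber : ∀ (s : Finset E) (y : Option ℂ), (∀ l ∈ s, κ l = y) → s.card ≤ (M y).card := by
    intro s y hs
    rcases s.eq_empty_or_nonempty with rfl | ⟨l₀, hl₀⟩
    · simp
    rw [← Finset.card_map (Function.Embedding.subtype (· ∈ E))]
    refine card_eigenvalues_le (A := A) (c := c) (fun l hl => ?_) ?_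
    · obtain ⟨l', -, rfl⟩ := Finset.mem_map.1 hl
      exact l'.2
    rcases y with _ | v
    · refine fun u hu huI => hglob _ (fun z hz => ?_) u hu fun n hn => huI n ?_
      · obtain ⟨l', hl', rfl⟩ := Finset.mem_map.1 hz
        by_contra hcon
        have := hs l' hl'
        have hcon' : ¬ ‖(l' : ℂ)‖ ≤ t ^ (k + 2) := hcon
        simp [κ, hcon'] at this
      · rw [hM]; simp [κ', hn]
    · have hl : ∀ l ∈ s, t ≤ ‖(m l : ℂ) + α‖ ∧ ((m l : ℂ) + α) ^ (k + 2) = v := by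
        intro l hl
        have h1 := hs l hl
        by_cases hle : ‖(l : ℂ)‖ ≤ t ^ (k + 2)
        · simp [κ, hle] at h1
        · exact ⟨hbig l hle, by simpa [κ, hle] using h1⟩
      obtain ⟨I, -, hI, hloc⟩ := hR (m l₀) (htR.trans (hl l₀ hl₀).1)
      have hnorm : ∀ n : ℤ, ((n : ℂ) + α) ^ (k + 2) = v → ‖(n : ℂ) + α‖ = ‖(m l₀ : ℂ) + α‖ :=
        fun n hn => norm_eq_of_pow_eq (by omega) (hn.trans (hl l₀ hl₀).2.symm)
      refine fun u hu huI => hloc _ (fun z hz => ?_) u hu fun n hn => huI n ?_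
      · obtain ⟨l', hl', rfl⟩ := Finset.mem_map.1 hz
        have h1 := hm l'
        rw [(hl l' hl').2, hnorm _ (hl l' hl').2] at h1
        rw [(hl l₀ hl₀).2]
        exact h1
      · have hn' := ((hI n).1 hn).trans (hl l₀ hl₀).2
        have : ¬ ‖(n : ℂ) + α‖ < t := by
          rw [hnorm n hn']; exact not_lt.2 (hl l₀ hl₀).1
        rw [hM]; simp [κ', this, hn']
  -- Hall's marriage theorem. Integer classes with different labels are disjoint, so Hall's
  -- condition follows by summing the inequality for a single label.
  obtain ⟨f, hf, hfM⟩ := (Finset.all_card_le_biUnion_card_iff_exists_injective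
    (fun l : E => M (κ l))).1 fun s => by
      have h1 : s.biUnion (fun l => M (κ l)) = (s.image κ).biUnion M := by
        rw [Finset.image_biUnion]
      rw [h1, Finset.card_biUnion, Finset.card_eq_sum_card_image κ s]
      · exact Finset.sum_le_sum fun y _ => hfiber _ y fun l hl => (Finset.mem_filter.1 hl).2
      · intro y _ y' _ hyy
        refine Finset.disjoint_left.2 fun n hn hn' => hyy ?_
        rw [hM] at hn hn'
        exact hn.symm.trans hn'
  -- Integers not matched to an eigenvalue take the unperturbed entry, where the estimate is
  -- trivial.
  refine ⟨fun n => if hn : ∃ l : E, f l = n then (hn.choose : ℂ) else ((n : ℂ) + α) ^ (k + 2),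
    fun l u hu0 hu => ⟨f ⟨l, u, hu0, hu⟩, ?_⟩, ?_⟩
  · have hex : ∃ l' : E, f l' = f ⟨l, u, hu0, hu⟩ := ⟨_, rfl⟩
    show l = if hn : ∃ l' : E, f l' = f ⟨l, u, hu0, hu⟩ then (hn.choose : ℂ) else _
    rw [dif_pos hex, hf hex.choose_spec]
  · rw [Filter.eventually_cofinite]
    refine (finite_norm_int_add_lt α t).subset fun n hn => ?_
    by_contra hcon
    refine hn ?_
    have hnt : ¬ ‖(n : ℂ) + α‖ < t := fun h' => hcon h'.le
    by_cases hex : ∃ l : E, f l = n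
    · simp only [dif_pos hex]
      set l := hex.choose with hl
      have h1 := hfM l
      rw [hM, hex.choose_spec] at h1
      have h2 : κ l = some (((n : ℂ) + α) ^ (k + 2)) := by rw [← h1]; simp [κ', hnt]
      by_cases hle : ‖(l : ℂ)‖ ≤ t ^ (k + 2)
      · simp [κ, hle] at h2
      · have h3 : ((m l : ℂ) + α) ^ (k + 2) = ((n : ℂ) + α) ^ (k + 2) := by
          simpa [κ, hle] using h2
        have h5 : ‖(m l : ℂ) + α‖ = ‖(n : ℂ) + α‖ := norm_eq_of_pow_eq (by omega) h3
        have h6 := hm l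
        rwa [h3, h5] at h6
    · simp only [dif_neg hex, sub_self, norm_zero]
      positivity

/-- Generalized eigenvectors for large eigenvalues are determined by at most two coordinates. -/
theorem exists_multiplicity_bound (h : DiagonalPerturbation A c α k K) :
    ∃ R : ℝ, ∀ (l : ℂ) (u : V), u ≠ 0 → A u = l • u → R < ‖l‖ →
      ∃ I : Finset ℤ, I.card ≤ 2 ∧ ∀ v : V,
        (∃ j : ℕ, ((A - algebraMap ℂ (Module.End ℂ V) l) ^ j) v = 0) →
          (∀ n ∈ I, c n v = 0) → v = 0 := by
  obtain ⟨R, hR⟩ := h.exists_local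
  obtain ⟨t, htR, ht1, hlow, -⟩ := h.exists_global R
  refine ⟨t ^ (k + 2), fun l u hu0 hu hl => ?_⟩
  obtain ⟨m, hm⟩ := h.exists_near hu0 hu
  have hmt : t ≤ ‖(m : ℂ) + α‖ := by
    by_contra! hcon
    have h1 := hlow _ hcon
    have h3 := norm_add_le (l - ((m : ℂ) + α) ^ (k + 2)) (((m : ℂ) + α) ^ (k + 2))
    rw [sub_add_cancel] at h3
    linarith
  obtain ⟨I, hI2, -, hloc⟩ := hR m (htR.trans hmt)
  -- A root vector is annihilated by `(X - l) ^ j`, the case of a repeated root.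
  refine ⟨I, hI2, fun v ⟨j, hj⟩ hv => hloc (Multiset.replicate j l) (fun z hz => ?_) v ?_ hv⟩
  · rwa [Multiset.eq_of_mem_replicate hz]
  · rw [Multiset.map_replicate, Multiset.prod_replicate, map_pow]
    simpa using hj

end DiagonalPerturbation

end Counting

/-! ### Normal form of differential operators over a commutative algebra. -/

section Order

variable {R : Type*} [CommRing R] [Algebra ℂ R]

/-- `T` is a differential operator of order less than `n` in the derivation `δ`. -/
def IsOrderLT (δ : Derivation ℂ R R) (n : ℕ) (T : R → R) : Prop :=
  ∃ b : ℕ → R, ∀ u, T u = ∑ j ∈ Finset.range n, b j * δ^[j] u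

namespace IsOrderLT

variable {δ : Derivation ℂ R R} {n m : ℕ} {T T' : R → R}

theorem add (h : IsOrderLT δ n T) (h' : IsOrderLT δ n T') :
    IsOrderLT δ n fun u => T u + T' u := by
  obtain ⟨b, hb⟩ := h
  obtain ⟨b', hb'⟩ := h'
  exact ⟨fun j => b j + b' j, fun u => by simp [hb, hb', add_mul, Finset.sum_add_distrib]⟩

theorem mul_left (h : IsOrderLT δ n T) (g : R) : IsOrderLT δ n fun u => g * T u := by
  obtain ⟨b, hb⟩ := h
  exact ⟨fun j => g * b j, fun u => by simp [hb, Finset.mul_sum, mul_assoc]⟩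

theorem single (δ : Derivation ℂ R R) (g : R) (hmn : m < n) :
    IsOrderLT δ n fun u => g * δ^[m] u :=
  ⟨fun j => if j = m then g else 0, fun u => by
    simp [ite_mul, Finset.sum_ite_eq', hmn]⟩

theorem mono (h : IsOrderLT δ n T) (hnm : n ≤ m) : IsOrderLT δ m T := by
  obtain ⟨b, hb⟩ := h
  refine ⟨fun j => if j < n then b j else 0, fun u => ?_⟩
  rw [hb, ← Finset.sum_subset (Finset.range_mono hnm)]
  · exact Finset.sum_congr rfl fun j hj => by simp [Finset.mem_range.1 hj]
  · intro j _ hj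
    have hj' : ¬ j < n := fun h => hj (Finset.mem_range.2 h)
    simp [hj']

theorem sum {ι : Type*} {s : Finset ι} {F : ι → R → R} (h : ∀ i ∈ s, IsOrderLT δ n (F i)) :
    IsOrderLT δ n fun u => ∑ i ∈ s, F i u := by
  classical
  induction s using Finset.induction_on with
  | empty => exact ⟨0, fun u => by simp⟩
  | insert i s hi ih =>
    have := (h i (Finset.mem_insert_self i s)).add
      (ih fun j hj => h j (Finset.mem_insert_of_mem hj))
    simpa [Finset.sum_insert hi] using this

theorem deriv (h : IsOrderLT δ n T) : IsOrderLT δ (n + 1) fun u => δ (T u) := by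
  obtain ⟨b, hb⟩ := h
  have e : (fun u => δ (T u)) = fun u => ∑ j ∈ Finset.range n,
      (δ (b j) * δ^[j] u + b j * δ^[j + 1] u) := by
    funext u
    rw [hb, map_sum]
    refine Finset.sum_congr rfl fun j _ => ?_
    rw [Derivation.leibniz, Function.iterate_succ_apply', smul_eq_mul, smul_eq_mul]
    ring
  rw [e]
  refine sum fun j hj => ?_
  have hj' := Finset.mem_range.1 hj
  exact (single δ _ (by omega)).add (single δ _ (by omega))

end IsOrderLT

theorem exists_iterate_mul_deriv (δ : Derivation ℂ R R) (g : R) (n : ℕ) :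
    ∃ T, IsOrderLT δ n T ∧ ∀ u, (fun v => g * δ v)^[n] u = g ^ n * δ^[n] u + T u := by
  induction n with
  | zero => exact ⟨fun _ => 0, ⟨0, fun u => by simp⟩, fun u => by simp⟩
  | succ n ih =>
    obtain ⟨T, hT, h⟩ := ih
    refine ⟨fun u => g * δ (g ^ n) * δ^[n] u + g * δ (T u),
      (IsOrderLT.single δ _ (by omega)).add (hT.deriv.mul_left g), fun u => ?_⟩
    rw [Function.iterate_succ_apply', h, Function.iterate_succ_apply' δ, map_add,
      Derivation.leibniz, smul_eq_mul, smul_eq_mul]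
    ring

theorem exists_iterate_add (δ : Derivation ℂ R R) (h : R) (n : ℕ) :
    ∃ T, IsOrderLT δ n T ∧ ∀ u, (fun v => δ v + h * v)^[n] u = δ^[n] u + T u := by
  induction n with
  | zero => exact ⟨fun _ => 0, ⟨0, fun u => by simp⟩, fun u => by simp⟩
  | succ n ih =>
    obtain ⟨T, hT, e⟩ := ih
    refine ⟨fun u => h * δ^[n] u + (δ (T u) + h * T u), (IsOrderLT.single δ _ (by omega)).add
      (hT.deriv.add ((hT.mul_left h).mono (by omega))), fun u => ?_⟩
    rw [Function.iterate_succ_apply', e, Function.iterate_succ_apply' δ, map_add]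
    ring

/-- The subleading coefficient has to be known exactly, since it decides which gauge to apply; lower
terms may be arbitrary. -/
theorem exists_iterate_add_succ (δ : Derivation ℂ R R) (h : R) (n : ℕ) :
    ∃ T, IsOrderLT δ n T ∧ ∀ u, (fun v => δ v + h * v)^[n + 1] u =
      δ^[n + 1] u + (n + 1 : ℕ) * h * δ^[n] u + T u := by
  induction n with
  | zero => exact ⟨fun _ => 0, ⟨0, fun u => by simp⟩, fun u => by simp⟩
  | succ n ih =>
    obtain ⟨T, hT, e⟩ := ih
    refine ⟨fun u => (δ ((n + 1 : ℕ) * h) + (n + 1 : ℕ) * h * h) * δ^[n] u + (δ (T u) + h * T u),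
      (IsOrderLT.single δ _ (by omega)).add
      (hT.deriv.add ((hT.mul_left h).mono (by omega))), fun u => ?_⟩
    rw [Function.iterate_succ_apply', e, Function.iterate_succ_apply' δ (n + 1), map_add, map_add,
      Derivation.leibniz (a := ((n + 1 : ℕ) : R) * h), smul_eq_mul, smul_eq_mul,
      Function.iterate_succ_apply' δ n]
    push_cast
    ring

/-- Conjugation by `E` replaces `δ` by `δ + h`, where `h` is the logarithmic derivative of `E`. -/
theorem iterate_mul_unit {δ : Derivation ℂ R R} {E h : R} (hE : δ E = E * h) (n : ℕ) (u : R) :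
    δ^[n] (E * u) = E * (fun v => δ v + h * v)^[n] u := by
  induction n generalizing u with
  | zero => rfl
  | succ n ih =>
    rw [Function.iterate_succ_apply, Function.iterate_succ_apply, ← ih]
    congr 1
    rw [Derivation.leibniz, hE, smul_eq_mul, smul_eq_mul]
    ring

theorem IsOrderLT.conj {δ : Derivation ℂ R R} {E E' h : R} (hEE : E' * E = 1) (hE : δ E = E * h)
    {n : ℕ} {T : R → R} (hT : IsOrderLT δ n T) : IsOrderLT δ n fun u => E' * T (E * u) := by
  obtain ⟨b, hb⟩ := hT
  have e : (fun u => E' * T (E * u)) =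
      fun u => ∑ j ∈ Finset.range n, b j * (fun v => δ v + h * v)^[j] u := by
    funext u
    rw [hb, Finset.mul_sum]
    refine Finset.sum_congr rfl fun j _ => ?_
    rw [iterate_mul_unit hE]
    linear_combination (b j * (fun v => δ v + h * v)^[j] u) * hEE
  rw [e]
  refine IsOrderLT.sum fun j hj => ?_
  have hj' := Finset.mem_range.1 hj
  obtain ⟨S, hS, hS'⟩ := exists_iterate_add δ h j
  have := ((IsOrderLT.single δ 1 hj').add (hS.mono hj'.le)).mul_left (b j)
  simpa [hS'] using this

/-- A differential operator with leading part `C₁ δ ^ N` is conjugate, by multiplication with a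
unit, to `C₁ (δ + α) ^ N` plus terms of order at most `N - 2`. -/
theorem exists_normal_form (δ : Derivation ℂ R R) (P : ℕ → R) (g : R) (k : ℕ) {C₁ : ℂ}
    (hC₁ : C₁ ≠ 0) (hlead : P (k + 2) * g ^ (k + 2) = algebraMap ℂ R C₁)
    (hgauge : ∀ a : R, ∃ (α : ℂ) (E E' : R), E' * E = 1 ∧ δ E = E * (algebraMap ℂ R α - a)) :
    ∃ (α : ℂ) (E E' : R) (b : ℕ → R), E' * E = 1 ∧ ∀ u,
      E' * ∑ j ∈ Finset.range (k + 3), P j * (fun v => g * δ v)^[j] (E * u) =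
        C₁ • ((fun v => δ v + α • v)^[k + 2] u + ∑ j ∈ Finset.range (k + 1), b j * δ^[j] u) := by
  obtain ⟨T, hT, e⟩ : ∃ T, IsOrderLT δ (k + 2) T ∧ ∀ u,
      ∑ j ∈ Finset.range (k + 3), P j * (fun v => g * δ v)^[j] u =
        C₁ • (δ^[k + 2] u + T u) := by
    obtain ⟨T₁, hT₁, e₁⟩ := exists_iterate_mul_deriv δ g (k + 2)
    have hlow : IsOrderLT δ (k + 2) fun u => ∑ j ∈ Finset.range (k + 2),
        P j * (fun v => g * δ v)^[j] u := by
      refine IsOrderLT.sum fun j hj => ?_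
      have hj' := Finset.mem_range.1 hj
      obtain ⟨S, hS, hS'⟩ := exists_iterate_mul_deriv δ g j
      have := ((IsOrderLT.single δ (g ^ j) hj').add (hS.mono hj'.le)).mul_left (P j)
      simpa [hS'] using this
    refine ⟨_, (hlow.add (hT₁.mul_left (P (k + 2)))).mul_left (algebraMap ℂ R C₁⁻¹), fun u => ?_⟩
    have hCC : algebraMap ℂ R C₁ * algebraMap ℂ R C₁⁻¹ = 1 := by
      rw [← map_mul, mul_inv_cancel₀ hC₁, map_one]
    rw [Finset.sum_range_succ, e₁, Algebra.smul_def, ← hlead]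
    rw [← hlead] at hCC
    set Sg := ∑ j ∈ Finset.range (k + 2), P j * (fun v => g * δ v)^[j] u
    linear_combination (-(Sg + P (k + 2) * T₁ u)) * hCC
  obtain ⟨b, hb⟩ := hT
  set a := b (k + 1) with ha
  have hN : ((k + 2 : ℕ) : ℂ) ≠ 0 := Nat.cast_ne_zero.2 (by omega)
  -- Conjugation adds `(k + 2) h` to the subleading coefficient `a`. The choice `h = α - a / (k +
  -- 2)` leaves `(k + 2) α`, the subleading coefficient of `(δ + α) ^ (k + 2)`.
  obtain ⟨α, E, E', hEE, hE⟩ := hgauge (algebraMap ℂ R ((k + 2 : ℕ) : ℂ)⁻¹ * a)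
  set h := algebraMap ℂ R α - algebraMap ℂ R ((k + 2 : ℕ) : ℂ)⁻¹ * a with hh
  have hNh : ((k + 2 : ℕ) : R) * h + a = ((k + 2 : ℕ) : R) * algebraMap ℂ R α := by
    have : ((k + 2 : ℕ) : R) * algebraMap ℂ R ((k + 2 : ℕ) : ℂ)⁻¹ = 1 := by
      rw [← map_natCast (algebraMap ℂ R) (k + 2), ← map_mul, mul_inv_cancel₀ hN, map_one]
    rw [hh]
    linear_combination -a * this
  obtain ⟨T₂, hT₂, e₂⟩ := exists_iterate_add_succ δ h (k + 1)
  obtain ⟨T₃, hT₃, e₃⟩ := exists_iterate_add_succ δ (algebraMap ℂ R α) (k + 1)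
  obtain ⟨T₄, hT₄, e₄⟩ := exists_iterate_add δ h (k + 1)
  have hlow : IsOrderLT δ (k + 1) fun u => ∑ j ∈ Finset.range (k + 1), b j * δ^[j] u :=
    ⟨b, fun _ => rfl⟩
  obtain ⟨b', hb'⟩ := (((hT₂.add (hT₃.mul_left (-1))).add (hT₄.mul_left a)).add (hlow.conj hEE hE))
  refine ⟨α, E, E', b', hEE, fun u => ?_⟩
  rw [e, mul_smul_comm, ← hb']
  congr 1
  have hsm : (fun v => δ v + α • v) = fun v => δ v + algebraMap ℂ R α * v := by
    funext v; rw [Algebra.smul_def]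
  rw [hsm, e₃, hb, Finset.sum_range_succ, iterate_mul_unit hE, iterate_mul_unit hE (k + 1), e₂, e₄,
    ← ha]
  set Sg := ∑ j ∈ Finset.range (k + 1), b j * δ^[j] (E * u)
  push_cast at hNh ⊢
  linear_combination (δ^[k + 2] u + (k + 1 + 1) * h * δ^[k + 1] u + T₂ u +
    a * (δ^[k + 1] u + T₄ u)) * hEE + δ^[k + 1] u * hNh

end Order

/-! ### From the normal form to a perturbed diagonal operator. -/

section Coordinates

variable {R : Type*} [CommRing R] [Algebra ℂ R]

/-- The operator `(δ + α) ^ N + ∑ b_j δ ^ j`. -/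
noncomputable def perturbedPower (δ : Derivation ℂ R R) (α : ℂ) (k : ℕ) (b : ℕ → R) :
    Module.End ℂ R :=
  ((δ : R →ₗ[ℂ] R) + α • LinearMap.id) ^ (k + 2) +
    ∑ j ∈ Finset.range (k + 1), LinearMap.mulLeft ℂ (b j) ∘ₗ ((δ : R →ₗ[ℂ] R) ^ j : Module.End ℂ R)

theorem perturbedPower_apply (δ : Derivation ℂ R R) (α : ℂ) (k : ℕ) (b : ℕ → R) (u : R) :
    perturbedPower δ α k b u =
      (fun v => δ v + α • v)^[k + 2] u + ∑ j ∈ Finset.range (k + 1), b j * δ^[j] u := by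
  simp only [perturbedPower, LinearMap.add_apply, LinearMap.sum_apply, LinearMap.comp_apply,
    LinearMap.mulLeft_apply, Module.End.pow_apply]
  rfl

theorem l2_sum_le {ι : Type*} (s : Finset ι) {v : ι → ℤ → ℂ} (hv : ∀ i, SqSummable (v i)) :
    SqSummable (fun n => ∑ i ∈ s, v i n) ∧ l2 (fun n => ∑ i ∈ s, v i n) ≤ ∑ i ∈ s, l2 (v i) := by
  classical
  induction s using Finset.induction_on with
  | empty => simp [SqSummable, l2, summable_zero]
  | insert i s hi ih =>
    simp only [Finset.sum_insert hi]
    exact ⟨(hv i).add ih.1, (l2_add_le (hv i) ih.1).trans (add_le_add le_rfl ih.2)⟩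

theorem coord_iterate {δ : Derivation ℂ R R} {c : ℤ → R →ₗ[ℂ] ℂ}
    (hδ : ∀ n u, c n (δ u) = n * c n u) (n : ℤ) (j : ℕ) (u : R) :
    c n (δ^[j] u) = (n : ℂ) ^ j * c n u := by
  induction j with
  | zero => simp
  | succ j ih => rw [Function.iterate_succ_apply', hδ, ih]; ring

theorem coord_iterate_add {δ : Derivation ℂ R R} {c : ℤ → R →ₗ[ℂ] ℂ}
    (hδ : ∀ n u, c n (δ u) = n * c n u) (α : ℂ) (n : ℤ) (j : ℕ) (u : R) :
    c n ((fun v => δ v + α • v)^[j] u) = ((n : ℂ) + α) ^ j * c n u := by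
  induction j with
  | zero => simp
  | succ j ih =>
    rw [Function.iterate_succ_apply', map_add, hδ, map_smul, ih, smul_eq_mul]; ring

/-- Multiplications are bounded in the coordinates and `δ ^ j` acts as `n ^ j`, so the remainder
costs at most a constant times `(1 + ‖n + α‖) ^ k`. -/
theorem exists_diagonalPerturbation {δ : Derivation ℂ R R} {c : ℤ → R →ₗ[ℂ] ℂ}
    (hδ : ∀ n u, c n (δ u) = n * c n u) (hsq : ∀ u, SqSummable fun n => c n u)
    (hinj : ∀ u, (∀ n, c n u = 0) → u = 0)
    (hmul : ∀ b : R, ∃ B : ℝ, 0 ≤ B ∧ ∀ u, l2 (fun n => c n (b * u)) ≤ B * l2 (fun n => c n u))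
    (α : ℂ) (k : ℕ) (b : ℕ → R) :
    ∃ K : ℝ, DiagonalPerturbation (perturbedPower δ α k b) c α k K := by
  choose B hB0 hB using hmul
  have hnα : ∀ n : ℤ, 1 + ‖(n : ℂ) + α‖ ≤ (1 + ‖α‖) * (1 + |(n : ℝ)|) := fun n => by
    have h1 := norm_add_le (n : ℂ) α
    rw [Complex.norm_intCast] at h1
    nlinarith [mul_nonneg (norm_nonneg α) (abs_nonneg (n : ℝ))]
  have hαn : ∀ n : ℤ, |(n : ℝ)| ≤ (1 + ‖α‖) * (1 + ‖(n : ℂ) + α‖) := fun n => by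
    have h1 : ‖(n : ℂ)‖ ≤ ‖(n : ℂ) + α‖ + ‖α‖ := by simpa using norm_sub_le ((n : ℂ) + α) α
    rw [Complex.norm_intCast] at h1
    nlinarith [mul_nonneg (norm_nonneg α) (norm_nonneg ((n : ℂ) + α))]
  -- The weight is dominated by a multiple of `1 + |n| ^ (k + 2)`, and `n ^ (k + 2) c n u` is a
  -- coordinate of `δ ^ (k + 2) u`, again an element of the algebra.
  have hsqw : ∀ u, SqSummable fun n => (((1 + ‖(n : ℂ) + α‖) ^ (k + 2) : ℝ) : ℂ) * c n u := by
    intro u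
    have h1 : SqSummable fun n : ℤ =>
        (((1 + ‖α‖) ^ (k + 2) * (2 ^ (k + 1) * (1 + |(n : ℝ)| ^ (k + 2))) : ℝ) : ℂ) * c n u := by
      have h2 := ((hsq u).const_mul ((1 + ‖α‖) ^ (k + 2) * 2 ^ (k + 1) : ℝ)).mono
        (v := fun n => (((1 + ‖α‖) ^ (k + 2) * 2 ^ (k + 1) : ℝ) : ℂ) * c n u) (c := 1)
        (fun n => by simp)
      have h3 : SqSummable fun n : ℤ =>
          (((1 + ‖α‖) ^ (k + 2) * 2 ^ (k + 1) * |(n : ℝ)| ^ (k + 2) : ℝ) : ℂ) * c n u := by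
        refine ((hsq (δ^[k + 2] u)).const_mul ((1 + ‖α‖) ^ (k + 2) * 2 ^ (k + 1) : ℝ)).mono
          (c := 1) fun n => ?_
        rw [coord_iterate hδ, one_mul]
        simp only [norm_mul, Complex.norm_real, norm_pow, Real.norm_eq_abs, abs_abs,
          Complex.norm_intCast]
        exact le_of_eq (by ring)
      refine (h2.add h3).mono (c := 1) fun n => ?_
      rw [one_mul]
      refine le_of_eq (congrArg norm ?_)
      push_cast
      ring
    refine h1.mono (c := 1) fun n => ?_
    rw [one_mul, norm_mul, norm_mul, Complex.norm_real, Complex.norm_real,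
      Real.norm_of_nonneg (by positivity), Real.norm_of_nonneg (by positivity)]
    refine mul_le_mul_of_nonneg_right ?_ (norm_nonneg _)
    refine (pow_le_pow_left₀ (by positivity) (hnα n) _).trans ?_
    rw [mul_pow]
    refine mul_le_mul_of_nonneg_left ?_ (by positivity)
    simpa using add_pow_le (zero_le_one (α := ℝ)) (abs_nonneg (n : ℝ)) (k + 2)
  have hsqk : ∀ u (D : ℝ), SqSummable fun n => ((D * (1 + ‖(n : ℂ) + α‖) ^ k : ℝ) : ℂ) * c n u := by
    intro u D
    refine (hsqw u).mono (c := |D|) fun n => ?_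
    rw [norm_mul, norm_mul, Complex.norm_real, Complex.norm_real, norm_mul,
      Real.norm_of_nonneg (by positivity : (0 : ℝ) ≤ (1 + ‖(n : ℂ) + α‖) ^ k),
      Real.norm_of_nonneg (by positivity : (0 : ℝ) ≤ (1 + ‖(n : ℂ) + α‖) ^ (k + 2)),
      Real.norm_eq_abs, ← mul_assoc]
    refine mul_le_mul_of_nonneg_right (mul_le_mul_of_nonneg_left ?_ (abs_nonneg D)) (norm_nonneg _)
    exact pow_le_pow_right₀ (by linarith [norm_nonneg ((n : ℂ) + α)]) (by omega)
  set K := ∑ j ∈ Finset.range (k + 1), B (b j) * (1 + ‖α‖) ^ k with hK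
  have hK0 : 0 ≤ K := Finset.sum_nonneg fun j _ => mul_nonneg (hB0 _) (by positivity)
  -- The added `1` makes the constant positive even when the remainder vanishes.
  refine ⟨K + 1, by linarith, hinj, hsqw, fun u => ?_⟩
  have e : (fun n : ℤ => c n (perturbedPower δ α k b u) - ((n : ℂ) + α) ^ (k + 2) * c n u) =
      fun n => ∑ j ∈ Finset.range (k + 1), c n (b j * δ^[j] u) := by
    funext n
    rw [perturbedPower_apply, map_add, coord_iterate_add hδ, map_sum]
    ring
  rw [e]
  set W := l2 (fun n : ℤ => (((1 : ℝ) * (1 + ‖(n : ℂ) + α‖) ^ k : ℝ) : ℂ) * c n u) with hW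
  have hterm : ∀ j ∈ Finset.range (k + 1), l2 (fun n => c n (b j * δ^[j] u)) ≤
      B (b j) * (1 + ‖α‖) ^ k * W := by
    intro j hj
    have hj' := Finset.mem_range.1 hj
    rw [mul_assoc]
    refine (hB _ _).trans (mul_le_mul_of_nonneg_left ?_ (hB0 _))
    refine l2_mono (by positivity) (hsqk u 1) fun n => ?_
    rw [coord_iterate hδ, norm_mul, norm_mul, norm_pow, Complex.norm_intCast, Complex.norm_real,
      Real.norm_of_nonneg (by positivity), one_mul, ← mul_assoc]
    refine mul_le_mul_of_nonneg_right ?_ (norm_nonneg _)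
    rw [← mul_pow]
    have h1 : 1 ≤ (1 + ‖α‖) * (1 + ‖(n : ℂ) + α‖) := by
      nlinarith [norm_nonneg α, norm_nonneg ((n : ℂ) + α),
        mul_nonneg (norm_nonneg α) (norm_nonneg ((n : ℂ) + α))]
    exact (pow_le_pow_left₀ (abs_nonneg _) (hαn n) j).trans (pow_le_pow_right₀ h1 (by omega))
  have hle := (l2_sum_le (Finset.range (k + 1)) (v := fun j n => c n (b j * δ^[j] u))
    fun j => hsq _).2.trans (Finset.sum_le_sum hterm)
  rw [← Finset.sum_mul, ← hK] at hle
  refine hle.trans ?_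
  refine (mul_le_mul_of_nonneg_right (by linarith : K ≤ K + 1) (l2_nonneg _)).trans ?_
  rw [← le_div_iff₀' (by linarith : 0 < K + 1), div_eq_inv_mul]
  refine l2_mono (by positivity) (hsqk u (K + 1)) fun n => ?_
  rw [norm_mul, norm_mul, Complex.norm_real, Complex.norm_real,
    Real.norm_of_nonneg (by positivity), Real.norm_of_nonneg (by positivity)]
  refine le_of_eq ?_
  field_simp

end Coordinates

/-! ### Fourier analysis on the circle in a weighted angular coordinate. -/

section Circle

open MeasureTheory intervalIntegral
open scoped ContDiff

/-- The algebra of smooth `2π`-periodic functions. -/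
def SmoothPeriodic : Subalgebra ℂ (ℝ → ℂ) where
  carrier := {u | ContDiff ℝ ∞ u ∧ Function.Periodic u (2 * Real.pi)}
  mul_mem' := fun hu hv => ⟨hu.1.mul hv.1, hu.2.mul hv.2⟩
  add_mem' := fun hu hv => ⟨hu.1.add hv.1, hu.2.add hv.2⟩
  algebraMap_mem' := fun _ => ⟨contDiff_const, fun _ => rfl⟩

namespace SmoothPeriodic

theorem contDiff_coe (u : SmoothPeriodic) : ContDiff ℝ ∞ (u : ℝ → ℂ) := u.2.1

theorem periodic_coe (u : SmoothPeriodic) : Function.Periodic (u : ℝ → ℂ) (2 * Real.pi) := u.2.2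

theorem continuous_coe (u : SmoothPeriodic) : Continuous (u : ℝ → ℂ) :=
  (SmoothPeriodic.contDiff_coe u).continuous

theorem differentiable_coe (u : SmoothPeriodic) : Differentiable ℝ (u : ℝ → ℂ) :=
  (SmoothPeriodic.contDiff_coe u).differentiable (by simp)

theorem deriv_mem (u : SmoothPeriodic) : deriv (u : ℝ → ℂ) ∈ SmoothPeriodic :=
  ⟨(contDiff_infty_iff_deriv.1 (SmoothPeriodic.contDiff_coe u)).2, fun θ => by
    rw [← deriv_comp_add_const]
    congr 1
    exact funext (SmoothPeriodic.periodic_coe u)⟩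

/-- The derivation `-i g d/dθ`. -/
noncomputable def derivation (g : SmoothPeriodic) : Derivation ℂ SmoothPeriodic SmoothPeriodic :=
  Derivation.mk'
    { toFun := fun u => algebraMap ℂ SmoothPeriodic (-Complex.I) * g *
        ⟨deriv u, SmoothPeriodic.deriv_mem u⟩
      map_add' := fun u v => by
        ext θ
        have : deriv (fun t => (u : ℝ → ℂ) t + (v : ℝ → ℂ) t) θ = _ :=
          deriv_fun_add ((SmoothPeriodic.differentiable_coe u) θ)
            ((SmoothPeriodic.differentiable_coe v) θ)
        simp only [Subalgebra.coe_mul, Subalgebra.coe_add, Pi.mul_apply, Pi.add_apply]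
        erw [this]
        ring
      map_smul' := fun z u => by
        ext θ
        have : deriv (fun t => z • (u : ℝ → ℂ) t) θ = _ :=
          deriv_fun_const_smul z ((SmoothPeriodic.differentiable_coe u) θ)
        simp only [Subalgebra.coe_mul, Pi.mul_apply, RingHom.id_apply, Subalgebra.coe_smul,
          Pi.smul_apply]
        erw [this]
        simp only [smul_eq_mul]
        ring }
    (fun u v => by
      ext θ
      have : deriv (fun t => (u : ℝ → ℂ) t * (v : ℝ → ℂ) t) θ = _ :=
          deriv_fun_mul ((SmoothPeriodic.differentiable_coe u) θ)
            ((SmoothPeriodic.differentiable_coe v) θ)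
      simp only [LinearMap.coe_mk, AddHom.coe_mk, Subalgebra.coe_mul, Pi.mul_apply,
        Subalgebra.coe_add, Pi.add_apply, smul_eq_mul]
      erw [this]
      ring)

theorem exists_norm_le (u : SmoothPeriodic) : ∃ B : ℝ, 0 ≤ B ∧ ∀ θ ∈ Set.Icc 0 (2 * Real.pi),
    ‖(u : ℝ → ℂ) θ‖ ≤ B := by
  obtain ⟨B, hB⟩ := isCompact_Icc.exists_bound_of_continuousOn
    ((SmoothPeriodic.continuous_coe u).continuousOn (s := Set.Icc 0 (2 * Real.pi)))
  exact ⟨max B 0, le_max_right _ _, fun θ hθ => (hB θ hθ).trans (le_max_left _ _)⟩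

theorem ext_Icc {u v : SmoothPeriodic}
    (h : ∀ θ ∈ Set.Icc 0 (2 * Real.pi), (u : ℝ → ℂ) θ = (v : ℝ → ℂ) θ) : u = v := by
  ext θ
  obtain ⟨y, hy, hy'⟩ := (periodic_coe (u - v)).exists_mem_Ico₀ (by positivity) θ
  have e : ∀ t, ((u - v : SmoothPeriodic) : ℝ → ℂ) t = (u : ℝ → ℂ) t - (v : ℝ → ℂ) t :=
    fun _ => rfl
  rw [e, e, h y (Set.Ico_subset_Icc_self hy), sub_self] at hy'
  exact sub_eq_zero.1 hy'

end SmoothPeriodic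

/-- A smooth positive `2π`-periodic density on the line of mean one. -/
structure CircleDensity where
  h : ℝ → ℝ
  smooth : ContDiff ℝ ∞ h
  periodic : Function.Periodic h (2 * Real.pi)
  pos : ∀ θ, 0 < h θ
  integral : ∫ θ in (0 : ℝ)..2 * Real.pi, h θ = 2 * Real.pi

namespace CircleDensity

variable (d : CircleDensity)

theorem continuous : Continuous d.h := d.smooth.continuous

/-- The angular coordinate with the given density. -/
noncomputable def angle (θ : ℝ) : ℝ := ∫ t in (0 : ℝ)..θ, d.h t

theorem angle_zero : d.angle 0 = 0 := integral_same

theorem angle_two_pi : d.angle (2 * Real.pi) = 2 * Real.pi := d.integral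

theorem hasDerivAt_angle (θ : ℝ) : HasDerivAt d.angle (d.h θ) θ :=
  integral_hasDerivAt_right (d.continuous.intervalIntegrable _ _)
    (d.continuous.stronglyMeasurableAtFilter _ _) d.continuous.continuousAt

theorem continuous_angle : Continuous d.angle :=
  continuous_iff_continuousAt.2 fun θ => (d.hasDerivAt_angle θ).continuousAt

theorem strictMono_angle : StrictMono d.angle :=
  strictMono_of_deriv_pos fun θ => by rw [(d.hasDerivAt_angle θ).deriv]; exact d.pos θ

/-- The inverse density, as a smooth periodic function. -/
noncomputable def inv : SmoothPeriodic :=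
  ⟨fun θ => ((d.h θ)⁻¹ : ℝ), Complex.ofRealCLM.contDiff.comp
    (d.smooth.inv fun θ => (d.pos θ).ne'), fun θ => by simp [d.periodic θ]⟩

/-- The derivation `-i d/dx` in the angular coordinate `x`. -/
noncomputable def delta : Derivation ℂ SmoothPeriodic SmoothPeriodic :=
  SmoothPeriodic.derivation d.inv

theorem delta_apply (u : SmoothPeriodic) (θ : ℝ) :
    (d.delta u : ℝ → ℂ) θ = -Complex.I * ((d.h θ)⁻¹ : ℝ) * deriv (u : ℝ → ℂ) θ := rfl

/-- The exponentials in the angular coordinate. -/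
noncomputable def expo (n : ℤ) (θ : ℝ) : ℂ := Complex.exp (-(n * d.angle θ * Complex.I))

theorem hasDerivAt_expo (n : ℤ) (θ : ℝ) :
    HasDerivAt (d.expo n) (d.expo n θ * -(n * d.h θ * Complex.I)) θ := by
  have h := (d.hasDerivAt_angle θ).ofReal_comp
  exact ((((h.const_mul (n : ℂ)).mul_const Complex.I).neg).cexp)

theorem continuous_expo (n : ℤ) : Continuous (d.expo n) :=
  continuous_iff_continuousAt.2 fun θ => (d.hasDerivAt_expo n θ).continuousAt

theorem expo_two_pi (n : ℤ) : d.expo n (2 * Real.pi) = d.expo n 0 := by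
  unfold expo
  rw [angle_two_pi, angle_zero]
  simp only [Complex.ofReal_mul, Complex.ofReal_ofNat, Complex.ofReal_zero, mul_zero, zero_mul,
    neg_zero, Complex.exp_zero]
  rw [Complex.exp_eq_one_iff]
  exact ⟨-n, by push_cast; ring⟩

theorem continuous_integrand (n : ℤ) (u : SmoothPeriodic) :
    Continuous fun θ => (u : ℝ → ℂ) θ * d.h θ * d.expo n θ :=
  ((SmoothPeriodic.continuous_coe u).mul (Complex.continuous_ofReal.comp d.continuous)).mul
    (d.continuous_expo n)

/-- The Fourier coefficients in the angular coordinate. -/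
noncomputable def coeff (n : ℤ) : SmoothPeriodic →ₗ[ℂ] ℂ where
  toFun u := (2 * Real.pi : ℂ)⁻¹ * ∫ θ in (0 : ℝ)..2 * Real.pi, (u : ℝ → ℂ) θ * d.h θ * d.expo n θ
  map_add' u v := by
    rw [← mul_add,
      ← intervalIntegral.integral_add ((d.continuous_integrand n u).intervalIntegrable _ _)
      ((d.continuous_integrand n v).intervalIntegrable _ _)]
    congr 1
    refine integral_congr fun θ _ => ?_
    simp only [Subalgebra.coe_add, Pi.add_apply]
    ring
  map_smul' z u := by
    rw [RingHom.id_apply, smul_eq_mul, mul_left_comm, ← intervalIntegral.integral_const_mul z]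
    congr 1
    refine integral_congr fun θ _ => ?_
    simp only [Subalgebra.coe_smul, Pi.smul_apply, smul_eq_mul]
    ring

theorem coeff_apply (n : ℤ) (u : SmoothPeriodic) : d.coeff n u =
    (2 * Real.pi : ℂ)⁻¹ * ∫ θ in (0 : ℝ)..2 * Real.pi, (u : ℝ → ℂ) θ * d.h θ * d.expo n θ := rfl

/-- Integration by parts: the density in the integral cancels the inverse density in `d.delta`, and
boundary terms cancel by periodicity. -/
theorem coeff_delta (n : ℤ) (u : SmoothPeriodic) : d.coeff n (d.delta u) = n * d.coeff n u := by
  have hu : Continuous (deriv (u : ℝ → ℂ)) :=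
    SmoothPeriodic.continuous_coe ⟨_, SmoothPeriodic.deriv_mem u⟩
  have key : ∫ θ in (0 : ℝ)..2 * Real.pi,
      (deriv (u : ℝ → ℂ) θ * d.expo n θ + (u : ℝ → ℂ) θ * (d.expo n θ * -(n * d.h θ * Complex.I))) =
      0 := by
    rw [integral_eq_sub_of_hasDerivAt (f := fun θ => (u : ℝ → ℂ) θ * d.expo n θ)
      (fun θ _ => ((SmoothPeriodic.differentiable_coe u) θ).hasDerivAt.mul (d.hasDerivAt_expo n θ))]
    · rw [d.expo_two_pi]
      have := (SmoothPeriodic.periodic_coe u) 0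
      rw [zero_add] at this
      rw [this, sub_self]
    · refine Continuous.intervalIntegrable ?_ _ _
      have h1 := (SmoothPeriodic.continuous_coe u)
      have h2 := d.continuous_expo n
      have h3 : Continuous fun θ => (d.h θ : ℂ) := Complex.continuous_ofReal.comp d.continuous
      fun_prop
  have e1 : ∫ θ in (0 : ℝ)..2 * Real.pi, (d.delta u : ℝ → ℂ) θ * d.h θ * d.expo n θ =
      -Complex.I * ∫ θ in (0 : ℝ)..2 * Real.pi, deriv (u : ℝ → ℂ) θ * d.expo n θ := by
    rw [← intervalIntegral.integral_const_mul]
    refine integral_congr fun θ _ => ?_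
    have : (d.h θ : ℂ) ≠ 0 := by exact_mod_cast (d.pos θ).ne'
    simp only [delta_apply, Complex.ofReal_inv]
    field_simp
  rw [intervalIntegral.integral_add (f := fun θ => deriv (u : ℝ → ℂ) θ * d.expo n θ)
    ((hu.mul (d.continuous_expo n)).intervalIntegrable _ _)] at key
  · have e2 : ∫ θ in (0 : ℝ)..2 * Real.pi, (u : ℝ → ℂ) θ * (d.expo n θ * -(n * d.h θ * Complex.I)) =
        -(n * Complex.I) * ∫ θ in (0 : ℝ)..2 * Real.pi, (u : ℝ → ℂ) θ * d.h θ * d.expo n θ := by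
      rw [← intervalIntegral.integral_const_mul]
      refine integral_congr fun θ _ => ?_
      ring
    rw [e2] at key
    rw [coeff_apply, coeff_apply, e1, eq_neg_of_add_eq_zero_left key]
    linear_combination (-(2 * Real.pi : ℂ)⁻¹ * n *
      ∫ θ in (0 : ℝ)..2 * Real.pi, (u : ℝ → ℂ) θ * d.h θ * d.expo n θ) * Complex.I_sq
  · refine Continuous.intervalIntegrable ?_ _ _
    have h1 := (SmoothPeriodic.continuous_coe u)
    have h2 := d.continuous_expo n
    have h3 : Continuous fun θ => (d.h θ : ℂ) := Complex.continuous_ofReal.comp d.continuous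
    fun_prop

theorem angle_add_two_pi (θ : ℝ) : d.angle (θ + 2 * Real.pi) = d.angle θ + 2 * Real.pi := by
  have h : d.angle (θ + 2 * Real.pi) = d.angle θ + ∫ t in θ..θ + 2 * Real.pi, d.h t :=
    (integral_add_adjacent_intervals (d.continuous.intervalIntegrable _ _)
      (d.continuous.intervalIntegrable _ _)).symm
  rw [h, d.periodic.intervalIntegral_add_eq θ 0, zero_add, d.integral]

/-- Since `d.angle θ - θ` is periodic, the coordinate fixes all multiples of `2π`; the rest is the
intermediate value theorem. -/
theorem surjective_angle : Function.Surjective d.angle := by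
  have hp : Function.Periodic (fun θ => d.angle θ - θ) (2 * Real.pi) := fun θ => by
    simp only [d.angle_add_two_pi]; ring
  have hn : ∀ n : ℤ, d.angle (n * (2 * Real.pi)) = n * (2 * Real.pi) := fun n => by
    have h := hp.int_mul_eq n
    simp only [d.angle_zero, sub_zero] at h
    linarith
  have hpi : (0 : ℝ) < 2 * Real.pi := by positivity
  intro y
  refine mem_range_of_exists_le_of_exists_ge d.continuous_angle
    ⟨⌊y / (2 * Real.pi)⌋ * (2 * Real.pi), ?_⟩ ⟨⌈y / (2 * Real.pi)⌉ * (2 * Real.pi), ?_⟩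
  · rw [hn, ← le_div_iff₀ hpi]
    exact Int.floor_le _
  · rw [hn, ← div_le_iff₀ hpi]
    exact Int.le_ceil _

/-- **Parseval's identity** in the angular coordinate. -/
theorem hasSum_sq_coeff (u : SmoothPeriodic) : HasSum (fun n => ‖d.coeff n u‖ ^ 2)
    ((2 * Real.pi)⁻¹ * ∫ θ in (0 : ℝ)..2 * Real.pi, d.h θ * ‖(u : ℝ → ℂ) θ‖ ^ 2) := by
  have hpi : (0 : ℝ) < 2 * Real.pi := by positivity
  -- Transport to the coordinate `y = d.angle θ` reduces the claim to the classical Parseval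
  -- identity; only continuity of the inverse is needed.
  let e := (d.strictMono_angle.orderIsoOfSurjective _ d.surjective_angle).toHomeomorph
  have he : ∀ θ, e.symm (d.angle θ) = θ := fun θ => e.symm_apply_apply θ
  set v : ℝ → ℂ := fun y => (u : ℝ → ℂ) (e.symm y) with hv
  have hvc : Continuous v := (SmoothPeriodic.continuous_coe u).comp e.symm.continuous
  have hL2 : MemLp v 2 (volume.restrict (Set.Ioc 0 (2 * Real.pi))) := by
    obtain ⟨B, hB⟩ := (isCompact_Icc (a := (0 : ℝ)) (b := 2 * Real.pi)).exists_bound_of_continuousOn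
      hvc.continuousOn
    refine MemLp.of_bound hvc.aestronglyMeasurable B ?_
    filter_upwards [ae_restrict_mem measurableSet_Ioc] with y hy
    exact hB y (Set.Ioc_subset_Icc_self hy)
  have key := hasSum_sq_fourierCoeffOn hpi hL2
  have hsub : ∀ g : ℝ → ℂ, Continuous g → ∫ y in (0 : ℝ)..2 * Real.pi, g y =
      ∫ θ in (0 : ℝ)..2 * Real.pi, d.h θ • g (d.angle θ) := by
    intro g hg
    have := intervalIntegral.integral_deriv_smul_comp (a := 0) (b := 2 * Real.pi)
      (fun θ _ => d.hasDerivAt_angle θ) d.continuous.continuousOn hg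
    rw [d.angle_zero, d.angle_two_pi] at this
    exact this.symm
  have hsub' : ∀ g : ℝ → ℝ, Continuous g → ∫ y in (0 : ℝ)..2 * Real.pi, g y =
      ∫ θ in (0 : ℝ)..2 * Real.pi, d.h θ • g (d.angle θ) := by
    intro g hg
    have := intervalIntegral.integral_deriv_smul_comp (a := 0) (b := 2 * Real.pi)
      (fun θ _ => d.hasDerivAt_angle θ) d.continuous.continuousOn hg
    rw [d.angle_zero, d.angle_two_pi] at this
    exact this.symm
  convert key using 1
  · funext n
    rw [fourierCoeffOn_eq_integral]
    congr 2
    have hcont : Continuous fun y : ℝ => Complex.exp (-(n * y * Complex.I)) * v y := by fun_prop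
    have e1 : ∀ y : ℝ, (fourier (-n) (y : AddCircle (2 * Real.pi - 0)) : ℂ) • v y =
        Complex.exp (-(n * y * Complex.I)) * v y := fun y => by
      rw [fourier_coe_apply, smul_eq_mul]
      congr 2
      have : (Real.pi : ℂ) ≠ 0 := by exact_mod_cast Real.pi_ne_zero
      push_cast
      rw [sub_zero]
      field_simp
    simp only [e1]
    rw [hsub _ hcont, coeff_apply]
    simp only [sub_zero, hv, he]
    rw [Complex.real_smul]
    congr 1
    · push_cast; simp
    · refine integral_congr fun θ _ => ?_
      simp only [expo, Complex.real_smul]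
      ring
  · rw [hsub' (fun y => ‖v y‖ ^ 2) (by fun_prop)]
    simp only [sub_zero, smul_eq_mul, hv, he]

theorem sqSummable_coeff (u : SmoothPeriodic) : SqSummable fun n => d.coeff n u :=
  (d.hasSum_sq_coeff u).summable

theorem eq_zero_of_coeff_eq_zero (u : SmoothPeriodic) (hu : ∀ n, d.coeff n u = 0) : u = 0 := by
  have hpi : (0 : ℝ) < 2 * Real.pi := by positivity
  have h1 := d.hasSum_sq_coeff u
  simp only [hu, norm_zero, ne_eq, OfNat.ofNat_ne_zero, not_false_eq_true, zero_pow] at h1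
  have h2 := h1.unique hasSum_zero
  have h3 : ∫ θ in (0 : ℝ)..2 * Real.pi, d.h θ * ‖(u : ℝ → ℂ) θ‖ ^ 2 = 0 := by
    simpa [Real.pi_ne_zero] using h2
  refine SmoothPeriodic.ext_Icc fun θ hθ => ?_
  by_contra hne
  refine absurd h3 (integral_pos hpi ?_ (fun t _ => ?_) ⟨θ, hθ, ?_⟩).ne'
  · exact (d.continuous.mul ((SmoothPeriodic.continuous_coe u).norm.pow 2)).continuousOn
  · exact mul_nonneg (d.pos t).le (by positivity)
  · exact mul_pos (d.pos θ) (pow_pos (norm_pos_iff.2 hne) 2)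

/-- By Parseval the norm of the coefficients is a weighted `L²` norm, in which multiplication by `b`
costs at most a bound for `|b|`. -/
theorem exists_l2_mul_le (b : SmoothPeriodic) : ∃ B : ℝ, 0 ≤ B ∧ ∀ u,
    l2 (fun n => d.coeff n (b * u)) ≤ B * l2 (fun n => d.coeff n u) := by
  have hpi : (0 : ℝ) < 2 * Real.pi := by positivity
  obtain ⟨B, hB0, hB⟩ := SmoothPeriodic.exists_norm_le b
  refine ⟨B, hB0, fun u => ?_⟩
  unfold l2
  rw [(d.hasSum_sq_coeff _).tsum_eq, (d.hasSum_sq_coeff _).tsum_eq]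
  refine Real.sqrt_le_iff.2 ⟨by positivity, ?_⟩
  rw [mul_pow, Real.sq_sqrt]
  · rw [mul_left_comm, ← intervalIntegral.integral_const_mul (B ^ 2)]
    refine mul_le_mul_of_nonneg_left ?_ (inv_nonneg.2 hpi.le)
    refine integral_mono_on hpi.le ?_ ?_ fun θ hθ => ?_
    · exact (d.continuous.mul
        ((SmoothPeriodic.continuous_coe (b * u)).norm.pow 2)).intervalIntegrable _ _
    · exact (continuous_const.mul (d.continuous.mul
        ((SmoothPeriodic.continuous_coe u).norm.pow 2))).intervalIntegrable _ _
    · simp only [Subalgebra.coe_mul, Pi.mul_apply, norm_mul, mul_pow]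
      rw [mul_left_comm]
      refine mul_le_mul_of_nonneg_right ?_ (mul_nonneg (d.pos θ).le (by positivity))
      exact pow_le_pow_left₀ (norm_nonneg _) (hB θ hθ) 2
  · refine mul_nonneg (by positivity) (integral_nonneg hpi.le fun θ _ => ?_)
    exact mul_nonneg (d.pos θ).le (by positivity)

/-- Every first order term can be gauged to a constant. -/
theorem exists_gauge (a : SmoothPeriodic) : ∃ (α : ℂ) (E E' : SmoothPeriodic), E' * E = 1 ∧
    d.delta E = E * (algebraMap ℂ SmoothPeriodic α - a) := by
  -- The mean of `a` is the one constant for which `α - a` has a periodic primitive; `E` is the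
  -- exponential of that primitive.
  set α : ℂ := (2 * Real.pi : ℂ)⁻¹ * ∫ θ in (0 : ℝ)..2 * Real.pi, d.h θ * (a : ℝ → ℂ) θ with hα
  set f : ℝ → ℂ := fun θ => Complex.I * d.h θ * (α - (a : ℝ → ℂ) θ) with hf
  have hhs : ContDiff ℝ ∞ fun θ => (d.h θ : ℂ) := Complex.ofRealCLM.contDiff.comp d.smooth
  have hfs : ContDiff ℝ ∞ f :=
    (contDiff_const.mul hhs).mul (contDiff_const.sub (SmoothPeriodic.contDiff_coe a))
  have hfp : Function.Periodic f (2 * Real.pi) := fun θ => by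
    have := (SmoothPeriodic.periodic_coe a) θ
    simp only [hf, d.periodic θ, this]
  have hf0 : ∫ θ in (0 : ℝ)..2 * Real.pi, f θ = 0 := by
    have e : ∀ θ, f θ = Complex.I * α * d.h θ - Complex.I * (d.h θ * (a : ℝ → ℂ) θ) := fun θ => by
      simp only [hf]; ring
    simp only [e]
    rw [intervalIntegral.integral_sub, intervalIntegral.integral_const_mul,
      intervalIntegral.integral_const_mul,
      intervalIntegral.integral_ofReal, d.integral, hα]
    · have : (Real.pi : ℂ) ≠ 0 := by exact_mod_cast Real.pi_ne_zero
      push_cast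
      field_simp
      ring
    · exact (continuous_const.mul hhs.continuous).intervalIntegrable _ _
    · exact (continuous_const.mul (hhs.continuous.mul
        (SmoothPeriodic.continuous_coe a))).intervalIntegrable _ _
  set ψ : ℝ → ℂ := fun θ => ∫ t in (0 : ℝ)..θ, f t with hψ
  have hψd : ∀ θ, HasDerivAt ψ (f θ) θ := fun θ =>
    integral_hasDerivAt_right (hfs.continuous.intervalIntegrable _ _)
      (hfs.continuous.stronglyMeasurableAtFilter _ _) hfs.continuous.continuousAt
  have hψs : ContDiff ℝ ∞ ψ := by
    rw [contDiff_infty_iff_deriv]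
    exact ⟨fun θ => (hψd θ).differentiableAt, by rwa [funext fun θ => (hψd θ).deriv]⟩
  have hψp : Function.Periodic ψ (2 * Real.pi) := fun θ => by
    have h1 : ψ (θ + 2 * Real.pi) = ψ θ + ∫ t in θ..θ + 2 * Real.pi, f t :=
      (integral_add_adjacent_intervals (hfs.continuous.intervalIntegrable _ _)
        (hfs.continuous.intervalIntegrable _ _)).symm
    rw [h1, hfp.intervalIntegral_add_eq θ 0, zero_add, hf0, add_zero]
  refine ⟨α, ⟨fun θ => Complex.exp (ψ θ), hψs.cexp, fun θ => by simp only [hψp θ]⟩,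
    ⟨fun θ => Complex.exp (-ψ θ), hψs.neg.cexp, fun θ => by simp only [hψp θ]⟩, ?_, ?_⟩
  · ext θ
    simp [← Complex.exp_add]
  · ext θ
    rw [delta_apply]
    simp only [Subalgebra.coe_mul, Pi.mul_apply]
    rw [((hψd θ).cexp).deriv]
    have : (d.h θ : ℂ) ≠ 0 := by exact_mod_cast (d.pos θ).ne'
    have e : ((algebraMap ℂ SmoothPeriodic α - a : SmoothPeriodic) : ℝ → ℂ) θ =
      α - (a : ℝ → ℂ) θ := rfl
    rw [e]
    simp only [hf, Complex.ofReal_inv]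
    field_simp
    rw [Complex.I_sq]
    ring

end CircleDensity

end Circle

/-! ### Power series on the closed disc and regularity of solutions. -/

section Series

local notation "𝔡" => DFunLike.coe (PowerSeries.derivative ℂ)

/-- Absolute convergence of a power series on a circle. -/
def SummableAt (f : PowerSeries ℂ) (r : ℝ) : Prop :=
  Summable fun n => ‖PowerSeries.coeff n f‖ * r ^ n

/-- The value of a power series at a point. -/
noncomputable def seriesValue (f : PowerSeries ℂ) (z : ℂ) : ℂ :=
  ∑' n, PowerSeries.coeff n f * z ^ n

theorem SummableAt.mono {f : PowerSeries ℂ} {r s : ℝ} (hs : SummableAt f s) (hr : 0 ≤ r)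
    (h : r ≤ s) : SummableAt f r :=
  Summable.of_nonneg_of_le (fun _ => by positivity)
    (fun n => mul_le_mul_of_nonneg_left (pow_le_pow_left₀ hr h n) (norm_nonneg _)) hs

theorem SummableAt.summable_norm {f : PowerSeries ℂ} {z : ℂ} (h : SummableAt f ‖z‖) :
    Summable fun n => ‖PowerSeries.coeff n f * z ^ n‖ := by
  simpa [SummableAt, norm_mul, norm_pow] using h

theorem SummableAt.add {f g : PowerSeries ℂ} {r : ℝ} (hr : 0 ≤ r) (hf : SummableAt f r)
    (hg : SummableAt g r) : SummableAt (f + g) r := by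
  refine Summable.of_nonneg_of_le (fun _ => by positivity) (fun n => ?_) (Summable.add hf hg)
  rw [map_add, ← add_mul]
  exact mul_le_mul_of_nonneg_right (norm_add_le _ _) (by positivity)

theorem SummableAt.const_smul {f : PowerSeries ℂ} {r : ℝ} (hf : SummableAt f r) (a : ℂ) :
    SummableAt (a • f) r :=
  (Summable.mul_left ‖a‖ hf).congr fun n => by simp [mul_assoc]

theorem summableAt_zero (r : ℝ) : SummableAt 0 r := by simp [SummableAt, summable_zero]

theorem SummableAt.mul {f g : PowerSeries ℂ} {z : ℂ} (hf : SummableAt f ‖z‖)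
    (hg : SummableAt g ‖z‖) :
    SummableAt (f * g) ‖z‖ ∧ seriesValue (f * g) z = seriesValue f z * seriesValue g z := by
  have e : ∀ n, PowerSeries.coeff n (f * g) * z ^ n = ∑ p ∈ Finset.HasAntidiagonal.antidiagonal n,
      (PowerSeries.coeff p.1 f * z ^ p.1) * (PowerSeries.coeff p.2 g * z ^ p.2) := by
    intro n
    rw [PowerSeries.coeff_mul, Finset.sum_mul]
    refine Finset.sum_congr rfl fun p hp => ?_
    rw [← Finset.HasAntidiagonal.mem_antidiagonal.1 hp, pow_add]
    ring
  constructor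
  · have := summable_norm_sum_mul_antidiagonal_of_summable_norm hf.summable_norm hg.summable_norm
    simp only [← e] at this
    simpa [SummableAt, norm_mul, norm_pow] using this
  · unfold seriesValue
    rw [tsum_mul_tsum_eq_tsum_sum_antidiagonal_of_summable_norm hf.summable_norm hg.summable_norm]
    simp only [e]

theorem seriesValue_add {f g : PowerSeries ℂ} {z : ℂ} (hf : SummableAt f ‖z‖)
    (hg : SummableAt g ‖z‖) : seriesValue (f + g) z = seriesValue f z + seriesValue g z := by
  unfold seriesValue
  rw [← hf.summable_norm.of_norm.tsum_add hg.summable_norm.of_norm]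
  simp [add_mul]

theorem seriesValue_smul (a : ℂ) (f : PowerSeries ℂ) (z : ℂ) :
    seriesValue (a • f) z = a * seriesValue f z := by
  unfold seriesValue
  rw [← tsum_mul_left]
  simp [mul_assoc]

theorem seriesValue_zero_right (f : PowerSeries ℂ) : seriesValue f 0 = PowerSeries.coeff 0 f := by
  unfold seriesValue
  rw [tsum_eq_single 0 (fun n hn => by simp [hn])]
  simp

theorem summableAt_sum {ι : Type*} (s : Finset ι) {F : ι → PowerSeries ℂ} {z : ℂ}
    (h : ∀ i ∈ s, SummableAt (F i) ‖z‖) : SummableAt (∑ i ∈ s, F i) ‖z‖ ∧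
      seriesValue (∑ i ∈ s, F i) z = ∑ i ∈ s, seriesValue (F i) z := by
  classical
  induction s using Finset.induction_on with
  | empty => exact ⟨by simpa using summableAt_zero _, by simp [seriesValue]⟩
  | insert i s hi ih =>
    have h1 := h i (Finset.mem_insert_self i s)
    have h2 := ih fun j hj => h j (Finset.mem_insert_of_mem hj)
    rw [Finset.sum_insert hi, Finset.sum_insert hi, seriesValue_add h1 h2.1, h2.2]
    exact ⟨h1.add (norm_nonneg _) h2.1, rfl⟩

theorem norm_seriesValue_le {f : PowerSeries ℂ} {r : ℝ} (hf : SummableAt f r) {z : ℂ}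
    (hz : ‖z‖ ≤ r) : ‖seriesValue f z‖ ≤ ∑' n, ‖PowerSeries.coeff n f‖ * r ^ n := by
  have h := (hf.mono (norm_nonneg z) hz)
  refine (norm_tsum_le_tsum_norm h.summable_norm).trans
    (h.summable_norm.tsum_le_tsum (fun n => ?_) hf)
  rw [norm_mul, norm_pow]
  exact mul_le_mul_of_nonneg_left (pow_le_pow_left₀ (norm_nonneg _) hz n) (norm_nonneg _)

theorem continuousOn_seriesValue {f : PowerSeries ℂ} {r : ℝ} (hf : SummableAt f r) :
    ContinuousOn (seriesValue f) (Metric.closedBall 0 r) := by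
  refine continuousOn_tsum (fun n => by fun_prop) hf fun n z hz => ?_
  rw [norm_mul, norm_pow]
  exact mul_le_mul_of_nonneg_left
    (pow_le_pow_left₀ (norm_nonneg _) (mem_closedBall_zero_iff.1 hz) n) (norm_nonneg _)

theorem seriesValue_derivative (f : PowerSeries ℂ) (z : ℂ)
    (h : Summable fun n : ℕ => PowerSeries.coeff n f * ((n : ℂ) * z ^ (n - 1))) :
    seriesValue (𝔡 f) z = ∑' n : ℕ, PowerSeries.coeff n f * ((n : ℂ) * z ^ (n - 1)) := by
  rw [h.tsum_eq_zero_add]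
  simp only [seriesValue, PowerSeries.coeff_derivative, CharP.cast_eq_zero, zero_mul, mul_zero,
    zero_add, Nat.add_sub_cancel]
  refine tsum_congr fun n => ?_
  push_cast
  ring

theorem SummableAt.of_derivative {f : PowerSeries ℂ} {r : ℝ} (h : SummableAt (𝔡 f) r) :
    Summable fun n : ℕ => ‖PowerSeries.coeff n f‖ * (n * r ^ (n - 1)) := by
  rw [← summable_nat_add_iff 1]
  refine Summable.congr h fun n => ?_
  rw [PowerSeries.coeff_derivative, norm_mul]
  have : ‖(n : ℂ) + 1‖ = n + 1 := by exact_mod_cast Complex.norm_natCast (n + 1)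
  rw [this, Nat.add_sub_cancel]
  push_cast
  ring

theorem hasDerivAt_seriesValue {f : PowerSeries ℂ} {r : ℝ} (h : SummableAt (𝔡 f) r) {z : ℂ}
    (hz : ‖z‖ < r) : HasDerivAt (seriesValue f) (seriesValue (𝔡 f) z) z := by
  have hu := h.of_derivative
  have hr : 0 < r := (norm_nonneg z).trans_lt hz
  have hb : ∀ n : ℕ, ∀ y ∈ Metric.ball (0 : ℂ) r,
      ‖PowerSeries.coeff n f * ((n : ℂ) * y ^ (n - 1))‖ ≤
        ‖PowerSeries.coeff n f‖ * (n * r ^ (n - 1)) := by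
    intro n y hy
    rw [norm_mul, norm_mul, norm_pow, Complex.norm_natCast]
    have := (mem_ball_zero_iff.1 hy).le
    gcongr
  have hz' : z ∈ Metric.ball (0 : ℂ) r := mem_ball_zero_iff.2 hz
  rw [seriesValue_derivative f z (Summable.of_norm_bounded hu fun n => hb n z hz')]
  refine hasDerivAt_tsum_of_isPreconnected hu Metric.isOpen_ball
    (convex_ball (0 : ℂ) r).isPreconnected (fun n y _ => ?_) hb (Metric.mem_ball_self hr)
    (summable_of_ne_finset_zero (s := {0}) fun n hn => ?_) hz'
  · exact (hasDerivAt_pow n y).const_mul _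
  · have : n ≠ 0 := by simpa using hn
    simp [this]

/-- The coefficients grow at most polynomially. -/
def PolynomialGrowth (f : PowerSeries ℂ) : Prop :=
  ∃ (B : ℝ) (k : ℕ), ∀ n, ‖PowerSeries.coeff n f‖ ≤ B * ((n : ℝ) + 1) ^ k

theorem PolynomialGrowth.derivative {f : PowerSeries ℂ} (h : PolynomialGrowth f) :
    PolynomialGrowth (𝔡 f) := by
  obtain ⟨B, k, h⟩ := h
  have hB : 0 ≤ B := by simpa using (norm_nonneg _).trans (h 0)
  refine ⟨B * 2 ^ k, k + 1, fun n => ?_⟩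
  rw [PowerSeries.coeff_derivative, norm_mul]
  have e : ‖(n : ℂ) + 1‖ = n + 1 := by exact_mod_cast Complex.norm_natCast (n + 1)
  rw [e, pow_succ, ← mul_assoc, mul_assoc B, ← mul_pow]
  refine mul_le_mul_of_nonneg_right ((h (n + 1)).trans ?_) (by positivity)
  refine mul_le_mul_of_nonneg_left (pow_le_pow_left₀ (by positivity) ?_ k) hB
  push_cast
  linarith [Nat.cast_nonneg (α := ℝ) n]

theorem PolynomialGrowth.iterate {f : PowerSeries ℂ} (h : PolynomialGrowth f) (k : ℕ) :
    PolynomialGrowth (𝔡^[k] f) := by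
  induction k with
  | zero => exact h
  | succ k ih => rw [Function.iterate_succ_apply']; exact ih.derivative

theorem PolynomialGrowth.summableAt {f : PowerSeries ℂ} (h : PolynomialGrowth f) {r : ℝ}
    (hr0 : 0 ≤ r) (hr1 : r < 1) : SummableAt f r := by
  obtain ⟨B, k, h⟩ := h
  obtain ⟨s, hs, hs1⟩ := exists_between (max_lt hr1 one_half_lt_one)
  have hrs := (le_max_left _ _).trans hs.le
  have hs0 : 0 < s := lt_of_lt_of_le one_half_pos ((le_max_right _ _).trans hs.le)
  have h1 : Summable fun n : ℕ => ((n : ℝ) + 1) ^ k * s ^ (n + 1) := by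
    have := (summable_nat_add_iff 1).2 (summable_pow_mul_geometric_of_norm_lt_one k
      (r := s) (by rwa [Real.norm_of_nonneg hs0.le]))
    simpa using this
  refine SummableAt.mono ?_ hr0 hrs
  refine Summable.of_nonneg_of_le (fun _ => by positivity) (fun n => ?_) (h1.mul_left (B / s))
  calc ‖PowerSeries.coeff n f‖ * s ^ n ≤ B * ((n : ℝ) + 1) ^ k * s ^ n :=
        mul_le_mul_of_nonneg_right (h n) (by positivity)
    _ = B / s * (((n : ℝ) + 1) ^ k * s ^ (n + 1)) := by field_simp; ring

theorem PolynomialGrowth.hasDerivAt {f : PowerSeries ℂ} (h : PolynomialGrowth f) {z : ℂ}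
    (hz : ‖z‖ < 1) : HasDerivAt (seriesValue f) (seriesValue (𝔡 f) z) z := by
  obtain ⟨r, hr, hr1⟩ := exists_between hz
  exact hasDerivAt_seriesValue (h.derivative.summableAt ((norm_nonneg z).trans hr.le) hr1) hr

theorem PolynomialGrowth.iteratedDeriv_eq {f : PowerSeries ℂ} (h : PolynomialGrowth f) (n : ℕ) :
    ∀ z : ℂ, ‖z‖ < 1 → iteratedDeriv n (seriesValue f) z = seriesValue (𝔡^[n] f) z := by
  induction n with
  | zero => intro z _; simp
  | succ n ih =>
    intro z hz
    rw [iteratedDeriv_succ, Function.iterate_succ_apply']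
    have he : iteratedDeriv n (seriesValue f) =ᶠ[nhds z] seriesValue (𝔡^[n] f) := by
      filter_upwards [Metric.isOpen_ball.mem_nhds (mem_ball_zero_iff.2 hz)] with y hy
      exact ih y (mem_ball_zero_iff.1 hy)
    rw [he.deriv_eq, ((h.iterate n).hasDerivAt hz).deriv]

/-- Cauchy's estimate. -/
theorem PolynomialGrowth.norm_coeff_le {f : PowerSeries ℂ} (h : PolynomialGrowth f) {M : ℝ}
    (hM : ∀ z : ℂ, ‖z‖ < 1 → ‖seriesValue f z‖ ≤ M) (n : ℕ) : ‖PowerSeries.coeff n f‖ ≤ M := by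
  have key : ∀ r : ℝ, r ∈ Set.Ioo (0 : ℝ) 1 → ‖PowerSeries.coeff n f‖ * r ^ n ≤ M := by
    rintro r ⟨hr0, hr1⟩
    have hd : DiffContOnCl ℂ (seriesValue f) (Metric.ball 0 r) := by
      refine DifferentiableOn.diffContOnCl fun z hz => ?_
      rw [closure_ball _ hr0.ne'] at hz
      exact (h.hasDerivAt ((mem_closedBall_zero_iff.1 hz).trans_lt
        hr1)).differentiableAt.differentiableWithinAt
    have h1 := Complex.norm_iteratedDeriv_le_of_forall_mem_sphere_norm_le n hr0 hd
      fun z hz => hM z (by rw [mem_sphere_zero_iff_norm.1 hz]; exact hr1)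
    rw [h.iteratedDeriv_eq n 0 (by simp), seriesValue_zero_right,
      PowerSeries.coeff_zero_eq_constantCoeff_apply,
      PowerSeries.constantCoeff_iterate_derivative, norm_mul, Complex.norm_natCast, mul_div_assoc]
      at h1
    have h2 := le_of_mul_le_mul_left h1 (by positivity)
    rwa [le_div_iff₀ (by positivity)] at h2
  -- The bound is known only inside the open disc, so the radius tends to `1` from below.
  have hlim : Filter.Tendsto (fun r : ℝ => ‖PowerSeries.coeff n f‖ * r ^ n)
      (nhdsWithin 1 (Set.Iio 1)) (nhds (‖PowerSeries.coeff n f‖ * 1 ^ n)) :=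
    ((continuous_const.mul (continuous_pow n)).tendsto 1).mono_left nhdsWithin_le_nhds
  rw [one_pow, mul_one] at hlim
  refine le_of_tendsto hlim ?_
  filter_upwards [Ioo_mem_nhdsLT (zero_lt_one (α := ℝ))] with r hr
  exact key r hr

/-- The power series all of whose derivatives converge absolutely on the closed unit disc. -/
def smoothSeries : Submodule ℂ (PowerSeries ℂ) where
  carrier := {f | ∀ k, SummableAt (𝔡^[k] f) 1}
  zero_mem' k := by
    rw [iterate_map_zero]
    exact summableAt_zero 1
  add_mem' := by
    intro f g hf hg k
    rw [iterate_map_add]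
    exact (hf k).add zero_le_one (hg k)
  smul_mem' := by
    intro a f hf k
    have : 𝔡^[k] (a • f) = a • 𝔡^[k] f := by
      induction k with
      | zero => rfl
      | succ k ih =>
        rw [Function.iterate_succ_apply', ih, Derivation.map_smul, Function.iterate_succ_apply']
    rw [this]
    exact (hf k).const_smul a

theorem smoothSeries_derivative {f : PowerSeries ℂ} (hf : f ∈ smoothSeries) :
    𝔡 f ∈ smoothSeries := fun k => by
  rw [← Function.iterate_succ_apply]; exact hf (k + 1)

theorem smoothSeries_iterate {f : PowerSeries ℂ} (hf : f ∈ smoothSeries) (k : ℕ) :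
    𝔡^[k] f ∈ smoothSeries := fun j => by
  rw [← Function.iterate_add_apply]; exact hf (j + k)

theorem smoothSeries_summableAt {f : PowerSeries ℂ} (hf : f ∈ smoothSeries) {z : ℂ}
    (hz : ‖z‖ ≤ 1) : SummableAt f ‖z‖ := (hf 0).mono (norm_nonneg z) hz

theorem smoothSeries_polynomialGrowth {f : PowerSeries ℂ} (hf : f ∈ smoothSeries) :
    PolynomialGrowth f := by
  refine ⟨∑' n, ‖PowerSeries.coeff n f‖ * 1 ^ n, 0, fun n => ?_⟩
  have := (hf 0).le_tsum n fun j _ => by positivity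
  simpa using this

/-- Cauchy's estimate for the derivative of order `k + 2` makes the coefficients of the derivative
of order `k` decay like `n ^ (-2)`, which is summable. -/
theorem mem_smoothSeries_of_bounded {f : PowerSeries ℂ} (hf : PolynomialGrowth f)
    (h : ∀ k, ∃ M : ℝ, ∀ z : ℂ, ‖z‖ < 1 → ‖seriesValue (𝔡^[k] f) z‖ ≤ M) : f ∈ smoothSeries := by
  intro k
  obtain ⟨M, hM⟩ := h (k + 2)
  have hc := (hf.iterate (k + 2)).norm_coeff_le hM
  have hM0 : 0 ≤ M := (norm_nonneg _).trans (hc 0)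
  unfold SummableAt
  rw [← summable_nat_add_iff 2]
  have hs : Summable fun n : ℕ => M * (1 / ((n + 1 : ℕ) : ℝ) ^ 2) :=
    ((summable_nat_add_iff 1).2 (Real.summable_one_div_nat_pow.2 one_lt_two)).mul_left M
  refine Summable.of_nonneg_of_le (fun _ => by positivity) (fun n => ?_) hs
  have h1 := hc n
  rw [Function.iterate_succ_apply', Function.iterate_succ_apply', PowerSeries.coeff_derivative,
    PowerSeries.coeff_derivative, norm_mul, norm_mul] at h1
  have e1 : ‖(n : ℂ) + 1‖ = n + 1 := by exact_mod_cast Complex.norm_natCast (n + 1)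
  have e2 : ‖((n + 1 : ℕ) : ℂ) + 1‖ = n + 2 := by
    have := Complex.norm_natCast (n + 2)
    push_cast at this ⊢
    rw [← this]
    congr 1
    ring
  rw [e1, e2] at h1
  rw [one_pow, mul_one, mul_one_div, le_div_iff₀ (by positivity)]
  refine le_trans ?_ h1
  push_cast
  rw [mul_assoc]
  refine mul_le_mul_of_nonneg_left ?_ (norm_nonneg _)
  nlinarith [Nat.cast_nonneg (α := ℝ) n]

/-- A continuous function on the closed disc without zeros on the circle is bounded below near
the circle. -/
theorem exists_annulus {Q : ℂ → ℂ} (hQ : ContinuousOn Q (Metric.closedBall 0 1))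
    (h : ∀ z : ℂ, ‖z‖ = 1 → Q z ≠ 0) :
    ∃ r c : ℝ, 0 < r ∧ r < 1 ∧ 0 < c ∧ ∀ z : ℂ, r ≤ ‖z‖ → ‖z‖ ≤ 1 → c ≤ ‖Q z‖ := by
  have hZ : IsCompact (Metric.closedBall (0 : ℂ) 1 ∩ Q ⁻¹' {0}) :=
    (isCompact_closedBall (0 : ℂ) 1).of_isClosed_subset
      (hQ.preimage_isClosed_of_isClosed Metric.isClosed_closedBall isClosed_singleton)
      Set.inter_subset_left
  -- The zeros form a compact set off the circle, so their moduli are bounded by some `ρ < 1`. Zeros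
  -- inside the disc are harmless.
  obtain ⟨ρ, hρ1, hρ⟩ : ∃ ρ : ℝ, ρ < 1 ∧ ∀ z : ℂ, ‖z‖ ≤ 1 → Q z = 0 → ‖z‖ ≤ ρ := by
    rcases (Metric.closedBall (0 : ℂ) 1 ∩ Q ⁻¹' {0}).eq_empty_or_nonempty with he | hne
    · refine ⟨0, one_pos, fun z hz hz0 => ?_⟩
      have : z ∈ Metric.closedBall (0 : ℂ) 1 ∩ Q ⁻¹' {0} := ⟨mem_closedBall_zero_iff.2 hz, hz0⟩
      rw [he] at this
      exact this.elim
    · obtain ⟨w, hw, hmax⟩ := hZ.exists_isMaxOn hne continuous_norm.continuousOn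
      refine ⟨‖w‖, lt_of_le_of_ne (mem_closedBall_zero_iff.1 hw.1) fun he => h w he hw.2,
        fun z hz hz0 => hmax ⟨mem_closedBall_zero_iff.2 hz, hz0⟩⟩
  set r := (max ρ 0 + 1) / 2 with hr
  have hmax1 : max ρ 0 < 1 := max_lt hρ1 one_pos
  have hr0 : 0 < r := by have := le_max_right ρ 0; rw [hr]; linarith
  have hr1 : r < 1 := by rw [hr]; linarith
  have hρr : ρ < r := by have := le_max_left ρ 0; rw [hr]; linarith
  have hA : IsCompact (Metric.closedBall (0 : ℂ) 1 ∩ {z | r ≤ ‖z‖}) :=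
    (isCompact_closedBall (0 : ℂ) 1).inter_right (isClosed_le continuous_const continuous_norm)
  obtain ⟨w, hw, hmin⟩ := hA.exists_isMinOn ⟨1, by simp, by simpa using hr1.le⟩
    (hQ.norm.mono Set.inter_subset_left)
  refine ⟨r, ‖Q w‖, hr0, hr1, norm_pos_iff.2 fun h0 => ?_, fun z hz hz1 =>
    hmin ⟨mem_closedBall_zero_iff.2 hz1, hz⟩⟩
  have h1 := hρ w (mem_closedBall_zero_iff.1 hw.1) h0
  have h2 : r ≤ ‖w‖ := hw.2
  linarith

/-- Solutions of a regular linear differential equation are bounded on the disc, with their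
derivatives of order less than `N`. -/
theorem exists_bound_of_ode {N : ℕ} {q : ℕ → PowerSeries ℂ} (hq : ∀ k ≤ N, q k ∈ smoothSeries)
    (hlead : ∀ z : ℂ, ‖z‖ = 1 → seriesValue (q N) z ≠ 0) {f : PowerSeries ℂ}
    (hf : PolynomialGrowth f)
    (hg : ∑ k ∈ Finset.range (N + 1), q k * 𝔡^[k] f ∈ smoothSeries) :
    ∀ k < N, ∃ M : ℝ, ∀ z : ℂ, ‖z‖ < 1 → ‖seriesValue (𝔡^[k] f) z‖ ≤ M := by
  obtain ⟨r, c, hr0, hr1, hc, hcz⟩ := exists_annulus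
    (continuousOn_seriesValue (hq N le_rfl 0)) hlead
  set g := ∑ k ∈ Finset.range (N + 1), q k * 𝔡^[k] f with hgdef
  set G := ∑' n, ‖PowerSeries.coeff n g‖ * (1 : ℝ) ^ n with hG
  have hG0 : 0 ≤ G := tsum_nonneg fun _ => by positivity
  set κ : ℕ → ℝ := fun k => ∑' n, ‖PowerSeries.coeff n (q k)‖ * (1 : ℝ) ^ n with hκ
  have hκ0 : ∀ k, 0 ≤ κ k := fun k => tsum_nonneg fun _ => by positivity
  set Kt := ∑ k ∈ Finset.range N, κ k with hKt
  have hKt0 : 0 ≤ Kt := Finset.sum_nonneg fun k _ => hκ0 k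
  set δ := ∑ k ∈ Finset.range N, ∑' n, ‖PowerSeries.coeff n (𝔡^[k] f)‖ * r ^ n with hδ
  have hterm0 : ∀ k ∈ Finset.range N, 0 ≤ ∑' n, ‖PowerSeries.coeff n (𝔡^[k] f)‖ * r ^ n :=
    fun k _ => tsum_nonneg fun _ => by positivity
  have hδ0 : 0 ≤ δ := Finset.sum_nonneg hterm0
  have hinner : ∀ k < N, ∀ z : ℂ, ‖z‖ ≤ r → ‖seriesValue (𝔡^[k] f) z‖ ≤ δ := fun k hk z hz =>
    (norm_seriesValue_le ((hf.iterate k).summableAt hr0.le hr1) hz).trans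
      (Finset.single_le_sum hterm0 (Finset.mem_range.2 hk))
  -- In the annulus the equation can be solved for the derivative of order `N`.
  have hlast : ∀ (z : ℂ) (B : ℝ), r ≤ ‖z‖ → ‖z‖ < 1 →
      (∀ k < N, ‖seriesValue (𝔡^[k] f) z‖ ≤ B) →
      ‖seriesValue (𝔡^[N] f) z‖ ≤ c⁻¹ * (G + Kt * B) := by
    intro z B hz hz1 hB
    have hs : ∀ k ∈ Finset.range (N + 1), SummableAt (q k) ‖z‖ ∧ SummableAt (𝔡^[k] f) ‖z‖ :=
      fun k hk => ⟨smoothSeries_summableAt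
        (hq k (Nat.lt_succ_iff.1 (Finset.mem_range.1 hk))) hz1.le,
        (hf.iterate k).summableAt (norm_nonneg _) hz1⟩
    have h1 : seriesValue g z = ∑ k ∈ Finset.range (N + 1),
        seriesValue (q k) z * seriesValue (𝔡^[k] f) z := by
      rw [hgdef, (summableAt_sum _ fun k hk => ((hs k hk).1.mul (hs k hk).2).1).2]
      exact Finset.sum_congr rfl fun k hk => ((hs k hk).1.mul (hs k hk).2).2
    rw [Finset.sum_range_succ] at h1
    have h2 : ‖seriesValue (q N) z * seriesValue (𝔡^[N] f) z‖ ≤ G + Kt * B := by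
      rw [eq_sub_of_add_eq' h1.symm]
      refine (norm_sub_le _ _).trans (add_le_add (norm_seriesValue_le (hg 0) hz1.le) ?_)
      refine (norm_sum_le _ _).trans ?_
      rw [hKt, Finset.sum_mul]
      refine Finset.sum_le_sum fun k hk => ?_
      have hk' := Finset.mem_range.1 hk
      rw [norm_mul]
      exact mul_le_mul (norm_seriesValue_le (hq k hk'.le 0) hz1.le) (hB k hk') (norm_nonneg _)
        (hκ0 k)
    rw [norm_mul] at h2
    rw [inv_mul_eq_div, le_div_iff₀' hc]
    exact (mul_le_mul_of_nonneg_right (hcz z hz hz1.le) (norm_nonneg _)).trans h2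
  intro k hk
  -- In the first order system the components that merely shift contribute `1`, the last component
  -- `c⁻¹ * Kt`.
  set L := 1 + c⁻¹ * Kt with hL
  have hL0 : 0 ≤ L := by positivity
  refine ⟨max δ (gronwallBound δ L (c⁻¹ * G) 1), fun z hz => ?_⟩
  rcases le_or_gt ‖z‖ r with hzr | hzr
  · exact (hinner k hk z hzr).trans (le_max_left _ _)
  refine le_trans ?_ (le_max_right _ _)
  have hz0 : ‖z‖ ≠ 0 := (hr0.trans hzr).ne'
  set ζ : ℂ := z / ‖z‖ with hζ
  have hζ1 : ‖ζ‖ = 1 := by rw [hζ, norm_div, Complex.norm_real, norm_norm, div_self hz0]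
  have hnorm : ∀ t : ℝ, 0 ≤ t → ‖(t : ℂ) * ζ‖ = t := fun t ht => by
    rw [norm_mul, hζ1, mul_one, Complex.norm_real, Real.norm_of_nonneg ht]
  let y : ℝ → Fin N → ℂ := fun t j => seriesValue (𝔡^[j] f) (t * ζ)
  let y' : ℝ → Fin N → ℂ := fun t j => seriesValue (𝔡^[j + 1] f) (t * ζ) * ζ
  have hy : ∀ t ∈ Set.Icc r ‖z‖, HasDerivAt y (y' t) t := by
    intro t ht
    rw [hasDerivAt_pi]
    intro j
    have ht1 : ‖(t : ℂ) * ζ‖ < 1 := by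
      rw [hnorm t (hr0.le.trans ht.1)]; exact ht.2.trans_lt hz
    have h1 := (hf.iterate j).hasDerivAt ht1
    rw [← Function.iterate_succ_apply' (f := 𝔡)] at h1
    have h2 : HasDerivAt (fun s : ℂ => s * ζ) ζ (t : ℂ) := by
      simpa using (hasDerivAt_id (t : ℂ)).mul_const ζ
    exact (h1.comp (t : ℂ) h2).comp_ofReal
  -- Gronwall on the radial segment from modulus `r` to `z`. Its constants do not depend on the
  -- direction and its length is at most `1`, so the bound is uniform in `z`.
  have hgr := norm_le_gronwallBound_of_norm_deriv_right_le (f := y) (f' := y') (δ := δ) (K := L)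
    (ε := c⁻¹ * G) (a := r) (b := ‖z‖) (fun t ht => (hy t ht).continuousAt.continuousWithinAt)
    (fun t ht => (hy t (Set.Ico_subset_Icc_self ht)).hasDerivWithinAt)
    ((pi_norm_le_iff_of_nonneg hδ0).2 fun j => hinner j j.2 _ (hnorm r hr0.le).le)
    (fun t ht => by
      have ht0 : 0 ≤ t := hr0.le.trans ht.1
      have hyj : ∀ j < N, ‖seriesValue (𝔡^[j] f) (t * ζ)‖ ≤ ‖y t‖ := fun j hj =>
        norm_le_pi_norm (y t) ⟨j, hj⟩
      have hyn : 0 ≤ ‖y t‖ := norm_nonneg _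
      refine (pi_norm_le_iff_of_nonneg (by positivity)).2 fun j => ?_
      show ‖seriesValue (𝔡^[j + 1] f) (t * ζ) * ζ‖ ≤ _
      rw [norm_mul, hζ1, mul_one, hL]
      have hpos1 : 0 ≤ c⁻¹ * Kt * ‖y t‖ := by positivity
      have hpos2 : 0 ≤ c⁻¹ * G := by positivity
      rcases Nat.lt_or_ge ((j : ℕ) + 1) N with hj | hj
      · have := hyj _ hj
        linarith
      · have hjN : (j : ℕ) + 1 = N := le_antisymm j.2 hj
        rw [hjN]
        have := hlast (t * ζ) ‖y t‖ (by rw [hnorm t ht0]; exact ht.1)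
          (by rw [hnorm t ht0]; exact ht.2.trans hz) hyj
        linarith) ‖z‖ ⟨hzr.le, le_rfl⟩
  have hzz : ((‖z‖ : ℝ) : ℂ) * ζ = z := by
    rw [hζ, mul_div_cancel₀]
    exact_mod_cast hz0
  have h3 : ‖seriesValue (𝔡^[k] f) z‖ ≤ ‖y ‖z‖‖ := by
    have := norm_le_pi_norm (y ‖z‖) ⟨k, hk⟩
    simpa only [y, hzz] using this
  exact h3.trans (hgr.trans (gronwallBound_mono hδ0 (by positivity) hL0 (by linarith)))

/-- Regularity up to the boundary of solutions of regular linear differential equations. -/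
theorem mem_smoothSeries_of_ode {N : ℕ} {q : ℕ → PowerSeries ℂ}
    (hq : ∀ k ≤ N, q k ∈ smoothSeries) (hlead : ∀ z : ℂ, ‖z‖ = 1 → seriesValue (q N) z ≠ 0)
    {f : PowerSeries ℂ} (hf : PolynomialGrowth f)
    (hg : ∑ k ∈ Finset.range (N + 1), q k * 𝔡^[k] f ∈ smoothSeries) : f ∈ smoothSeries := by
  -- Differentiating the equation raises its order but keeps its leading coefficient, so the bounds
  -- reach derivatives of every order.
  have key : ∀ j : ℕ, ∃ q' : ℕ → PowerSeries ℂ, (∀ k ≤ N + j, q' k ∈ smoothSeries) ∧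
      q' (N + j) = q N ∧ ∑ k ∈ Finset.range (N + j + 1), q' k * 𝔡^[k] f ∈ smoothSeries := by
    intro j
    induction j with
    | zero => exact ⟨q, hq, rfl, hg⟩
    | succ j ih =>
      obtain ⟨q', hq', hq'N, hg'⟩ := ih
      refine ⟨fun k => (if k ≤ N + j then 𝔡 (q' k) else 0) + (if k = 0 then 0 else q' (k - 1)),
        fun k hk => ?_, ?_, ?_⟩
      · refine Submodule.add_mem _ ?_ ?_
        · split_ifs with h
          · exact smoothSeries_derivative (hq' k h)
          · exact Submodule.zero_mem _
        · split_ifs with h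
          · exact Submodule.zero_mem _
          · exact hq' _ (by omega)
      · have h1 : ¬ N + (j + 1) ≤ N + j := by omega
        have h2 : N + (j + 1) ≠ 0 := by omega
        have h3 : N + (j + 1) - 1 = N + j := by omega
        simp only [if_neg h1, if_neg h2, h3, zero_add, hq'N]
      · have h1 := smoothSeries_derivative hg'
        convert h1 using 1
        rw [map_sum]
        simp only [add_mul, Finset.sum_add_distrib, Derivation.leibniz, smul_eq_mul]
        rw [add_comm]
        congr 1
        · rw [← add_assoc N j 1, Finset.sum_range_succ']
          simp [Function.iterate_succ_apply']
        · rw [← add_assoc N j 1, Finset.sum_range_succ]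
          have h2 : ¬ N + j + 1 ≤ N + j := by omega
          rw [if_neg h2, zero_mul, add_zero]
          refine Finset.sum_congr rfl fun k hk => ?_
          rw [if_pos (Nat.lt_succ_iff.1 (Finset.mem_range.1 hk)), mul_comm]
  refine mem_smoothSeries_of_bounded hf fun k => ?_
  obtain ⟨q', hq', hq'N, hg'⟩ := key (k + 1)
  exact exists_bound_of_ode hq' (by rw [hq'N]; exact hlead) hf hg' k (by omega)

end Series

/-! ### From the weighted Hardy space to functions on the circle. -/

section Boundary

open scoped ContDiff

local notation "𝔡" => DFunLike.coe (PowerSeries.derivative ℂ)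

theorem betaSq_pos {σ : ℝ} (hσ : 0 < σ) (n : ℕ) : 0 < betaSq σ n := by
  induction n with
  | zero => exact one_pos
  | succ n ih => rw [betaSq]; positivity

/-- The left side changes from `n` to `n + 1` by the factor `(n + 1) / (n + σ) * ((n + 2) / (n + 1))
^ k`, which is at least `1` by Bernoulli's inequality. -/
theorem one_le_betaSq_mul_pow {σ : ℝ} (hσ : 0 < σ) {k : ℕ} (hk : σ ≤ k) (n : ℕ) :
    1 ≤ betaSq σ n * ((n : ℝ) + 1) ^ k := by
  induction n with
  | zero => simp [betaSq]
  | succ n ih =>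
    refine ih.trans ?_
    rw [betaSq, mul_assoc]
    refine mul_le_mul_of_nonneg_left ?_ (betaSq_pos hσ n).le
    have hn : (0 : ℝ) < n + 1 := by positivity
    have h1 := one_add_mul_le_pow (a := 1 / ((n : ℝ) + 1))
      (by linarith [one_div_pos.2 hn]) k
    have h2 : (((n + 1 : ℕ) : ℝ) + 1) ^ k = ((n : ℝ) + 1) ^ k * (1 + 1 / ((n : ℝ) + 1)) ^ k := by
      rw [← mul_pow]
      congr 1
      push_cast
      field_simp
    have h3 : (n : ℝ) + σ ≤ (n + 1) * (1 + 1 / ((n : ℝ) + 1)) ^ k := by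
      have h4 := mul_le_mul_of_nonneg_left h1 hn.le
      have h5 : ((n : ℝ) + 1) * (1 + k * (1 / ((n : ℝ) + 1))) = n + 1 + k := by field_simp
      linarith
    rw [h2, div_mul_eq_mul_div, le_div_iff₀ (by positivity)]
    have h6 := mul_le_mul_of_nonneg_left h3 (by positivity : (0 : ℝ) ≤ ((n : ℝ) + 1) ^ k)
    linarith

/-- The regularity theory needs nothing else about the space, which is why the conclusions do not
depend on `σ`. -/
theorem polynomialGrowth_of_mem_weightedHardy {σ : ℝ} (hσ : 0 < σ) {f : PowerSeries ℂ}
    (hf : f ∈ weightedHardy σ) : PolynomialGrowth f := by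
  obtain ⟨k, hk⟩ := exists_nat_ge σ
  have hs : Summable fun n => ‖PowerSeries.coeff n f‖ ^ 2 * |betaSq σ n| := hf
  set S := ∑' n, ‖PowerSeries.coeff n f‖ ^ 2 * |betaSq σ n|
  have hS0 : 0 ≤ S := tsum_nonneg fun _ => by positivity
  refine ⟨Real.sqrt S, k, fun n => ?_⟩
  have h1 := hs.le_tsum n fun j _ => by positivity
  rw [abs_of_pos (betaSq_pos hσ n)] at h1
  have h2 := one_le_betaSq_mul_pow hσ hk n
  have hp : 1 ≤ ((n : ℝ) + 1) ^ k := one_le_pow₀ (by linarith [Nat.cast_nonneg (α := ℝ) n])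
  refine abs_le_of_sq_le_sq' (a := ‖PowerSeries.coeff n f‖) ?_ (by positivity) |>.2
  rw [mul_pow, Real.sq_sqrt hS0]
  calc ‖PowerSeries.coeff n f‖ ^ 2
      ≤ ‖PowerSeries.coeff n f‖ ^ 2 * (betaSq σ n * ((n : ℝ) + 1) ^ k) :=
        le_mul_of_one_le_right (by positivity) h2
    _ = ‖PowerSeries.coeff n f‖ ^ 2 * betaSq σ n * ((n : ℝ) + 1) ^ k := by ring
    _ ≤ S * (((n : ℝ) + 1) ^ k) ^ 2 := by
        refine mul_le_mul h1 ?_ (by positivity) hS0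
        nlinarith

theorem exists_differentiableOn_ball {p : ℂ → ℂ}
    (hp : AnalyticOnNhd ℂ p (Metric.closedBall 0 1)) :
    ∃ R : ℝ, 1 < R ∧ DifferentiableOn ℂ p (Metric.ball 0 R) := by
  obtain ⟨δ, hδ, hsub⟩ := (isCompact_closedBall (0 : ℂ) 1).exists_thickening_subset_open
    (isOpen_analyticAt ℂ p) hp
  rw [thickening_closedBall hδ zero_le_one] at hsub
  exact ⟨δ + 1, by linarith, fun z hz => (hsub hz).differentiableAt.differentiableWithinAt⟩

theorem hasSum_taylorSeries {p : ℂ → ℂ} {R : ℝ} (hp : DifferentiableOn ℂ p (Metric.ball 0 R))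
    {z : ℂ} (hz : ‖z‖ < R) :
    HasSum (fun n => PowerSeries.coeff n (taylorSeries p) * z ^ n) (p z) := by
  have h := Complex.hasSum_taylorSeries_on_ball hp (mem_ball_zero_iff.2 hz)
  have e : (fun n => PowerSeries.coeff n (taylorSeries p) * z ^ n) =
      fun n : ℕ => (n.factorial : ℂ)⁻¹ • (z - 0) ^ n • iteratedDeriv n p 0 := by
    funext n
    simp only [taylorSeries, PowerSeries.coeff_mk, sub_zero, smul_eq_mul]
    ring
  rwa [e]

theorem seriesValue_taylorSeries {p : ℂ → ℂ} (hp : AnalyticOnNhd ℂ p (Metric.closedBall 0 1))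
    {z : ℂ} (hz : ‖z‖ ≤ 1) : seriesValue (taylorSeries p) z = p z := by
  obtain ⟨R, hR, hd⟩ := exists_differentiableOn_ball hp
  exact (hasSum_taylorSeries hd (hz.trans_lt hR)).tsum_eq

theorem taylorSeries_mem_smoothSeries {p : ℂ → ℂ}
    (hp : AnalyticOnNhd ℂ p (Metric.closedBall 0 1)) : taylorSeries p ∈ smoothSeries := by
  obtain ⟨R, hR, hd⟩ := exists_differentiableOn_ball hp
  have hg : PolynomialGrowth (taylorSeries p) := by
    have hs := (hasSum_taylorSeries hd (z := 1) (by simpa using hR)).summable.norm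
    refine ⟨∑' n, ‖PowerSeries.coeff n (taylorSeries p) * 1 ^ n‖, 0, fun n => ?_⟩
    have := hs.le_tsum n fun j _ => norm_nonneg _
    simpa using this
  refine mem_smoothSeries_of_bounded hg fun k => ?_
  have ha : AnalyticOnNhd ℂ (iteratedDeriv k p) (Metric.closedBall 0 1) := by
    rw [iteratedDeriv_eq_iterate]
    exact hp.iterated_deriv k
  obtain ⟨M, hM⟩ := (isCompact_closedBall (0 : ℂ) 1).exists_bound_of_continuousOn ha.continuousOn
  refine ⟨M, fun z hz => ?_⟩
  rw [← hg.iteratedDeriv_eq k z hz]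
  have he : seriesValue (taylorSeries p) =ᶠ[nhds z] p := by
    filter_upwards [Metric.isOpen_ball.mem_nhds (mem_ball_zero_iff.2 hz)] with y hy
    exact seriesValue_taylorSeries hp (mem_ball_zero_iff.1 hy).le
  rw [he.iteratedDeriv_eq]
  exact hM z (mem_closedBall_zero_iff.2 hz.le)

theorem diffExpr_apply (N : ℕ) (p : ℕ → ℂ → ℂ) (f : PowerSeries ℂ) :
    diffExpr N p f = ∑ k ∈ Finset.range (N + 1), taylorSeries (p k) * 𝔡^[k] f := by
  simp only [diffExpr, LinearMap.sum_apply, LinearMap.comp_apply, LinearMap.mulLeft_apply,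
    Module.End.pow_apply]
  rfl

/-- The point of the unit circle with argument `θ`. -/
noncomputable def circlePoint (θ : ℝ) : ℂ := Complex.exp (θ * Complex.I)

theorem norm_circlePoint (θ : ℝ) : ‖circlePoint θ‖ = 1 := Complex.norm_exp_ofReal_mul_I θ

theorem periodic_circlePoint : Function.Periodic circlePoint (2 * Real.pi) := fun θ => by
  unfold circlePoint
  push_cast
  rw [add_mul, Complex.exp_add, Complex.exp_two_pi_mul_I, mul_one]

theorem contDiff_circlePoint : ContDiff ℝ ∞ circlePoint :=
  (Complex.ofRealCLM.contDiff.mul contDiff_const).cexp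

theorem hasDerivAt_circlePoint (θ : ℝ) :
    HasDerivAt circlePoint (circlePoint θ * Complex.I) θ := by
  have h : HasDerivAt (fun t : ℝ => (t : ℂ) * Complex.I) Complex.I θ := by
    simpa using (Complex.ofRealCLM.hasDerivAt (x := θ)).mul_const Complex.I
  exact h.cexp

theorem exists_circlePoint_eq {z : ℂ} (hz : ‖z‖ = 1) : ∃ θ, circlePoint θ = z :=
  ⟨z.arg, by simpa [hz, circlePoint] using Complex.norm_mul_exp_arg_mul_I z⟩

theorem hasDerivAt_seriesValue_circlePoint {f : PowerSeries ℂ} (hf : f ∈ smoothSeries) (θ : ℝ) :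
    HasDerivAt (fun t => seriesValue f (circlePoint t))
      (circlePoint θ * Complex.I * seriesValue (𝔡 f) (circlePoint θ)) θ := by
  have hu := SummableAt.of_derivative (hf 1)
  have hb : ∀ (n : ℕ) (t : ℝ), ‖PowerSeries.coeff n f *
      ((n : ℂ) * circlePoint t ^ (n - 1) * (circlePoint t * Complex.I))‖ ≤
        ‖PowerSeries.coeff n f‖ * (n * 1 ^ (n - 1)) := by
    intro n t
    simp [norm_circlePoint]
  have h0 : Summable fun n => PowerSeries.coeff n f * circlePoint 0 ^ n :=
    (smoothSeries_summableAt hf (norm_circlePoint 0).le).summable_norm.of_norm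
  have h := hasDerivAt_tsum hu (fun n t => (((hasDerivAt_pow n (circlePoint t)).comp t
    (hasDerivAt_circlePoint t)).const_mul (PowerSeries.coeff n f))) hb h0 θ
  have hs : Summable fun n : ℕ => PowerSeries.coeff n f *
      ((n : ℂ) * circlePoint θ ^ (n - 1)) := by
    refine Summable.of_norm_bounded hu fun n => ?_
    simp [norm_circlePoint]
  rw [seriesValue_derivative f _ hs, ← tsum_mul_left]
  refine HasDerivAt.congr_deriv h (tsum_congr fun n => ?_)
  ring

/-- The boundary values of a smooth power series, as a function of the argument. -/
noncomputable def boundaryValue : smoothSeries →ₗ[ℂ] SmoothPeriodic where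
  toFun f := ⟨fun θ => seriesValue f (circlePoint θ), by
    refine ⟨contDiff_infty.2 fun n => ?_, fun θ => by simp only [periodic_circlePoint θ]⟩
    obtain ⟨f, hf⟩ := f
    induction n generalizing f with
    | zero =>
      exact contDiff_zero.2 (continuous_iff_continuousAt.2 fun θ =>
        (hasDerivAt_seriesValue_circlePoint hf θ).continuousAt)
    | succ n ih =>
      rw [Nat.cast_add, Nat.cast_one, contDiff_succ_iff_deriv]
      refine ⟨fun θ => (hasDerivAt_seriesValue_circlePoint hf θ).differentiableAt,
        fun h => by simp at h, ?_⟩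
      rw [funext fun θ => (hasDerivAt_seriesValue_circlePoint hf θ).deriv]
      exact ((contDiff_infty.1 contDiff_circlePoint n).mul contDiff_const).mul
        (ih _ (smoothSeries_derivative hf))⟩
  map_add' f g := by
    ext θ
    exact seriesValue_add (smoothSeries_summableAt f.2 (norm_circlePoint θ).le)
      (smoothSeries_summableAt g.2 (norm_circlePoint θ).le)
  map_smul' a f := by
    ext θ
    exact seriesValue_smul a f _

theorem boundaryValue_apply (f : smoothSeries) (θ : ℝ) :
    (boundaryValue f : ℝ → ℂ) θ = seriesValue f (circlePoint θ) := rfl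

/-- The maximum principle carries the zero boundary values into the disc, and Cauchy's estimate then
kills every coefficient. -/
theorem eq_zero_of_boundaryValue_eq_zero {f : smoothSeries} (h : boundaryValue f = 0) : f = 0 := by
  have hg := smoothSeries_polynomialGrowth f.2
  have h0 : ∀ z : ℂ, ‖z‖ = 1 → seriesValue (f : PowerSeries ℂ) z = 0 := by
    intro z hz
    obtain ⟨θ, rfl⟩ := exists_circlePoint_eq hz
    rw [← boundaryValue_apply, h]
    rfl
  have hd : DiffContOnCl ℂ (seriesValue (f : PowerSeries ℂ)) (Metric.ball 0 1) := by
    refine ⟨fun z hz => (hg.hasDerivAt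
      (mem_ball_zero_iff.1 hz)).differentiableAt.differentiableWithinAt, ?_⟩
    rw [closure_ball _ one_ne_zero]
    exact continuousOn_seriesValue (f.2 0)
  have hM : ∀ z : ℂ, ‖z‖ < 1 → ‖seriesValue (f : PowerSeries ℂ) z‖ ≤ 0 := fun z hz =>
    Complex.norm_le_of_forall_mem_frontier_norm_le Metric.isBounded_ball hd (fun w hw => by
      rw [frontier_ball _ one_ne_zero] at hw
      rw [h0 w (mem_sphere_zero_iff_norm.1 hw), norm_zero])
      (subset_closure (mem_ball_zero_iff.2 hz))
  ext n
  simpa using hg.norm_coeff_le hM n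

/-- An `R`-symmetric polynomial is, on the unit circle, a constant times `z ^ N` times a positive
function. -/
theorem IsRSymmetric.exists_pos {N : ℕ} {P : ℂ[X]} (hP : IsRSymmetric N P) :
    ∃ C : ℂ, C ≠ 0 ∧ ∀ z : ℂ, ‖z‖ = 1 → ∃ w : ℝ, 0 < w ∧ P.eval z = C * z ^ N * w := by
  obtain ⟨hP0, -, s, hs, hs1, hroots⟩ := hP
  have key : ∀ s : Multiset ℂ, (∀ a ∈ s, a ≠ 0 ∧ ‖a‖ < 1) → ∃ C : ℂ, C ≠ 0 ∧ ∀ z : ℂ, ‖z‖ = 1 →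
      ∃ w : ℝ, 0 < w ∧ (s.map fun a => z - a).prod *
        (s.map fun a => z - 1 / (starRingEnd ℂ) a).prod = C * z ^ s.card * w := by
    intro s
    induction s using Multiset.induction with
    | empty => exact fun _ => ⟨1, one_ne_zero, fun z _ => ⟨1, one_pos, by simp⟩⟩
    | cons a s ih =>
      intro h
      obtain ⟨C, hC, hC'⟩ := ih fun b hb => h b (Multiset.mem_cons_of_mem hb)
      obtain ⟨ha0, ha1⟩ := h a (Multiset.mem_cons_self a s)
      have ha0' : (starRingEnd ℂ) a ≠ 0 := by simpa using ha0
      refine ⟨C * (-1 / (starRingEnd ℂ) a),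
        mul_ne_zero hC (div_ne_zero (neg_ne_zero.2 one_ne_zero) ha0'), fun z hz => ?_⟩
      obtain ⟨w, hw, e⟩ := hC' z hz
      have hza : z - a ≠ 0 := by
        intro h0
        rw [sub_eq_zero.1 h0] at hz
        exact absurd hz ha1.ne
      refine ⟨w * ‖z - a‖ ^ 2, mul_pos hw (pow_pos (norm_pos_iff.2 hza) 2), ?_⟩
      have hzz : z * (starRingEnd ℂ) z = 1 := by
        rw [Complex.mul_conj, Complex.normSq_eq_norm_sq, hz]; simp
      have hn : ((‖z - a‖ ^ 2 : ℝ) : ℂ) = (z - a) * ((starRingEnd ℂ) z - (starRingEnd ℂ) a) := by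
        rw [← map_sub, Complex.mul_conj, Complex.normSq_eq_norm_sq]
      -- On the circle a reflected factor is a constant times `z` times the conjugate of `z - a`, so
      -- each pair of roots contributes a constant times `z ‖z - a‖ ^ 2`. The roots at `0` supply
      -- the remaining powers of `z`.
      have h1 : z - 1 / (starRingEnd ℂ) a =
          -1 / (starRingEnd ℂ) a * (z * ((starRingEnd ℂ) z - (starRingEnd ℂ) a)) := by
        rw [mul_sub, hzz]
        field_simp
        ring
      rw [Multiset.map_cons, Multiset.map_cons, Multiset.prod_cons, Multiset.prod_cons,
        Multiset.card_cons, Complex.ofReal_mul, hn, h1, pow_succ]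
      linear_combination (z - a) * (-1 / (starRingEnd ℂ) a *
        (z * ((starRingEnd ℂ) z - (starRingEnd ℂ) a))) * e
  obtain ⟨C, hC, hC'⟩ := key s hs1
  refine ⟨P.leadingCoeff * C, mul_ne_zero (leadingCoeff_ne_zero.2 hP0) hC, fun z hz => ?_⟩
  obtain ⟨w, hw, e⟩ := hC' z hz
  refine ⟨w, hw, ?_⟩
  rw [(IsAlgClosed.splits P).eval_eq_prod_roots, hroots]
  simp only [Multiset.map_add, Multiset.prod_add, Multiset.map_replicate, sub_zero,
    Multiset.prod_replicate, Multiset.map_map, Function.comp_def]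
  have hN : z ^ N = z ^ s.card * z ^ (N - s.card) := by rw [← pow_add]; congr 1; omega
  rw [hN]
  linear_combination P.leadingCoeff * z ^ (N - s.card) * e

end Boundary

/-! ### The expression `L` in the adapted coordinate. -/

section Main

open scoped ContDiff

local notation "𝔡" => DFunLike.coe (PowerSeries.derivative ℂ)

/-- The density for which a leading coefficient on the circle becomes constant. -/
theorem exists_circleDensity {N : ℕ} (hN : N ≠ 0) {C : ℂ} (hC : C ≠ 0) {u : SmoothPeriodic}
    (hu : ∀ θ, ∃ w : ℝ, 0 < w ∧ (u : ℝ → ℂ) θ = C * circlePoint θ ^ N * w) :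
    ∃ (d : CircleDensity) (C₁ : ℂ), C₁ ≠ 0 ∧
      ∀ θ, (u : ℝ → ℂ) θ * ((circlePoint θ)⁻¹ * d.h θ) ^ N = C₁ := by
  choose w hw hwu using hu
  have hz : ∀ θ, circlePoint θ ≠ 0 := fun θ => Complex.exp_ne_zero _
  have hwe : ∀ θ, (w θ : ℂ) = (u : ℝ → ℂ) θ * C⁻¹ * (circlePoint θ ^ N)⁻¹ := fun θ => by
    rw [hwu]
    have := pow_ne_zero N (hz θ)
    field_simp
  have hws : ContDiff ℝ ∞ w := by
    have h1 : w = fun θ => Complex.reCLM ((u : ℝ → ℂ) θ * C⁻¹ * (circlePoint θ ^ N)⁻¹) := by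
      funext θ
      rw [← hwe]
      simp
    rw [h1]
    exact Complex.reCLM.contDiff.comp (((SmoothPeriodic.contDiff_coe u).mul contDiff_const).mul
      ((contDiff_circlePoint.pow N).inv fun θ => pow_ne_zero N (hz θ)))
  have hwp : Function.Periodic w (2 * Real.pi) := fun θ => by
    have h1 : (w (θ + 2 * Real.pi) : ℂ) = w θ := by
      have h2 := SmoothPeriodic.periodic_coe u θ
      rw [hwe, hwe, h2, periodic_circlePoint θ]
    exact_mod_cast h1
  -- The `N`-th power of this density cancels `w`. Rescaling by `κ` gives total mass `2π` and only
  -- changes the constant by `κ ^ N`.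
  set v : ℝ → ℝ := fun θ => w θ ^ (-(1 / (N : ℝ))) with hv
  have hvs : ContDiff ℝ ∞ v := hws.rpow_const_of_ne fun θ => (hw θ).ne'
  have hv0 : ∀ θ, 0 < v θ := fun θ => Real.rpow_pos_of_pos (hw θ) _
  have hvN : ∀ θ, v θ ^ N = (w θ)⁻¹ := fun θ => by
    rw [hv, ← Real.rpow_natCast, ← Real.rpow_mul (hw θ).le, neg_mul, one_div,
      inv_mul_cancel₀ (Nat.cast_ne_zero.2 hN), Real.rpow_neg_one]
  set I := ∫ θ in (0 : ℝ)..2 * Real.pi, v θ with hI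
  have hpi : (0 : ℝ) < 2 * Real.pi := by positivity
  have hI0 : 0 < I := intervalIntegral.intervalIntegral_pos_of_pos
    (hvs.continuous.intervalIntegrable _ _) hv0 hpi
  set κ := 2 * Real.pi / I with hκ
  have hκ0 : 0 < κ := by positivity
  refine ⟨⟨fun θ => κ * v θ, contDiff_const.mul hvs, fun θ => by simp only [hv, hwp θ],
    fun θ => mul_pos hκ0 (hv0 θ), ?_⟩, C * κ ^ N,
    mul_ne_zero hC (pow_ne_zero _ (by exact_mod_cast hκ0.ne')), fun θ => ?_⟩
  · rw [intervalIntegral.integral_const_mul, ← hI, hκ, div_mul_cancel₀ _ hI0.ne']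
  · have h1 : ((v θ : ℝ) : ℂ) ^ N = (w θ : ℂ)⁻¹ := by exact_mod_cast hvN θ
    have h2 : (w θ : ℂ) ≠ 0 := by exact_mod_cast (hw θ).ne'
    have h3 := pow_ne_zero N (hz θ)
    rw [hwu]
    push_cast
    rw [mul_pow, mul_pow, h1, inv_pow]
    field_simp

/-- The coefficient relating `d/dz` on the circle to the derivation of a density. -/
noncomputable def CircleDensity.factor (d : CircleDensity) : SmoothPeriodic :=
  ⟨fun θ => (circlePoint θ)⁻¹ * d.h θ,
    (contDiff_circlePoint.inv fun _ => Complex.exp_ne_zero _).mul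
      (Complex.ofRealCLM.contDiff.comp d.smooth),
    fun θ => by simp only [periodic_circlePoint θ, d.periodic θ]⟩

/-- Along the circle `d/dθ = i z d/dz`, so `d/dz = z⁻¹ h δ` with `δ = -i h⁻¹ d/dθ`. -/
theorem CircleDensity.boundaryValue_derivative (d : CircleDensity) {f : PowerSeries ℂ}
    (hf : f ∈ smoothSeries) : boundaryValue ⟨𝔡 f, smoothSeries_derivative hf⟩ =
      d.factor * d.delta (boundaryValue ⟨f, hf⟩) := by
  ext θ
  have h1 : deriv (boundaryValue ⟨f, hf⟩ : ℝ → ℂ) θ = _ :=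
    (hasDerivAt_seriesValue_circlePoint hf θ).deriv
  have hz : circlePoint θ ≠ 0 := Complex.exp_ne_zero _
  have hh : (d.h θ : ℂ) ≠ 0 := by exact_mod_cast (d.pos θ).ne'
  rw [boundaryValue_apply, Subalgebra.coe_mul, Pi.mul_apply, d.delta_apply, h1]
  show _ = (circlePoint θ)⁻¹ * d.h θ * _
  push_cast
  field_simp
  rw [Complex.I_sq]
  ring

theorem CircleDensity.boundaryValue_iterate (d : CircleDensity) {f : PowerSeries ℂ}
    (hf : f ∈ smoothSeries) (k : ℕ) : boundaryValue ⟨𝔡^[k] f, smoothSeries_iterate hf k⟩ =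
      (fun v => d.factor * d.delta v)^[k] (boundaryValue ⟨f, hf⟩) := by
  induction k with
  | zero => rfl
  | succ k ih =>
    rw [Function.iterate_succ_apply' (fun v => d.factor * d.delta v), ← ih,
      ← d.boundaryValue_derivative]
    congr 2
    exact Function.iterate_succ_apply' _ _ _

theorem CircleDensity.boundaryValue_diffExpr (d : CircleDensity) {N : ℕ} {p : ℕ → ℂ → ℂ}
    (hp : ∀ k ≤ N, taylorSeries (p k) ∈ smoothSeries) {P : ℕ → SmoothPeriodic}
    (hP : ∀ k (hk : k ≤ N), P k = boundaryValue ⟨_, hp k hk⟩)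
    {f : PowerSeries ℂ} (hf : f ∈ smoothSeries) (hLf : diffExpr N p f ∈ smoothSeries) :
    boundaryValue ⟨_, hLf⟩ = ∑ k ∈ Finset.range (N + 1),
      P k * (fun v => d.factor * d.delta v)^[k] (boundaryValue ⟨f, hf⟩) := by
  ext θ
  have hs : ∀ k ∈ Finset.range (N + 1), SummableAt (taylorSeries (p k)) ‖circlePoint θ‖ ∧
      SummableAt (𝔡^[k] f) ‖circlePoint θ‖ := fun k hk =>
    ⟨smoothSeries_summableAt (hp k (Nat.lt_succ_iff.1 (Finset.mem_range.1 hk)))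
      (norm_circlePoint θ).le,
      smoothSeries_summableAt (smoothSeries_iterate hf k) (norm_circlePoint θ).le⟩
  rw [boundaryValue_apply]
  simp only
  rw [diffExpr_apply, (summableAt_sum _ fun k hk => ((hs k hk).1.mul (hs k hk).2).1).2,
    AddSubmonoidClass.coe_finsetSum, Finset.sum_apply]
  refine Finset.sum_congr rfl fun k hk => ?_
  rw [((hs k hk).1.mul (hs k hk).2).2, ← d.boundaryValue_iterate,
    hP k (Nat.lt_succ_iff.1 (Finset.mem_range.1 hk))]
  rfl

theorem one_mem_smoothSeries : (1 : PowerSeries ℂ) ∈ smoothSeries := by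
  refine mem_smoothSeries_of_bounded ⟨1, 0, fun n => ?_⟩ fun k => ?_
  · rw [PowerSeries.coeff_one]
    split_ifs <;> simp
  · rcases k with _ | k
    · refine ⟨1, fun z _ => ?_⟩
      have : seriesValue (1 : PowerSeries ℂ) z = 1 := by
        unfold seriesValue
        rw [tsum_eq_single 0 (fun n hn => by simp [PowerSeries.coeff_one, hn])]
        simp
      simp [this]
    · refine ⟨0, fun z _ => ?_⟩
      rw [Function.iterate_succ_apply, PowerSeries.derivative_one, iterate_map_zero]
      simp [seriesValue]

/-- Elements `f` of the weighted Hardy space for which `L f - λ f` is smooth are smooth. -/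
theorem mem_smoothSeries_of_diffExpr_sub {σ : ℝ} (hσ : 0 < σ) {N : ℕ} (hN : N ≠ 0)
    {p : ℕ → ℂ → ℂ} (hreg : IsDRegular N p) {f : PowerSeries ℂ} (hf : f ∈ weightedHardy σ)
    {lam : ℂ} (h : diffExpr N p f - lam • f ∈ smoothSeries) : f ∈ smoothSeries := by
  -- The spectral parameter is absorbed into the coefficient of order zero; as `N ≠ 0`, the leading
  -- coefficient is untouched.
  refine mem_smoothSeries_of_ode (N := N)
    (q := fun k => taylorSeries (p k) - if k = 0 then lam • 1 else 0) (fun k hk => ?_)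
    (fun z hz => ?_) (polynomialGrowth_of_mem_weightedHardy hσ hf) ?_
  · refine Submodule.sub_mem _ (taylorSeries_mem_smoothSeries (hreg.1 k hk)) ?_
    split_ifs
    · exact Submodule.smul_mem _ _ one_mem_smoothSeries
    · exact Submodule.zero_mem _
  · simp only [if_neg hN, sub_zero]
    rw [seriesValue_taylorSeries (hreg.1 N le_rfl) hz.le]
    exact hreg.2 z hz
  · convert h using 1
    rw [diffExpr_apply]
    simp only [sub_mul, Finset.sum_sub_distrib, ite_mul, zero_mul]
    congr 1
    simp

end Main

/-! ### Transfer of root vectors and the conclusion. -/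

section Intertwining

/-- On smooth series a `𝔻`-regular expression with `R`-symmetric leading coefficient is equivalent
to a multiple of a perturbed power. -/
theorem exists_intertwining {k : ℕ} {p : ℕ → ℂ → ℂ} (hreg : IsDRegular (k + 2) p) {P : ℂ[X]}
    (hP : IsRSymmetric (k + 2) P)
    (hpP : ∀ z ∈ Metric.closedBall (0 : ℂ) 1, p (k + 2) z = P.eval z) :
    ∃ (C₁ α : ℂ) (A : Module.End ℂ SmoothPeriodic) (c : ℤ → SmoothPeriodic →ₗ[ℂ] ℂ) (K : ℝ)
      (Ψ : smoothSeries →ₗ[ℂ] SmoothPeriodic), C₁ ≠ 0 ∧ DiagonalPerturbation A c α k K ∧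
      (∀ f, Ψ f = 0 → f = 0) ∧ ∀ (f : PowerSeries ℂ) (hf : f ∈ smoothSeries)
        (hLf : diffExpr (k + 2) p f ∈ smoothSeries), Ψ ⟨_, hLf⟩ = C₁ • A (Ψ ⟨f, hf⟩) := by
  have hp : ∀ j ≤ k + 2, taylorSeries (p j) ∈ smoothSeries := fun j hj =>
    taylorSeries_mem_smoothSeries (hreg.1 j hj)
  let Q : ℕ → SmoothPeriodic := fun j =>
    if h : j ≤ k + 2 then boundaryValue ⟨_, hp j h⟩ else 0
  have hQ : ∀ j (hj : j ≤ k + 2), Q j = boundaryValue ⟨_, hp j hj⟩ := fun j hj => dif_pos hj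
  have hQv : ∀ θ, (Q (k + 2) : ℝ → ℂ) θ = P.eval (circlePoint θ) := fun θ => by
    rw [hQ _ le_rfl, boundaryValue_apply,
      seriesValue_taylorSeries (hreg.1 _ le_rfl) (norm_circlePoint θ).le,
      hpP _ (mem_closedBall_zero_iff.2 (norm_circlePoint θ).le)]
  obtain ⟨C, hC, hw⟩ := hP.exists_pos
  obtain ⟨d, C₁, hC₁, hd⟩ := exists_circleDensity (N := k + 2) (by omega) hC
    (u := Q (k + 2)) fun θ => by
      rw [hQv]
      exact hw _ (norm_circlePoint θ)
  have hlead : Q (k + 2) * d.factor ^ (k + 2) = algebraMap ℂ SmoothPeriodic C₁ := by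
    ext θ
    exact hd θ
  obtain ⟨α, E, E', b, hE, hform⟩ := exists_normal_form d.delta Q d.factor k hC₁ hlead
    d.exists_gauge
  obtain ⟨K, hK⟩ := exists_diagonalPerturbation d.coeff_delta d.sqSummable_coeff
    d.eq_zero_of_coeff_eq_zero d.exists_l2_mul_le α k b
  have hE2 : ∀ v, E * (E' * v) = v := fun v => by
    rw [← mul_assoc, mul_comm E, hE, one_mul]
  refine ⟨C₁, α, _, _, K, LinearMap.mulLeft ℂ E' ∘ₗ boundaryValue, hC₁, hK, fun f hf => ?_,
    fun f hf hLf => ?_⟩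
  · refine eq_zero_of_boundaryValue_eq_zero ?_
    rw [← hE2 (boundaryValue f)]
    simp only [LinearMap.comp_apply, LinearMap.mulLeft_apply] at hf
    rw [hf, mul_zero]
  · simp only [LinearMap.comp_apply, LinearMap.mulLeft_apply]
    rw [d.boundaryValue_diffExpr hp hQ hf hLf, perturbedPower_apply, ← hform, hE2]

variable {E : Type*} [AddCommGroup E] [Module ℂ E]

theorem mem_nullPow_succ {T : E →ₗ.[ℂ] E} {lam : ℂ} {j : ℕ} {f : E} :
    f ∈ nullPow T lam (j + 1) ↔ ∃ g : T.domain, T g - lam • (g : E) ∈ nullPow T lam j ∧ g = f :=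
  Iff.rfl

theorem monotone_nullPow (T : E →ₗ.[ℂ] E) (lam : ℂ) : Monotone (nullPow T lam) := by
  refine monotone_nat_of_le_succ fun j => ?_
  induction j with
  | zero => exact bot_le
  | succ j ih =>
    intro f hf
    obtain ⟨g, hg, rfl⟩ := mem_nullPow_succ.1 hf
    exact mem_nullPow_succ.2 ⟨g, ih hg, rfl⟩

theorem mem_iSup_nullPow {T : E →ₗ.[ℂ] E} {lam : ℂ} {f : E} :
    f ∈ ⨆ j, nullPow T lam j ↔ ∃ j, f ∈ nullPow T lam j :=
  Submodule.mem_iSup_of_directed _ (monotone_nullPow T lam).directed_le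

variable {V : Type*} [AddCommGroup V] [Module ℂ V]

/-- Root vectors of the maximal operator are smooth, and are mapped to root vectors. -/
theorem map_nullPow {σ : ℝ} (hσ : 0 < σ) {N : ℕ} (hN : N ≠ 0) {p : ℕ → ℂ → ℂ}
    (hreg : IsDRegular N p) {C₁ : ℂ} (hC₁ : C₁ ≠ 0) {A : Module.End ℂ V}
    {Ψ : smoothSeries →ₗ[ℂ] V} (hΨ : ∀ (f : PowerSeries ℂ) (hf : f ∈ smoothSeries)
        (hLf : diffExpr N p f ∈ smoothSeries), Ψ ⟨_, hLf⟩ = C₁ • A (Ψ ⟨f, hf⟩))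
    (lam : ℂ) (j : ℕ) : ∀ f ∈ nullPow (maximalOperator σ N p) lam j,
      ∃ hf : (f : PowerSeries ℂ) ∈ smoothSeries,
        ((A - algebraMap ℂ (Module.End ℂ V) (lam / C₁)) ^ j) (Ψ ⟨f, hf⟩) = 0 := by
  induction j with
  | zero =>
    intro f hf
    obtain rfl : f = 0 := hf
    exact ⟨Submodule.zero_mem _, map_zero Ψ⟩
  | succ j ih =>
    intro f hf
    obtain ⟨g, hg, rfl⟩ := mem_nullPow_succ.1 hf
    obtain ⟨h1, h2⟩ := ih _ hg
    have e : (((maximalOperator σ N p) g - lam • (g : weightedHardy σ) : weightedHardy σ) :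
      PowerSeries ℂ) = diffExpr N p g.1.1 - lam • g.1.1 := rfl
    -- By induction the image of `g` under the operator minus `λ` is already smooth, so regularity
    -- applies to the inhomogeneous equation.
    have hs : g.1.1 ∈ smoothSeries :=
      mem_smoothSeries_of_diffExpr_sub hσ hN hreg g.1.2 (e ▸ h1)
    have hL : diffExpr N p g.1.1 ∈ smoothSeries := by
      have := Submodule.add_mem _ h1 (Submodule.smul_mem _ lam hs)
      rwa [e, sub_add_cancel] at this
    refine ⟨hs, ?_⟩
    have e2 : Ψ ⟨_, h1⟩ = C₁ • (A - algebraMap ℂ (Module.End ℂ V) (lam / C₁)) (Ψ ⟨g.1.1, hs⟩) := by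
      have e3 : (⟨_, h1⟩ : smoothSeries) = ⟨_, hL⟩ - lam • ⟨g.1.1, hs⟩ := Subtype.ext e
      rw [e3, map_sub, map_smul, hΨ _ hs, LinearMap.sub_apply, Module.algebraMap_end_apply,
        smul_sub, smul_smul, mul_div_cancel₀ _ hC₁]
    rw [e2, map_smul] at h2
    rw [pow_succ, Module.End.mul_apply]
    exact (smul_eq_zero.1 h2).resolve_left hC₁

/-- Eigenfunctions of the maximal operator are mapped to eigenvectors. -/
theorem IsEigenvalue.exists_eigenvector {σ : ℝ} (hσ : 0 < σ) {N : ℕ} (hN : N ≠ 0) {p : ℕ → ℂ → ℂ}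
    (hreg : IsDRegular N p) {C₁ : ℂ} (hC₁ : C₁ ≠ 0) {A : Module.End ℂ V}
    {Ψ : smoothSeries →ₗ[ℂ] V} (hinj : ∀ f, Ψ f = 0 → f = 0)
    (hΨ : ∀ (f : PowerSeries ℂ) (hf : f ∈ smoothSeries)
        (hLf : diffExpr N p f ∈ smoothSeries), Ψ ⟨_, hLf⟩ = C₁ • A (Ψ ⟨f, hf⟩))
    {lam : ℂ} (h : IsEigenvalue (maximalOperator σ N p) lam) :
    ∃ u : V, u ≠ 0 ∧ A u = (lam / C₁) • u := by
  obtain ⟨f, hf0, hf⟩ := h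
  obtain ⟨hs, h1⟩ := map_nullPow hσ hN hreg hC₁ hΨ lam 1 f
    (mem_nullPow_succ.2 ⟨f, by rw [hf, sub_self]; exact Submodule.zero_mem _, rfl⟩)
  refine ⟨Ψ ⟨_, hs⟩, fun h0 => hf0 (Subtype.ext ?_), ?_⟩
  · exact congrArg (fun g : smoothSeries => (g : PowerSeries ℂ)) (hinj ⟨_, hs⟩ h0)
  rwa [pow_one, LinearMap.sub_apply, sub_eq_zero, Module.algebraMap_end_apply] at h1

theorem rank_le_card_of_forall_eq_zero {M : Type*} [AddCommGroup M] [Module ℂ M] {I : Finset ℤ}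
    (F : M →ₗ[ℂ] I → ℂ) (hF : ∀ f, F f = 0 → f = 0) : Module.rank ℂ M ≤ I.card := by
  have h := LinearMap.lift_rank_le_of_injective F ((injective_iff_map_eq_zero F).2 hF)
  rw [rank_fun'] at h
  simpa using h

/-- The whole root space embeds linearly into the coordinates in `I`, through the injection `Ψ` and
the root vectors of `A`. -/
theorem algMultiplicity_le_card {σ : ℝ} (hσ : 0 < σ) {N : ℕ} (hN : N ≠ 0) {p : ℕ → ℂ → ℂ}
    (hreg : IsDRegular N p) {C₁ : ℂ} (hC₁ : C₁ ≠ 0) {A : Module.End ℂ V}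
    {Ψ : smoothSeries →ₗ[ℂ] V} (hinj : ∀ f, Ψ f = 0 → f = 0)
    (hΨ : ∀ (f : PowerSeries ℂ) (hf : f ∈ smoothSeries)
        (hLf : diffExpr N p f ∈ smoothSeries), Ψ ⟨_, hLf⟩ = C₁ • A (Ψ ⟨f, hf⟩))
    {c : ℤ → V →ₗ[ℂ] ℂ} {lam : ℂ} {I : Finset ℤ}
    (hI : ∀ v, (∃ j : ℕ, ((A - algebraMap ℂ (Module.End ℂ V) (lam / C₁)) ^ j) v = 0) →
      (∀ n ∈ I, c n v = 0) → v = 0) :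
    algMultiplicity (maximalOperator σ N p) lam ≤ I.card := by
  let S := ⨆ j, nullPow (maximalOperator σ N p) lam j
  have hS : ∀ f : S, ∃ (j : ℕ) (hf : (f : PowerSeries ℂ) ∈ smoothSeries),
      ((A - algebraMap ℂ (Module.End ℂ V) (lam / C₁)) ^ j) (Ψ ⟨_, hf⟩) = 0 := fun f => by
    obtain ⟨j, hj⟩ := mem_iSup_nullPow.1 f.2
    exact ⟨j, map_nullPow hσ hN hreg hC₁ hΨ lam j _ hj⟩
  let ι : S →ₗ[ℂ] smoothSeries := LinearMap.codRestrict smoothSeries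
    ((weightedHardy σ).subtype ∘ₗ S.subtype) fun f => (hS f).choose_spec.choose
  let F : S →ₗ[ℂ] I → ℂ := LinearMap.pi fun n => c n ∘ₗ Ψ ∘ₗ ι
  refine (rank_le_card_of_forall_eq_zero (M := S) F fun f hf => ?_ : Module.rank ℂ S ≤ I.card)
  obtain ⟨j, hs, hj⟩ := hS f
  have h0 := hI _ ⟨j, hj⟩ fun n hn => congrFun hf ⟨n, hn⟩
  refine Subtype.ext (Subtype.ext ?_)
  exact congrArg (fun g : smoothSeries => (g : PowerSeries ℂ)) (hinj ⟨_, hs⟩ h0)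

theorem isBigO_of_eventually_le {μ : ℤ → ℂ} {α : ℂ} {k : ℕ} {K : ℝ} (hK : 0 < K)
    (h : ∀ᶠ n in Filter.cofinite,
      ‖μ n - ((n : ℂ) + α) ^ (k + 2)‖ ≤ 2 * (K * (1 + ‖(n : ℂ) + α‖) ^ k))
    {ε : ℝ} (hε : 0 < ε) :
    (fun n : ℤ => μ n - ((n : ℂ) + α) ^ (k + 2)) =O[Filter.cofinite]
      (fun n : ℤ => |(n : ℝ)| ^ (((k + 2 : ℕ) : ℝ) - 2 + ε)) := by
  refine Asymptotics.IsBigO.of_bound (2 * (K * (2 + ‖α‖) ^ k)) ?_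
  filter_upwards [h, (Set.finite_singleton (0 : ℤ)).compl_mem_cofinite] with n hn hn0
  have h1 : (1 : ℝ) ≤ |(n : ℝ)| := by
    exact_mod_cast Int.one_le_abs hn0
  have h2 : 1 + ‖(n : ℂ) + α‖ ≤ (2 + ‖α‖) * |(n : ℝ)| := by
    have h3 := norm_add_le (n : ℂ) α
    rw [Complex.norm_intCast] at h3
    nlinarith [norm_nonneg α]
  have h4 : |(n : ℝ)| ^ k ≤ |(n : ℝ)| ^ (((k + 2 : ℕ) : ℝ) - 2 + ε) := by
    rw [← Real.rpow_natCast]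
    refine Real.rpow_le_rpow_of_exponent_le h1 ?_
    push_cast
    linarith
  rw [Real.norm_of_nonneg (by positivity)]
  calc _ ≤ 2 * (K * (1 + ‖(n : ℂ) + α‖) ^ k) := hn
    _ ≤ 2 * (K * ((2 + ‖α‖) * |(n : ℝ)|) ^ k) := by gcongr
    _ = 2 * (K * (2 + ‖α‖) ^ k) * |(n : ℝ)| ^ k := by rw [mul_pow]; ring
    _ ≤ _ := by gcongr

end Intertwining

theorem mainTheorem4 (σ : ℝ) (hσ : 0 < σ) (N : ℕ) (hN : 2 ≤ N) (p : ℕ → ℂ → ℂ)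
    (hreg : IsDRegular N p)
    (P : ℂ[X]) (hP : IsRSymmetric N P) (hpP : ∀ z ∈ Metric.closedBall (0 : ℂ) 1, p N z = P.eval z) :
    (∃ (C₁ : ℂ) (τ : ℝ) (C₂ : ℂ), C₁ ≠ 0 ∧ 0 < τ ∧
      ∀ ε : ℝ, 0 < ε → ε < 1 →
        ∃ μ : ℤ → ℂ,
          (∀ lam : ℂ, IsEigenvalue (maximalOperator σ N p) lam → ∃ n : ℤ, lam = μ n) ∧
          (fun n : ℤ => μ n / C₁ - ((n : ℂ) / (τ : ℂ) + C₂) ^ N) =O[Filter.cofinite]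
            (fun n : ℤ => |(n : ℝ)| ^ ((N : ℝ) - 2 + ε))) ∧
    ∃ R : ℝ, ∀ lam : ℂ, IsEigenvalue (maximalOperator σ N p) lam → R < ‖lam‖ →
      algMultiplicity (maximalOperator σ N p) lam ≤ 2 := by
  obtain ⟨k, rfl⟩ := Nat.exists_eq_add_of_le' hN
  have hN0 : k + 2 ≠ 0 := by omega
  obtain ⟨C₁, α, A, c, K, Ψ, hC₁, hA, hinj, hΨ⟩ := exists_intertwining hreg hP hpP
  -- Here `τ = 1` because the density was normalised to total mass `2π`. The sequence does not
  -- depend on `ε`; the estimate obtained is in fact of order `|n| ^ (N - 2)`.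
  refine ⟨⟨C₁, 1, α, hC₁, one_pos, fun ε hε _ => ?_⟩, ?_⟩
  · obtain ⟨μ, hμ, hμb⟩ := hA.exists_enumeration
    refine ⟨fun n => C₁ * μ n, fun lam hlam => ?_, ?_⟩
    · obtain ⟨u, hu0, hu⟩ := hlam.exists_eigenvector hσ hN0 hreg hC₁ hinj hΨ
      obtain ⟨n, hn⟩ := hμ _ u hu0 hu
      exact ⟨n, by simp only [← hn, mul_div_cancel₀ _ hC₁]⟩
    · simpa [hC₁] using isBigO_of_eventually_le hA.pos hμb hε
  · obtain ⟨R, hR⟩ := hA.exists_multiplicity_bound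
    -- Eigenvalues of `A` are those of the maximal operator divided by `C₁`, so the threshold is
    -- rescaled.
    refine ⟨R * ‖C₁‖, fun lam hlam hl => ?_⟩
    obtain ⟨u, hu0, hu⟩ := hlam.exists_eigenvector hσ hN0 hreg hC₁ hinj hΨ
    obtain ⟨I, hI2, hI⟩ := hR _ u hu0 hu <| by
      rwa [norm_div, lt_div_iff₀ (norm_pos_iff.2 hC₁)]
    exact (algMultiplicity_le_card hσ hN0 hreg hC₁ hinj hΨ hI).trans (by exact_mod_cast hI2)
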